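/- Setting. An inverse system $X_0 \xleftarrow{\pi_0} X_1 \xleftarrow{\pi_1} X_2 \leftarrow \cdots$ of metric graphs is called admissible with data $(m,\eta,\Delta)$, where $2\le m\in\mathbb N$, $\eta>0$, $\Delta>0$, if for every $i\ge 0$: (1) $(X_i,d_i)$ is a nonempty connected graph with all vertices of valence at most $\Delta$, and every edge of $X_i$ is isometric to an interval of length $m^{-i}$ with respect to the path metric $d_i$; (2) $(X_0,d_0)$ is isometric to $[0,1]$; (3) if $X_i'$ denotes the graph obtained by subdividing each edge of $X_i$ into $m$ edges of length $m^{-(i+1)}$, then $\pi_i:(X_{i+1},d_{i+1})\to (X_i',d_i)$ is open, simplicial, and an isometry on every edge; (4) for every $x\in X_i'$ the fiber $\pi_i^{-1}(x)\subset X_{i+1}$ has $d_{i+1}$-diameter at most $\eta m^{-i}$. Its limit is $X=\{(v_i)\in\prod_{i\ge0} X_i : \pi_i(v_{i+1})=v_i \text{ for all } i\ge 0\}$ with the metric $d((v_i),(w_i))=\lim_{i\to\infty} d_i(v_i,w_i)$ (the sequence is nondecreasing). A monotone geodesic in $X$ is a set $L\subset X$ such that the projection $(v_i)\mapsto v_0$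 restricts to an isometry of $L$ onto $X_0\cong[0,1]$. For $E\subset X$ and a ball $B\subset X$ let $$\beta_E(B)=\frac1{\operatorname{diam}(B)}\,\inf_{L}\ \sup_{x\in E\cap B}\operatorname{dist}(x,L),$$ where the infimum is over all monotone geodesics $L$ in $X$ (and the supremum is $0$ if $E\cap B=\emptyset$). Fix an integer $A\ge 1$. For every $n\ge0$ and every edge $e$ of $X_n$ choose a point $p_e\in X$ whose $n$-th coordinate is the center of $e$, and let $\mathcal B$ be the family of open balls $B(e)=B(p_e,Am^{-n})\subset X$, indexed by all pairs $(n,e)$ with $n\ge 0$ and $e$ an edge of $X_n$. Theorem 1.5. For all $p>1$, $m$, $\eta$, $\Delta$ and $A$ as above there is a constant $C>0$, depending only on $p,m,\eta,\Delta,A$, such that for every admissible inverse system with data $(m,\eta,\Delta)$ and limit $X$, every choice of the points $p_e$, and every compact connected set $\Gamma\subset X$, $$\sum_{B\in\mathcal B}\beta_\Gamma(B)^p\,\operatorname{diam}(B)\ \le\ C\,\mathcal H^1(\Gamma),$$ where $\mathcal H^1$ is the one-dimensional Hausdorff measure on $X$. -/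

import Mathlib

open Set Filter Topology MeasureTheory
open scoped ENNReal

universe u

/-- Combinatorial data of a graph drawn on the set `X`: a set of vertices and a family of edges
of the same length, each parametrized by the interval `[0, edgeLength]`
(values of `edge e` outside of that interval play no role). Several edges may join the same
two vertices. -/
structure GraphData (X : Type u) where
  vertices : Set X
  edgeLength : ℝ
  Edge : Type u
  edge : Edge → ℝ → X

namespace GraphData

variable {X : Type u}

/-- The closed edge, as a subset of `X`. -/
def edgeSet (G : GraphData X) (e : G.Edge) : Set X :=
  G.edge e '' Icc 0 G.edgeLength

/-- The center point of an edge. -/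
noncomputable def midpoint (G : GraphData X) (e : G.Edge) : X :=
  G.edge e (G.edgeLength / 2)

/-- `G.PathLength x y L`: there is a path in the graph from `x` to `y`, made of finitely many
segments each of which runs inside one edge, of total length `L`. -/
inductive PathLength (G : GraphData X) : X → X → ℝ → Prop
  | nil (x : X) : PathLength G x x 0
  | cons (e : G.Edge) (s t : ℝ) (hs : s ∈ Icc 0 G.edgeLength) (ht : t ∈ Icc 0 G.edgeLength)
      (y : X) (L : ℝ) (h : PathLength G (G.edge e t) y L) :
      PathLength G (G.edge e s) y (|s - t| + L)

/-- The metric space `X`, with the vertices and edges of `G`, is a nonempty connected metric graph: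
it is the union of the vertices and edges, distinct edges meet in vertices only, the vertices on
an edge are its two endpoints, the metric of `X` is the path metric of the graph, and with
respect to it every edge is isometric to the interval `[0, edgeLength]`.
Connectedness is part of `isGLB_dist`, as the empty set of reals has no greatest lower bound. -/
structure IsMetricGraph [MetricSpace X] (G : GraphData X) : Prop where
  nonempty : Nonempty X
  edgeLength_pos : 0 < G.edgeLength
  cover : ∀ x : X, x ∈ G.vertices ∨ ∃ e, x ∈ G.edgeSet e
  edge_mem_vertices : ∀ e, ∀ t ∈ Icc 0 G.edgeLength,
    (G.edge e t ∈ G.vertices ↔ t = 0 ∨ t = G.edgeLength)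
  inter_subset : ∀ e e', e ≠ e' → G.edgeSet e ∩ G.edgeSet e' ⊆ G.vertices
  dist_edge : ∀ e, ∀ s ∈ Icc 0 G.edgeLength, ∀ t ∈ Icc 0 G.edgeLength,
    dist (G.edge e s) (G.edge e t) = |s - t|
  isGLB_dist : ∀ x y : X, IsGLB {L : ℝ | G.PathLength x y L} (dist x y)

/-- Every vertex has valence at most `Δ`. (Edges of a metric graph as above are not loops.) -/
def ValenceLE (G : GraphData X) (Δ : ℝ) : Prop :=
  ∀ v ∈ G.vertices, {e | v ∈ G.edgeSet e}.Finite ∧ ({e | v ∈ G.edgeSet e}.ncard : ℝ) ≤ Δ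

/-- The graph obtained by subdividing each edge into `m` edges of equal length. -/
noncomputable def subdivide (G : GraphData X) (m : ℕ) : GraphData X where
  vertices := G.vertices ∪ {x | ∃ e, ∃ k : ℕ, k ≤ m ∧ x = G.edge e (k * (G.edgeLength / m))}
  edgeLength := G.edgeLength / m
  Edge := G.Edge × Fin m
  edge := fun e t => G.edge e.1 ((e.2 : ℕ) * (G.edgeLength / m) + t)

/-- Simplicial maps that collapse no edge: vertices go to vertices, and edges go onto edges. -/
def IsSimplicial {Y : Type u} (G : GraphData X) (H : GraphData Y) (f : X → Y) : Prop :=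
  MapsTo f G.vertices H.vertices ∧ ∀ e, ∃ e', f '' G.edgeSet e = H.edgeSet e'

end GraphData

/-- Admissible inverse systems `X₀ ← X₁ ← X₂ ← ⋯` of metric graphs, with data `m, η, Δ`. -/
structure AdmissibleSystem (m : ℕ) (η Δ : ℝ) where
  Space : ℕ → Type u
  [metric : ∀ i, MetricSpace (Space i)]
  graph : ∀ i, GraphData (Space i)
  proj : ∀ i, Space (i + 1) → Space i
  isMetricGraph : ∀ i, (graph i).IsMetricGraph
  edgeLength_eq : ∀ i, (graph i).edgeLength = ((m : ℝ) ^ i)⁻¹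
  valence_le : ∀ i, (graph i).ValenceLE Δ
  isometric_unitInterval : Nonempty (Space 0 ≃ᵢ Icc (0 : ℝ) 1)
  isOpenMap_proj : ∀ i, IsOpenMap (proj i)
  isSimplicial_proj : ∀ i, (graph (i + 1)).IsSimplicial ((graph i).subdivide m) (proj i)
  isometry_on_edge : ∀ i, ∀ e, ∀ x ∈ (graph (i + 1)).edgeSet e, ∀ y ∈ (graph (i + 1)).edgeSet e,
    dist (proj i x) (proj i y) = dist x y
  ediam_fiber_le : ∀ i, ∀ x : Space i,
    Metric.ediam (proj i ⁻¹' {x}) ≤ ENNReal.ofReal (η * ((m : ℝ) ^ i)⁻¹)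

namespace AdmissibleSystem

attribute [instance] AdmissibleSystem.metric

variable {m : ℕ} {η Δ : ℝ}

/-- The underlying set of the inverse limit. -/
@[ext]
structure Limit (S : AdmissibleSystem.{u} m η Δ) where
  coord : ∀ i, S.Space i
  proj_coord : ∀ i, S.proj i (coord (i + 1)) = coord i

/-- The metric of the inverse limit. The distances of the coordinates increase, so their supremum
is their limit; see `tendsto_edist_coord`. -/
noncomputable instance (S : AdmissibleSystem.{u} m η Δ) : EMetricSpace S.Limit where
  edist v w := ⨆ i, edist (v.coord i) (w.coord i)
  edist_self v := by simp
  edist_comm v w := by simp only [edist_comm]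
  edist_triangle u v w := iSup_le fun i =>
    (edist_triangle _ (v.coord i) _).trans
      (add_le_add (le_iSup (fun i => edist (u.coord i) (v.coord i)) i)
        (le_iSup (fun i => edist (v.coord i) (w.coord i)) i))
  eq_of_edist_eq_zero {v w} h := by
    ext i
    exact edist_le_zero.1 ((le_iSup (fun i => edist (v.coord i) (w.coord i)) i).trans h.le)

noncomputable instance (S : AdmissibleSystem.{u} m η Δ) : MeasurableSpace S.Limit := borel _

instance (S : AdmissibleSystem.{u} m η Δ) : BorelSpace S.Limit := ⟨rfl⟩

theorem edist_def (S : AdmissibleSystem.{u} m η Δ) (v w : S.Limit) :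
    edist v w = ⨆ i, edist (v.coord i) (w.coord i) := rfl

theorem dist_proj_le (S : AdmissibleSystem.{u} m η Δ) (i : ℕ) (x y : S.Space (i + 1)) :
    dist (S.proj i x) (S.proj i y) ≤ dist x y := by
  refine ((S.isMetricGraph (i + 1)).isGLB_dist x y).2 ?_
  intro L hL
  induction hL with
  | nil x => simp
  | cons e s t hs ht y L h ih =>
    refine (dist_triangle _ (S.proj i ((S.graph (i + 1)).edge e t)) _).trans (add_le_add ?_ ih)
    rw [S.isometry_on_edge i e _ ⟨s, hs, rfl⟩ _ ⟨t, ht, rfl⟩,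
      (S.isMetricGraph (i + 1)).dist_edge e s hs t ht]

theorem tendsto_edist_coord (S : AdmissibleSystem.{u} m η Δ) (v w : S.Limit) :
    Tendsto (fun i => edist (v.coord i) (w.coord i)) atTop (𝓝 (edist v w)) := by
  refine tendsto_atTop_iSup (monotone_nat_of_le_succ fun i => ?_)
  rw [← v.proj_coord i, ← w.proj_coord i, edist_dist, edist_dist]
  exact ENNReal.ofReal_le_ofReal (S.dist_proj_le i _ _)

/-- Monotone geodesics of the limit: subsets `L` such that the projection to `X₀ ≅ [0,1]` restricts
to an isometry of `L` onto `X₀`. (Such a set is an arc, and a geodesic.) -/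
def IsMonotoneGeodesic (S : AdmissibleSystem.{u} m η Δ) (L : Set S.Limit) : Prop :=
  (∀ x ∈ L, ∀ y ∈ L, edist (x.coord 0) (y.coord 0) = edist x y) ∧
    (fun x : S.Limit => x.coord 0) '' L = univ

/-- `β_E(B)`, measured against monotone geodesics. -/
noncomputable def beta (S : AdmissibleSystem.{u} m η Δ) (E B : Set S.Limit) : ℝ≥0∞ :=
  (⨅ (L : Set S.Limit) (_ : S.IsMonotoneGeodesic L), ⨆ x ∈ E ∩ B, Metric.infEDist x L) /
    Metric.ediam B

/-- A choice, for each edge of each graph `X_n`, of a point of the limit that projects to the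
center of that edge. -/
def IsCenterChoice (S : AdmissibleSystem.{u} m η Δ)
    (c : ∀ n, (S.graph n).Edge → S.Limit) : Prop :=
  ∀ n e, (c n e).coord n = (S.graph n).midpoint e

/-- The open ball of radius `A * m ^ (-n)` in the limit, centered at `x`. -/
def adicBall (S : AdmissibleSystem.{u} m η Δ) (A : ℕ) (n : ℕ) (x : S.Limit) : Set S.Limit :=
  Metric.eball x (ENNReal.ofReal (A * ((m : ℝ) ^ n)⁻¹))

end AdmissibleSystem

/-! Fix a depth `J`. The edges of the `J`-th graph met by the projection of `Γ` form a finite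
connected set of total length at most a constant times the length of `Γ`
(`exists_finset_edgesMeeting`, `edgesMeeting_connected`), so a walk with about twice as many steps
covers them (`exists_covering_walk`). The projection to the zeroth graph gives every vertex an
integral height and every edge a direction, and every upward path extends to the projection of a
monotone geodesic (`exists_monotoneGeodesic`). It has to be shown that at most places and scales the
walk follows a single upward path.

Seen in the `i`-th graph, the walk has a normalized length `N i`, which is `m ^ (-i)` times the
number of edge crossings, and a normalized image `G i`, which is `m ^ (-i)` times the number of
distinct crossed edges. Both are nondecreasing in `i`, since whoever crosses an edge must cross
lifts at all of its heights. The growth from level `a` to level `j` pays for the steps back towards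
the last visited vertex of level `a` (`card_crossings`) and for the edges with two crossed lifts at
the same height (`card_crossed`). Together with the vertices of level `a` where the walk turns or
its image branches, these make up the set `bad a j`. Turns and branchings are bounded by the
quantity `defect`, a count of edges minus vertices plus turns. Scaled by `m ^ (-a)`, it contracts by
the factor `1 / m` at each level, up to increments of `N` and `G` and a summable term
(`defect_succ_le`).

If no vertex of `bad a (a + n)` is near a ball of size comparable to `m ^ (-a)`, then the part of
`Γ` in the ball is within a multiple of `m ^ (-(a + n))` of one monotone geodesic
(`exists_monotoneGeodesic_of_bad`), so its beta number is of order at most `m ^ (-n)`. Hence, with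
`θ = m ^ (-p)`, the power `β ^ p` is bounded by the sum of `θ ^ n` over those `n` for which a bad
vertex is near, plus `θ ^ (J - a)` (`beta_rpow_le`). Bounded valence turns the sum over balls into a
sum of `m ^ (-a) * θ ^ n * (bad a (a + n)).card`. The increments enter it with the weight `(m * θ) ^
n`, and `m * θ < 1` is exactly `p > 1`. The double sum then telescopes to a multiple of the length
(`sum_card_bad_le`).

At scales above the diameter of `Γ` boundedly many balls matter, the beta number is at most a
constant times the diameter over the scale, and a geometric series remains. -/

/-! ### Lazy walks on the integers and their coarsenings -/

namespace LazyWalk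

/-- The last visited multiple of `q`, divided by `q`. -/
def coarsen (q : ℕ) (x : ℕ → ℤ) : ℕ → ℤ
  | 0 => x 0 / q
  | r + 1 => if (q : ℤ) ∣ x (r + 1) then x (r + 1) / q else coarsen q x r

/-- The position before the last move. -/
def previous (x : ℕ → ℤ) : ℕ → ℤ
  | 0 => x 0 - 1
  | r + 1 => if x (r + 1) = x r then previous x r else x r

/-- The times of the moves. -/
def moves (x : ℕ → ℤ) (n : ℕ) : Finset ℕ :=
  (Finset.range n).filter fun r => x (r + 1) ≠ x r

/-- The times of the moves that revert the direction. -/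
def turns (x : ℕ → ℤ) (n : ℕ) : Finset ℕ :=
  (Finset.range n).filter fun r => x (r + 1) ≠ x r ∧ x (r + 1) = previous x r

/-- The times of the moves towards the last visited multiple of `q`. -/
def backs (q : ℕ) (x : ℕ → ℤ) (n : ℕ) : Finset ℕ :=
  (Finset.range n).filter fun r =>
    x (r + 1) ≠ x r ∧ |x (r + 1) - q * coarsen q x r| < |x r - q * coarsen q x r|

variable {q : ℕ} {x : ℕ → ℤ}

theorem mul_coarsen_of_dvd {r : ℕ} (h : (q : ℤ) ∣ x r) :
    (q : ℤ) * coarsen q x r = x r := by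
  cases r with
  | zero => simp only [coarsen]; exact Int.mul_ediv_cancel' h
  | succ r => simp only [coarsen, if_pos h]; exact Int.mul_ediv_cancel' h

theorem coarsen_succ_of_not_dvd {r : ℕ} (h : ¬ (q : ℤ) ∣ x (r + 1)) :
    coarsen q x (r + 1) = coarsen q x r := by
  simp only [coarsen, if_neg h]

/-- Steps of size at most one cannot jump over a multiple of `q`, and a visit to one updates
`coarsen`. -/
theorem abs_sub_mul_coarsen_lt (hq : 0 < q) (hx : ∀ r, |x (r + 1) - x r| ≤ 1)
    (h0 : (q : ℤ) ∣ x 0) (r : ℕ) : |x r - q * coarsen q x r| < q := by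
  induction r with
  | zero => rw [mul_coarsen_of_dvd h0]; simpa using hq
  | succ r ih =>
    by_cases h : (q : ℤ) ∣ x (r + 1)
    · rw [mul_coarsen_of_dvd h]; simpa using hq
    · rw [coarsen_succ_of_not_dvd h]
      have hl := hx r
      rw [abs_lt] at ih ⊢
      rw [abs_le] at hl
      have h1 : x (r + 1) - q * coarsen q x r ≠ q := fun h' =>
        h ⟨coarsen q x r + 1, by linarith⟩
      have h2 : x (r + 1) - q * coarsen q x r ≠ -q := fun h' =>
        h ⟨coarsen q x r - 1, by linarith⟩
      constructor <;> omega

theorem mul_coarsen_succ_of_ne {r : ℕ}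
    (h : coarsen q x (r + 1) ≠ coarsen q x r) : (q : ℤ) * coarsen q x (r + 1) = x (r + 1) := by
  by_cases hd : (q : ℤ) ∣ x (r + 1)
  · exact mul_coarsen_of_dvd hd
  · exact absurd (coarsen_succ_of_not_dvd hd) h

theorem abs_coarsen_sub_le (hq : 0 < q) (hx : ∀ r, |x (r + 1) - x r| ≤ 1)
    (h0 : (q : ℤ) ∣ x 0) (r : ℕ) : |coarsen q x (r + 1) - coarsen q x r| ≤ 1 := by
  by_cases h : coarsen q x (r + 1) = coarsen q x r
  · simp [h]
  · have h1 := mul_coarsen_succ_of_ne h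
    have h2 := abs_sub_mul_coarsen_lt hq hx h0 r
    have h3 := hx r
    rw [abs_lt] at h2
    rw [abs_le] at h3 ⊢
    have hq' : (0 : ℤ) < q := by exact_mod_cast hq
    constructor
    · by_contra! hc
      have : coarsen q x (r + 1) - coarsen q x r ≤ -2 := by omega
      nlinarith
    · by_contra! hc
      have : 2 ≤ coarsen q x (r + 1) - coarsen q x r := by omega
      nlinarith

theorem ne_of_coarsen_ne (hq : 0 < q) {r : ℕ}
    (h : coarsen q x (r + 1) ≠ coarsen q x r) : x (r + 1) ≠ x r := by
  intro he
  have h1 := mul_coarsen_succ_of_ne h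
  have h2 : (q : ℤ) * coarsen q x r = x r := mul_coarsen_of_dvd ⟨_, he ▸ h1.symm⟩
  have hq' : (q : ℤ) ≠ 0 := by exact_mod_cast hq.ne'
  exact h (mul_left_cancel₀ hq' (by rw [h1, h2, he]))

/-- Multiples of `p * q` are found among the visited multiples of `q`, so nothing is lost by
coarsening in two stages. This makes the levels of a tower comparable pairwise. -/
theorem coarsen_coarsen {p : ℕ} (hq : 0 < q) (hp : 0 < p) (h0 : ((p * q : ℕ) : ℤ) ∣ x 0) :
    coarsen p (coarsen q x) = coarsen (p * q) x := by
  have hq' : (q : ℤ) ≠ 0 := by exact_mod_cast hq.ne'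
  have hp' : (p : ℤ) ≠ 0 := by exact_mod_cast hp.ne'
  have key : ∀ r, (q : ℤ) ∣ x r → ((p : ℤ) ∣ coarsen q x r ↔ ((p * q : ℕ) : ℤ) ∣ x r) := by
    intro r hr
    rw [← mul_coarsen_of_dvd hr, Nat.cast_mul, mul_comm (p : ℤ), Int.mul_dvd_mul_iff_left hq']
  have key2 : ∀ r, ((p * q : ℕ) : ℤ) ∣ x r → coarsen p (coarsen q x) r = coarsen (p * q) x r := by
    intro r hr
    have hqr : (q : ℤ) ∣ x r := (Dvd.intro_left (p : ℤ) (by push_cast; rfl)).trans hr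
    have h1 := mul_coarsen_of_dvd hr
    have h2 := mul_coarsen_of_dvd ((key r hqr).2 hr)
    have h3 := mul_coarsen_of_dvd hqr
    push_cast at h1
    have : (p * q : ℤ) * coarsen p (coarsen q x) r = (p * q : ℤ) * coarsen (p * q) x r := by
      rw [h1, ← h3, ← h2]; ring
    exact mul_left_cancel₀ (mul_ne_zero hp' hq') this
  funext r
  induction r with
  | zero => exact key2 0 h0
  | succ r ih =>
    by_cases h : ((p * q : ℕ) : ℤ) ∣ x (r + 1)
    · exact key2 _ h
    · rw [coarsen_succ_of_not_dvd h, ← ih]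
      by_cases hqr : (q : ℤ) ∣ x (r + 1)
      · exact coarsen_succ_of_not_dvd (fun hd => h ((key _ hqr).1 hd))
      · have e := coarsen_succ_of_not_dvd (q := q) (x := x) hqr
        by_cases hd : (p : ℤ) ∣ coarsen q x (r + 1)
        · have h1 := mul_coarsen_of_dvd hd
          have h2 := mul_coarsen_of_dvd (x := coarsen q x) (e ▸ hd)
          exact mul_left_cancel₀ hp' (by rw [h1, h2, e])
        · exact coarsen_succ_of_not_dvd hd

theorem card_filter_range_succ (P : ℕ → Prop) [DecidablePred P] (n : ℕ) :
    ((((Finset.range (n + 1)).filter P).card : ℕ) : ℤ)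
      = ((Finset.range n).filter P).card + if P n then 1 else 0 := by
  rw [Finset.range_add_one, Finset.filter_insert]
  split_ifs with h <;> simp

/-- Every move changes the distance to the last visited multiple by one: up for a move away, down
for a move back. A coarse move resets that distance from `q` to `0`. Hence moves away minus moves
back equal `q` times the coarse moves plus the present distance. -/
theorem card_moves (hq : 0 < q) (hx : ∀ r, |x (r + 1) - x r| ≤ 1)
    (h0 : (q : ℤ) ∣ x 0) (n : ℕ) :
    ((moves x n).card : ℤ) = q * (moves (coarsen q x) n).card + |x n - q * coarsen q x n|
      + 2 * (backs q x n).card := by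
  induction n with
  | zero => simp [moves, backs, mul_coarsen_of_dvd h0]
  | succ n ih =>
    simp only [moves, backs] at ih ⊢
    rw [card_filter_range_succ, card_filter_range_succ, card_filter_range_succ, ih]
    have hl := hx n
    have h1 := abs_sub_mul_coarsen_lt hq hx h0 n
    have h2 := abs_coarsen_sub_le hq hx h0 n
    by_cases hy : coarsen q x (n + 1) = coarsen q x n
    · simp only [hy, ne_eq, not_true_eq_false, if_false]
      generalize (q : ℤ) * coarsen q x n = Q at *
      grind
    · have h3 := mul_coarsen_succ_of_ne hy
      have h4 := ne_of_coarsen_ne hq hy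
      have h5 : (q : ℤ) * coarsen q x (n + 1) = q * coarsen q x n + q ∨
          (q : ℤ) * coarsen q x (n + 1) = q * coarsen q x n - q := by
        rw [abs_le] at h2
        have : coarsen q x (n + 1) = coarsen q x n + 1 ∨
          coarsen q x (n + 1) = coarsen q x n - 1 := by omega
        rcases this with h | h <;> rw [h]
        · left; ring
        · right; ring
      rw [mul_add]
      simp only [ne_eq, h4, hy, not_false_eq_true, if_true, true_and]
      generalize (q : ℤ) * coarsen q x n = Q at *
      generalize (q : ℤ) * coarsen q x (n + 1) = Q' at *
      grind

theorem previous_eq (hx : ∀ r, |x (r + 1) - x r| ≤ 1) (r : ℕ) :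
    previous x r = x r - 1 ∨ previous x r = x r + 1 := by
  induction r with
  | zero => simp [previous]
  | succ r ih =>
    have := hx r
    simp only [previous]
    split_ifs with h
    · rwa [h]
    · rw [abs_le] at this; omega

/-- A turn towards the last multiple is itself a step back, and a turn away from it follows a step
back, unless it occurs at a multiple that has just been reached. Such a turn is either completed to
a turn of the coarse walk or undone by a step back. -/
theorem card_turns_le (hq : 2 ≤ q) (hx : ∀ r, |x (r + 1) - x r| ≤ 1)
    (h0 : (q : ℤ) ∣ x 0) (n : ℕ) :
    (turns x n).card ≤ (turns (coarsen q x) n).card + 2 * (backs q x n).card + 1 := by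
  have hq0 : 0 < q := by omega
  have hy := abs_coarsen_sub_le hq0 hx h0
  -- The added term is a balance. It vanishes if the walk and its coarsening last moved in the same
  -- direction. Otherwise it is `-1` on the far side of the last multiple, where a turn is still
  -- unpaid, and `1` on the other side, where a step back has paid for one turn more than was made.
  have main : ((turns x n).card : ℤ) + (if (x n - previous x n) *
      (coarsen q x n - previous (coarsen q x) n) = 1 then 0 else
      if (x n - q * coarsen q x n) * (coarsen q x n - previous (coarsen q x) n) < 0
        then -1 else 1)
      ≤ (turns (coarsen q x) n).card + 2 * (backs q x n).card := by
    induction n with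
    | zero => simp [turns, backs, previous]
    | succ n ih =>
      simp only [turns, backs] at ih ⊢
      rw [card_filter_range_succ, card_filter_range_succ, card_filter_range_succ]
      have hl := hx n
      have h1 := abs_sub_mul_coarsen_lt hq0 hx h0 n
      have h2 := hy n
      have p1 := previous_eq hx n
      have p2 := previous_eq hy n
      have hq' : (2 : ℤ) ≤ q := by exact_mod_cast hq
      simp only [previous]
      generalize ((Finset.filter (fun r ↦ x (r + 1) ≠ x r ∧ x (r + 1) = previous x r)
        (Finset.range n)).card : ℤ) = T' at *
      generalize ((Finset.filter (fun r ↦ coarsen q x (r + 1) ≠ coarsen q x r ∧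
        coarsen q x (r + 1) = previous (coarsen q x) r) (Finset.range n)).card : ℤ) = T at *
      generalize ((Finset.filter (fun r ↦ x (r + 1) ≠ x r ∧
        |x (r + 1) - q * coarsen q x r| < |x r - q * coarsen q x r|)
          (Finset.range n)).card : ℤ) = B at *
      by_cases hc : coarsen q x (n + 1) = coarsen q x n
      · simp only [hc, ne_eq, not_true_eq_false, if_true, false_and, if_false]
        generalize (q : ℤ) * coarsen q x n = Q at *
        rcases p1 with p1 | p1 <;> rcases p2 with p2 | p2 <;> rw [p1, p2] at ih ⊢ <;>
        · rw [abs_le] at hl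
          rcases (by omega : x (n + 1) = x n ∨ x (n + 1) = x n + 1 ∨ x (n + 1) = x n - 1)
            with h | h | h <;> rw [h] <;> ring_nf at ih ⊢ <;> grind
      · have h3 := mul_coarsen_succ_of_ne hc
        have h4 := ne_of_coarsen_ne hq0 hc
        have h6 : (coarsen q x (n + 1) = coarsen q x n + 1 ∧
            (q : ℤ) * coarsen q x (n + 1) = q * coarsen q x n + q) ∨
            (coarsen q x (n + 1) = coarsen q x n - 1 ∧
            (q : ℤ) * coarsen q x (n + 1) = q * coarsen q x n - q) := by
          rw [abs_le] at h2
          have : coarsen q x (n + 1) = coarsen q x n + 1 ∨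
            coarsen q x (n + 1) = coarsen q x n - 1 := by omega
          rcases this with h | h <;> rw [h]
          · left; exact ⟨rfl, by ring⟩
          · right; exact ⟨rfl, by ring⟩
        generalize (q : ℤ) * coarsen q x n = Q at *
        generalize (q : ℤ) * coarsen q x (n + 1) = Q' at *
        simp only [ne_eq, h4, hc, not_false_eq_true, if_false, true_and]
        rcases p1 with p1 | p1 <;> rcases p2 with p2 | p2 <;> rw [p1, p2] at ih ⊢ <;>
        · rw [abs_le] at hl
          rcases h6 with ⟨h6, h7⟩ | ⟨h6, h7⟩ <;>
          rcases (by omega : x (n + 1) = x n + 1 ∨ x (n + 1) = x n - 1)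
            with h | h <;> rw [h, h6] <;> ring_nf at ih ⊢ <;> grind
  have : (-1 : ℤ) ≤ (if (x n - previous x n) *
      (coarsen q x n - previous (coarsen q x) n) = 1 then 0 else
      if (x n - q * coarsen q x n) * (coarsen q x n - previous (coarsen q x) n) < 0
        then -1 else 1) := by split_ifs <;> norm_num
  zify
  linarith

/-- The last move before a time at which the position differs from the initial one. -/
theorem exists_last_move {r : ℕ} (h : ∃ s ≤ r, x s ≠ x r) :
    ∃ s < r, x (s + 1) ≠ x s ∧ ∀ t, s < t → t ≤ r → x t = x r := by
  induction r with
  | zero =>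
    obtain ⟨s, hs, hne⟩ := h
    simp_all
  | succ r ih =>
    by_cases hr : x (r + 1) = x r
    · obtain ⟨s, hs, hne⟩ := h
      have hs' : s ≠ r + 1 := by rintro rfl; exact hne rfl
      obtain ⟨s, hs, h1, h2⟩ := ih ⟨s, by omega, by rwa [← hr]⟩
      refine ⟨s, by omega, h1, fun t h3 h4 => ?_⟩
      rcases h4.lt_or_eq with h4 | rfl
      · rw [hr]; exact h2 t h3 (by omega)
      · rfl
    · refine ⟨r, by omega, hr, fun t h3 h4 => ?_⟩
      rw [show t = r + 1 by omega]

theorem exists_next_move {r n : ℕ} (hrn : r ≤ n) (h : x r ≠ x n) :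
    ∃ s, r ≤ s ∧ s < n ∧ x (s + 1) ≠ x s ∧ ∀ t, r ≤ t → t ≤ s → x t = x r := by
  classical
  have hex : ∃ k, x (r + k) ≠ x r := ⟨n - r, by rw [Nat.add_sub_cancel' hrn]; exact h.symm⟩
  have h1 := Nat.find_spec hex
  have h2 : ∀ k < Nat.find hex, x (r + k) = x r := fun k hk => not_not.1 (Nat.find_min hex hk)
  have h3 : Nat.find hex ≤ n - r :=
    Nat.find_min' hex (by rw [Nat.add_sub_cancel' hrn]; exact h.symm)
  obtain ⟨k, hk⟩ : ∃ k, Nat.find hex = k + 1 := by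
    refine Nat.exists_eq_succ_of_ne_zero fun h0 => ?_
    rw [h0] at h1
    exact h1 rfl
  rw [hk] at h1 h2 h3
  refine ⟨r + k, by omega, by omega, ?_, fun t h4 h5 => ?_⟩
  · rw [h2 k (by omega)]; exact h1
  · have := h2 (t - r) (by omega)
    rwa [Nat.add_sub_cancel' h4] at this

theorem previous_eq_of_last_move {s t : ℕ} (hst : s < t) (hm : x (s + 1) ≠ x s)
    (h : ∀ u, s < u → u ≤ t → x u = x t) : previous x t = x s := by
  induction t, Nat.succ_le_of_lt hst using Nat.le_induction with
  | base => simp [previous, hm]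
  | succ t ht ih =>
    have h1 : x t = x (t + 1) := h t ht (by omega)
    simp only [previous, h1, if_true]
    exact ih ht fun u hu hut => by rw [h1]; exact h u hu (by omega)

end LazyWalk

/-! ### Walks in a tower of graphs -/

/-- Upward paths: lists of consecutive edges, each traversed from its source to its target. -/
def UpPath {P E : Type*} (src tgt : E → P) : P → List E → P → Prop
  | u, [], v => u = v
  | u, f :: l, v => src f = u ∧ UpPath src tgt (tgt f) l v

namespace UpPath

variable {P E : Type*} {src tgt : E → P}

theorem append {u v w : P} {l l' : List E} (h : UpPath src tgt u l v)
    (h' : UpPath src tgt v l' w) : UpPath src tgt u (l ++ l') w := by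
  induction l generalizing u with
  | nil => rw [show u = v from h]; exact h'
  | cons f l ih => exact ⟨h.1, ih h.2⟩

theorem singleton (f : E) : UpPath src tgt (src f) [f] (tgt f) := ⟨rfl, rfl⟩

theorem exists_mem {ht : P → ℤ} (hht : ∀ f, ht (tgt f) = ht (src f) + 1) {u v : P} {l : List E}
    (h : UpPath src tgt u l v) {k : ℤ} (hu : ht u ≤ k) (hv : k < ht v) :
    ∃ f ∈ l, ht (src f) = k := by
  induction l generalizing u with
  | nil => rw [show u = v from h] at hu; omega
  | cons f l ih =>
    rcases hu.eq_or_lt with h1 | h1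
    · exact ⟨f, by simp, by rw [h.1, h1]⟩
    · obtain ⟨g, hg, hk⟩ := ih h.2 (by rw [hht, h.1]; omega)
      exact ⟨g, by simp [hg], hk⟩

end UpPath

/-- A walk in the `J`-th graph of a tower of graphs, seen in all of the graphs of the tower.
The edges are directed upwards with respect to an integral height function; the height of the
walk is measured in the scale of level `J`. -/
structure TowerWalk (m J : ℕ) where
  Pt : ℕ → Type u
  Ed : ℕ → Type u
  src : ∀ {i}, Ed i → Pt i
  tgt : ∀ {i}, Ed i → Pt i
  ht : ∀ {i}, Pt i → ℤ
  pr : ∀ {i}, Pt (i + 1) → Pt i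
  up : ∀ {i}, Ed (i + 1) → Ed i
  len : ℕ
  pos : ℕ → ∀ i, Pt i
  edge : ℕ → ∀ i, Ed i
  height : ℕ → ℤ
  abs_height : ∀ r, |height (r + 1) - height r| = 1
  ht_tgt : ∀ {i} (f : Ed i), ht (tgt f) = ht (src f) + 1
  pr_pos : ∀ r i, pr (pos r (i + 1)) = pos r i
  up_edge : ∀ r i, up (edge r (i + 1)) = edge r i
  -- Heights are counted in edge lengths of level `J`, so the floor of the quotient by `m ^ (J - i)`
  -- counts edge lengths of level `i`. The lower end of a step selects the edge of level `i` that
  -- contains it.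
  ht_src_edge : ∀ r, ∀ i ≤ J,
    ht (src (edge r i)) = min (height r) (height (r + 1)) / (m ^ (J - i) : ℕ)
  pos_eq_src : ∀ r, ∀ i ≤ J,
    height r = (m ^ (J - i) : ℕ) * ht (src (edge r i)) → pos r i = src (edge r i)
  pos_eq_tgt : ∀ r, ∀ i ≤ J,
    height r = (m ^ (J - i) : ℕ) * (ht (src (edge r i)) + 1) → pos r i = tgt (edge r i)
  pos_succ_eq_src : ∀ r, ∀ i ≤ J,
    height (r + 1) = (m ^ (J - i) : ℕ) * ht (src (edge r i)) → pos (r + 1) i = src (edge r i)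
  pos_succ_eq_tgt : ∀ r, ∀ i ≤ J,
    height (r + 1) = (m ^ (J - i) : ℕ) * (ht (src (edge r i)) + 1) →
      pos (r + 1) i = tgt (edge r i)
  edge_succ : ∀ r, ∀ i ≤ J, ¬ ((m ^ (J - i) : ℕ) : ℤ) ∣ height (r + 1) →
    edge (r + 1) i = edge r i
  -- A vertex whose height is not a multiple of `m` projects into the interior of an edge, and so
  -- determines that edge.
  up_eq_of_pr_eq : ∀ {i} (f g : Ed (i + 1)), pr (src f) = pr (src g) →
    ¬ (m : ℤ) ∣ ht (src f) → up f = up g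

namespace TowerWalk

open LazyWalk

variable {m J : ℕ} (W : TowerWalk.{u} m J)

/-- The height of the last visited vertex of the `i`-th graph. -/
def level (i : ℕ) : ℕ → ℤ := coarsen (m ^ (J - i)) W.height

/-- The time of the last visit to a vertex of the `i`-th graph. -/
def lastVisit (i : ℕ) : ℕ → ℕ
  | 0 => 0
  | r + 1 => if ((m ^ (J - i) : ℕ) : ℤ) ∣ W.height (r + 1) then r + 1 else lastVisit i r

/-- The last visited vertex of the `i`-th graph. -/
def vert (i r : ℕ) : W.Pt i := W.pos (W.lastVisit i r) i

theorem lastVisit_le (i r : ℕ) : W.lastVisit i r ≤ r := by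
  induction r with
  | zero => rfl
  | succ r ih => simp only [lastVisit]; split_ifs <;> omega

theorem dvd_height_lastVisit {i : ℕ} (h0 : ((m ^ (J - i) : ℕ) : ℤ) ∣ W.height 0) (r : ℕ) :
    ((m ^ (J - i) : ℕ) : ℤ) ∣ W.height (W.lastVisit i r) := by
  induction r with
  | zero => exact h0
  | succ r ih => simp only [lastVisit]; split_ifs with h <;> assumption

theorem lastVisit_of_dvd {i r : ℕ} (h : ((m ^ (J - i) : ℕ) : ℤ) ∣ W.height r) :
    W.lastVisit i r = r := by
  cases r with
  | zero => rfl
  | succ r => simp only [lastVisit, if_pos h]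

theorem mul_level {i : ℕ} (h0 : ((m ^ (J - i) : ℕ) : ℤ) ∣ W.height 0) (r : ℕ) :
    ((m ^ (J - i) : ℕ) : ℤ) * W.level i r = W.height (W.lastVisit i r) := by
  induction r with
  | zero => exact mul_coarsen_of_dvd h0
  | succ r ih =>
    by_cases h : ((m ^ (J - i) : ℕ) : ℤ) ∣ W.height (r + 1)
    · rw [W.lastVisit_of_dvd h]; exact mul_coarsen_of_dvd h
    · rw [level, coarsen_succ_of_not_dvd h, lastVisit, if_neg h]; exact ih

theorem mul_level_of_dvd {i r : ℕ} (h : ((m ^ (J - i) : ℕ) : ℤ) ∣ W.height r) :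
    ((m ^ (J - i) : ℕ) : ℤ) * W.level i r = W.height r := mul_coarsen_of_dvd h

theorem edge_lastVisit {i : ℕ} (hi : i ≤ J) (r : ℕ) :
    W.edge (W.lastVisit i r) i = W.edge r i := by
  induction r with
  | zero => rfl
  | succ r ih =>
    simp only [lastVisit]
    split_ifs with h
    · rfl
    · rw [W.edge_succ r i hi h, ih]

theorem lastVisit_of_le {i r t : ℕ} (h1 : W.lastVisit i r ≤ t) (h2 : t ≤ r) :
    W.lastVisit i t = W.lastVisit i r := by
  induction r with
  | zero => rw [show t = 0 by omega]
  | succ r ih =>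
    by_cases h : ((m ^ (J - i) : ℕ) : ℤ) ∣ W.height (r + 1)
    · rw [W.lastVisit_of_dvd h] at h1; rw [show t = r + 1 by omega]
    · rcases h2.eq_or_lt with rfl | h2
      · rfl
      · simp only [lastVisit, if_neg h] at h1 ⊢
        exact ih h1 (by omega)

theorem height_ne (r : ℕ) : W.height (r + 1) = W.height r + 1 ∨
    W.height (r + 1) = W.height r - 1 := by
  have := W.abs_height r
  grind

theorem abs_height_le (r : ℕ) : |W.height (r + 1) - W.height r| ≤ 1 := (W.abs_height r).le

/-- Since its last visit to a vertex of level `i` the walk has stayed in one edge of that level. The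
first step after the visit decides whether the vertex is the lower or the upper end. -/
theorem vert_cases (hm : 0 < m) {i : ℕ} (hi : i ≤ J)
    (h0 : ((m ^ (J - i) : ℕ) : ℤ) ∣ W.height 0) (r : ℕ) :
    (W.level i r = W.ht (W.src (W.edge r i)) ∧ W.vert i r = W.src (W.edge r i)) ∨
    (W.level i r = W.ht (W.src (W.edge r i)) + 1 ∧ W.vert i r = W.tgt (W.edge r i)) := by
  have hM : (0 : ℤ) < ((m ^ (J - i) : ℕ) : ℤ) := by exact_mod_cast Nat.pow_pos hm
  have h1 := W.mul_level h0 r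
  have h2 := W.ht_src_edge (W.lastVisit i r) i hi
  have h3 := W.pos_eq_src (W.lastVisit i r) i hi
  have h4 := W.pos_eq_tgt (W.lastVisit i r) i hi
  rw [W.edge_lastVisit hi] at h2 h3 h4
  rw [vert]
  generalize ((m ^ (J - i) : ℕ) : ℤ) = M at *
  rcases W.height_ne (W.lastVisit i r) with h | h
  · left
    rw [h, min_eq_left (by omega), ← h1, Int.mul_ediv_cancel_left _ hM.ne'] at h2
    exact ⟨h2.symm, h3 (by rw [h2, h1])⟩
  · right
    have h5 : W.ht (W.src (W.edge r i)) = W.level i r - 1 := by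
      rw [h2, h, min_eq_right (by omega), ← h1]
      rw [Int.ediv_eq_iff_of_pos hM]
      constructor <;> nlinarith
    exact ⟨by omega, h4 (by rw [h5, ← h1]; ring)⟩

/-- Together with `vert_cases`, this puts the last visited vertices before and after a step on the
same edge. A change of level is therefore a crossing of that edge, in a direction read off from the
heights. -/
theorem vert_succ_cases (hm : 0 < m) {i : ℕ} (hi : i ≤ J)
    (h0 : ((m ^ (J - i) : ℕ) : ℤ) ∣ W.height 0) (r : ℕ) :
    (W.level i (r + 1) = W.ht (W.src (W.edge r i)) ∧ W.vert i (r + 1) = W.src (W.edge r i)) ∨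
    (W.level i (r + 1) = W.ht (W.src (W.edge r i)) + 1 ∧
      W.vert i (r + 1) = W.tgt (W.edge r i)) := by
  have hM : (0 : ℤ) < ((m ^ (J - i) : ℕ) : ℤ) := by exact_mod_cast Nat.pow_pos hm
  by_cases hd : ((m ^ (J - i) : ℕ) : ℤ) ∣ W.height (r + 1)
  · have h1 := W.mul_level_of_dvd hd
    have h2 := W.ht_src_edge r i hi
    have h3 := W.pos_succ_eq_src r i hi
    have h4 := W.pos_succ_eq_tgt r i hi
    rw [vert, W.lastVisit_of_dvd hd]
    clear hd h0
    generalize ((m ^ (J - i) : ℕ) : ℤ) = M at *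
    rcases W.height_ne r with h | h
    · right
      have h5 : W.ht (W.src (W.edge r i)) = W.level i (r + 1) - 1 := by
        rw [h2, min_eq_left (by omega), show W.height r = W.height (r + 1) - 1 by omega, ← h1]
        rw [Int.ediv_eq_iff_of_pos hM]
        constructor <;> nlinarith
      exact ⟨by omega, h4 (by rw [h5, ← h1]; ring)⟩
    · left
      rw [min_eq_right (by omega), ← h1, Int.mul_ediv_cancel_left _ hM.ne'] at h2
      exact ⟨h2.symm, h3 (by rw [h2, h1])⟩
  · have e1 : W.level i (r + 1) = W.level i r := coarsen_succ_of_not_dvd hd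
    have e2 : W.vert i (r + 1) = W.vert i r := by simp only [vert, lastVisit, if_neg hd]
    rw [e1, e2]
    exact W.vert_cases hm hi h0 r

theorem vert_succ_eq (hm : 0 < m) {i : ℕ} (hi : i ≤ J)
    (h0 : ((m ^ (J - i) : ℕ) : ℤ) ∣ W.height 0) {r : ℕ} (h : W.level i (r + 1) = W.level i r) :
    W.vert i (r + 1) = W.vert i r := by
  rcases W.vert_cases hm hi h0 r with ⟨h1, h2⟩ | ⟨h1, h2⟩ <;>
  rcases W.vert_succ_cases hm hi h0 r with ⟨h3, h4⟩ | ⟨h3, h4⟩ <;>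
  first | (rw [h2, h4]; done) | omega

theorem vert_eq_of_const (hm : 0 < m) {i : ℕ} (hi : i ≤ J)
    (h0 : ((m ^ (J - i) : ℕ) : ℤ) ∣ W.height 0) {r s : ℕ} (hrs : r ≤ s)
    (h : ∀ t, r ≤ t → t ≤ s → W.level i t = W.level i s) : W.vert i r = W.vert i s := by
  induction s, hrs using Nat.le_induction with
  | base => rfl
  | succ s hs ih =>
    have h1 := h s hs (by omega)
    rw [W.vert_succ_eq hm hi h0 h1.symm]
    exact ih fun t h2 h3 => by rw [h1]; exact h t h2 (by omega)

theorem ht_vert (hm : 0 < m) {i : ℕ} (hi : i ≤ J)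
    (h0 : ((m ^ (J - i) : ℕ) : ℤ) ∣ W.height 0) (r : ℕ) : W.ht (W.vert i r) = W.level i r := by
  rcases W.vert_cases hm hi h0 r with ⟨h1, h2⟩ | ⟨h1, h2⟩
  · rw [h1, h2]
  · rw [h1, h2, W.ht_tgt]

theorem vert_of_up (hm : 0 < m) {i : ℕ} (hi : i ≤ J)
    (h0 : ((m ^ (J - i) : ℕ) : ℤ) ∣ W.height 0) {r : ℕ} (h : W.level i r < W.level i (r + 1)) :
    W.vert i r = W.src (W.edge r i) ∧ W.vert i (r + 1) = W.tgt (W.edge r i) ∧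
      W.level i r = W.ht (W.src (W.edge r i)) ∧ W.level i (r + 1) = W.level i r + 1 := by
  rcases W.vert_cases hm hi h0 r with ⟨h1, h2⟩ | ⟨h1, h2⟩ <;>
  rcases W.vert_succ_cases hm hi h0 r with ⟨h3, h4⟩ | ⟨h3, h4⟩ <;>
  first | (exact ⟨h2, h4, h1, by omega⟩) | omega

theorem vert_of_down (hm : 0 < m) {i : ℕ} (hi : i ≤ J)
    (h0 : ((m ^ (J - i) : ℕ) : ℤ) ∣ W.height 0) {r : ℕ} (h : W.level i (r + 1) < W.level i r) :
    W.vert i r = W.tgt (W.edge r i) ∧ W.vert i (r + 1) = W.src (W.edge r i) ∧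
      W.level i (r + 1) = W.ht (W.src (W.edge r i)) ∧ W.level i (r + 1) = W.level i r - 1 := by
  rcases W.vert_cases hm hi h0 r with ⟨h1, h2⟩ | ⟨h1, h2⟩ <;>
  rcases W.vert_succ_cases hm hi h0 r with ⟨h3, h4⟩ | ⟨h3, h4⟩ <;>
  first | (exact ⟨h2, h4, h3, by omega⟩) | omega

theorem abs_level_le (hm : 0 < m) {i : ℕ} (h0 : ((m ^ (J - i) : ℕ) : ℤ) ∣ W.height 0) (r : ℕ) :
    |W.level i (r + 1) - W.level i r| ≤ 1 :=
  abs_coarsen_sub_le (Nat.pow_pos hm) W.abs_height_le h0 r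

theorem dvd_height_of_le {a j : ℕ} (haj : a ≤ j) {z : ℤ} (h : ((m ^ (J - a) : ℕ) : ℤ) ∣ z) :
    ((m ^ (J - j) : ℕ) : ℤ) ∣ z := by
  refine dvd_trans ?_ h
  exact_mod_cast pow_dvd_pow m (by omega)

theorem level_eq_coarsen (hm : 0 < m) {a j : ℕ} (haj : a ≤ j) (hj : j ≤ J)
    (h0 : ((m ^ (J - a) : ℕ) : ℤ) ∣ W.height 0) :
    W.level a = coarsen (m ^ (j - a)) (W.level j) := by
  have e : m ^ (J - a) = m ^ (j - a) * m ^ (J - j) := by rw [← pow_add]; congr 1; omega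
  rw [level, level, coarsen_coarsen (Nat.pow_pos hm) (Nat.pow_pos hm) (e ▸ h0), e]

theorem dvd_level_zero (hm : 0 < m) {a j : ℕ} (haj : a ≤ j) (hj : j ≤ J)
    (h0 : ((m ^ (J - a) : ℕ) : ℤ) ∣ W.height 0) :
    ((m ^ (j - a) : ℕ) : ℤ) ∣ W.level j 0 := by
  have e : m ^ (J - a) = m ^ (J - j) * m ^ (j - a) := by rw [← pow_add]; congr 1; omega
  have h1 := W.mul_level_of_dvd (dvd_height_of_le haj h0)
  have hM : ((m ^ (J - j) : ℕ) : ℤ) ≠ 0 := by exact_mod_cast (Nat.pow_pos hm).ne'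
  rw [← h1, e, Nat.cast_mul] at h0
  exact (Int.mul_dvd_mul_iff_left hM).1 h0

theorem edge_eq_of_edge_eq {a j r s : ℕ} (haj : a ≤ j) (h : W.edge r j = W.edge s j) :
    W.edge r a = W.edge s a := by
  induction j, haj using Nat.le_induction with
  | base => exact h
  | succ j hj ih => exact ih (by rw [← W.up_edge r j, ← W.up_edge s j, h])

theorem ht_src_edge_div {a j : ℕ} (haj : a ≤ j) (hj : j ≤ J) (r : ℕ) :
    W.ht (W.src (W.edge r a)) = W.ht (W.src (W.edge r j)) / (m ^ (j - a) : ℕ) := by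
  rw [W.ht_src_edge r a (haj.trans hj), W.ht_src_edge r j hj,
    Int.ediv_ediv_of_nonneg (by positivity)]
  congr 1
  rw [← Nat.cast_mul, ← pow_add]; congr 2; omega

theorem level_eq_of_dvd (hm : 0 < m) {a j : ℕ} (haj : a ≤ j) (hj : j ≤ J) {r : ℕ}
    (h : ((m ^ (J - a) : ℕ) : ℤ) ∣ W.height r) :
    W.level j r = (m ^ (j - a) : ℕ) * W.level a r := by
  have e : m ^ (J - a) = m ^ (J - j) * m ^ (j - a) := by rw [← pow_add]; congr 1; omega
  have h1 := W.mul_level_of_dvd (dvd_height_of_le haj h)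
  have h2 := W.mul_level_of_dvd h
  have hM : ((m ^ (J - j) : ℕ) : ℤ) ≠ 0 := by exact_mod_cast (Nat.pow_pos hm).ne'
  rw [← h1, e, Nat.cast_mul, mul_assoc] at h2
  exact (mul_left_cancel₀ hM h2).symm

theorem edge_succ_of_level_ne (hm : 0 < m) {a j : ℕ} (haj : a ≤ j) (hj : j ≤ J) {r : ℕ}
    (h : W.level j (r + 1) ≠ (m ^ (j - a) : ℕ) * W.level a (r + 1)) :
    W.edge (r + 1) a = W.edge r a :=
  W.edge_succ r a (haj.trans hj) fun hd => h (W.level_eq_of_dvd hm haj hj hd)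

theorem level_eq_of_level_ne (hm : 0 < m) {a j : ℕ} (haj : a ≤ j) (hj : j ≤ J)
    (h0 : ((m ^ (J - a) : ℕ) : ℤ) ∣ W.height 0) {r : ℕ}
    (h : W.level a (r + 1) ≠ W.level a r) :
    W.level j (r + 1) = (m ^ (j - a) : ℕ) * W.level a (r + 1) := by
  rw [W.level_eq_coarsen hm haj hj h0] at h ⊢
  exact (mul_coarsen_succ_of_ne h).symm

theorem abs_level_sub_lt (hm : 0 < m) {a j : ℕ} (haj : a ≤ j) (hj : j ≤ J)
    (h0 : ((m ^ (J - a) : ℕ) : ℤ) ∣ W.height 0) (r : ℕ) :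
    |W.level j r - (m ^ (j - a) : ℕ) * W.level a r| < (m ^ (j - a) : ℕ) := by
  rw [W.level_eq_coarsen hm haj hj h0]
  exact abs_sub_mul_coarsen_lt (Nat.pow_pos hm) (W.abs_level_le hm (dvd_height_of_le haj h0))
    (W.dvd_level_zero hm haj hj h0) r

theorem ne_of_level_ne (hm : 0 < m) {a j : ℕ} (haj : a ≤ j) (hj : j ≤ J)
    (h0 : ((m ^ (J - a) : ℕ) : ℤ) ∣ W.height 0) {r : ℕ}
    (h : W.level a (r + 1) ≠ W.level a r) : W.level j (r + 1) ≠ W.level j r := by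
  rw [W.level_eq_coarsen hm haj hj h0] at h
  exact ne_of_coarsen_ne (Nat.pow_pos hm) h

/-- The times at which the walk finishes to cross an edge of the `i`-th graph. -/
def crossings (i : ℕ) : Finset ℕ := moves (W.level i) W.len

theorem mem_crossings {i s : ℕ} :
    s ∈ W.crossings i ↔ s < W.len ∧ W.level i (s + 1) ≠ W.level i s := by
  simp [crossings, moves]

/-- The times at which the walk in the `j`-th graph crosses an edge in the direction of the last
visited vertex of the `a`-th graph. -/
def backTimes (a j : ℕ) : Finset ℕ := backs (m ^ (j - a)) (W.level j) W.len

open scoped Classical in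
/-- The edges of the `i`-th graph crossed by the walk. -/
noncomputable def crossed (i : ℕ) : Finset (W.Ed i) := (W.crossings i).image fun s => W.edge s i

open scoped Classical in
/-- The visited vertices of the `i`-th graph. -/
noncomputable def visited (i : ℕ) : Finset (W.Pt i) :=
  (Finset.range (W.len + 1)).image (W.vert i)

open scoped Classical in
/-- The crossed edges of the `a`-th graph that have two lifts at the same height among the
crossed edges of the `j`-th graph. -/
noncomputable def multi (a j : ℕ) : Finset (W.Ed a) :=
  (W.crossed a).filter fun e => ∃ s ∈ W.crossings j, ∃ t ∈ W.crossings j, W.edge s a = e ∧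
    W.edge t a = e ∧ W.ht (W.src (W.edge s j)) = W.ht (W.src (W.edge t j)) ∧
      W.edge s j ≠ W.edge t j

theorem mem_crossed {i : ℕ} {e : W.Ed i} :
    e ∈ W.crossed i ↔ ∃ s ∈ W.crossings i, W.edge s i = e := by simp [crossed]

theorem vert_mem_visited {i r : ℕ} (hr : r ≤ W.len) : W.vert i r ∈ W.visited i := by
  classical
  exact Finset.mem_image_of_mem _ (by simpa [Nat.lt_succ_iff] using hr)

theorem ends_mem_visited (hm : 0 < m) {i : ℕ} (hi : i ≤ J)
    (h0 : ((m ^ (J - i) : ℕ) : ℤ) ∣ W.height 0) {e : W.Ed i} (he : e ∈ W.crossed i) :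
    W.src e ∈ W.visited i ∧ W.tgt e ∈ W.visited i := by
  obtain ⟨s, hs, rfl⟩ := W.mem_crossed.1 he
  rw [mem_crossings] at hs
  rcases lt_or_gt_of_ne hs.2 with h | h
  · obtain ⟨h1, h2, -⟩ := W.vert_of_down hm hi h0 h
    rw [← h1, ← h2]
    exact ⟨W.vert_mem_visited (by omega), W.vert_mem_visited (by omega)⟩
  · obtain ⟨h1, h2, -⟩ := W.vert_of_up hm hi h0 h
    rw [← h1, ← h2]
    exact ⟨W.vert_mem_visited (by omega), W.vert_mem_visited (by omega)⟩

theorem ht_src_edge_of_crossing (hm : 0 < m) {i : ℕ} (hi : i ≤ J)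
    (h0 : ((m ^ (J - i) : ℕ) : ℤ) ∣ W.height 0) {r : ℕ} (h : W.level i (r + 1) ≠ W.level i r) :
    W.ht (W.src (W.edge r i)) = min (W.level i r) (W.level i (r + 1)) := by
  rcases lt_or_gt_of_ne h with h | h
  · obtain ⟨-, -, h1, h2⟩ := W.vert_of_down hm hi h0 h
    omega
  · obtain ⟨-, -, h1, h2⟩ := W.vert_of_up hm hi h0 h
    omega

/-- A discrete intermediate value argument. At its last visit to level `a` the walk was at height `m
^ (j - a) * level a`, and since then it has moved inside one edge of level `a` with steps of at most
one in level `j`. -/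
theorem exists_crossing_between (hm : 0 < m) {a j : ℕ} (haj : a ≤ j) (hj : j ≤ J)
    (h0 : ((m ^ (J - a) : ℕ) : ℤ) ∣ W.height 0) (r : ℕ) {k : ℤ}
    (h1 : min (W.level j r) ((m ^ (j - a) : ℕ) * W.level a r) ≤ k)
    (h2 : k < max (W.level j r) ((m ^ (j - a) : ℕ) * W.level a r)) :
    ∃ s < r, W.level j (s + 1) ≠ W.level j s ∧ W.ht (W.src (W.edge s j)) = k ∧
      W.edge s a = W.edge r a := by
  have h0j := dvd_height_of_le haj h0
  induction r with
  | zero =>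
    rw [W.level_eq_of_dvd hm haj hj h0] at h1 h2
    simp only [min_self, max_self] at h1 h2
    omega
  | succ r ih =>
    have hne : W.level j (r + 1) ≠ (m ^ (j - a) : ℕ) * W.level a (r + 1) := by
      intro h; rw [h] at h1 h2; simp only [min_self, max_self] at h1 h2; omega
    have hea := W.edge_succ_of_level_ne hm haj hj hne
    have hla : W.level a (r + 1) = W.level a r := by
      by_contra h
      exact hne (W.level_eq_of_level_ne hm haj hj h0 h)
    rw [hla] at h1 h2
    rw [hea]
    by_cases hk : min (W.level j r) ((m ^ (j - a) : ℕ) * W.level a r) ≤ k ∧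
      k < max (W.level j r) ((m ^ (j - a) : ℕ) * W.level a r)
    · obtain ⟨s, hs, h3⟩ := ih hk.1 hk.2
      exact ⟨s, by omega, h3⟩
    · have hl := W.abs_level_le hm h0j r
      generalize ((m ^ (j - a) : ℕ) : ℤ) * W.level a r = Q at *
      have hc : W.level j (r + 1) ≠ W.level j r := by
        intro h; rw [h] at h1 h2; exact hk ⟨h1, h2⟩
      refine ⟨r, by omega, hc, ?_, rfl⟩
      rw [W.ht_src_edge_of_crossing hm hj h0j hc]
      rw [abs_le] at hl
      omega

/-- When the crossing is completed, all heights over the edge but the last one have been passed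
before, by `exists_crossing_between`; the remaining one is crossed by the final step. -/
theorem exists_crossing_over (hm : 0 < m) {a j : ℕ} (haj : a ≤ j) (hj : j ≤ J)
    (h0 : ((m ^ (J - a) : ℕ) : ℤ) ∣ W.height 0) {e : W.Ed a} (he : e ∈ W.crossed a) {k : ℤ}
    (h1 : (m ^ (j - a) : ℕ) * W.ht (W.src e) ≤ k)
    (h2 : k < (m ^ (j - a) : ℕ) * (W.ht (W.src e) + 1)) :
    ∃ s ∈ W.crossings j, W.ht (W.src (W.edge s j)) = k ∧ W.edge s a = e := by
  have h0j := dvd_height_of_le haj h0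
  obtain ⟨s, hs, rfl⟩ := W.mem_crossed.1 he
  rw [mem_crossings] at hs
  rw [W.ht_src_edge_of_crossing hm (haj.trans hj) h0 hs.2] at h1 h2
  have h3 := W.level_eq_of_level_ne hm haj hj h0 hs.2
  have h4 := W.ne_of_level_ne hm haj hj h0 hs.2
  have h5 := W.abs_level_le hm h0j s
  have h6 := W.abs_level_le hm h0 s
  by_cases hk : min (W.level j s) ((m ^ (j - a) : ℕ) * W.level a s) ≤ k ∧
      k < max (W.level j s) ((m ^ (j - a) : ℕ) * W.level a s)
  · obtain ⟨t, ht, h7, h8⟩ := W.exists_crossing_between hm haj hj h0 s hk.1 hk.2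
    exact ⟨t, W.mem_crossings.2 ⟨by omega, h7⟩, h8⟩
  · refine ⟨s, W.mem_crossings.2 ⟨hs.1, h4⟩, ?_, rfl⟩
    rw [W.ht_src_edge_of_crossing hm hj h0j h4]
    have h7 := hs.2
    have h8 : (W.level a (s + 1) = W.level a s + 1 ∧ ((m ^ (j - a) : ℕ) : ℤ) * W.level a (s + 1) =
        (m ^ (j - a) : ℕ) * W.level a s + (m ^ (j - a) : ℕ)) ∨
        (W.level a (s + 1) = W.level a s - 1 ∧ ((m ^ (j - a) : ℕ) : ℤ) * W.level a (s + 1) =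
        (m ^ (j - a) : ℕ) * W.level a s - (m ^ (j - a) : ℕ)) := by
      rw [abs_le] at h6
      rcases (by omega : W.level a (s + 1) = W.level a s + 1 ∨
        W.level a (s + 1) = W.level a s - 1) with h | h <;> rw [h]
      · left; exact ⟨rfl, by ring⟩
      · right; exact ⟨rfl, by ring⟩
    rw [abs_le] at h5
    rcases h8 with ⟨h8, h9⟩ | ⟨h8, h9⟩
    · rw [h8, min_eq_left (by omega)] at h1 h2
      rw [mul_add, mul_one] at h2
      rw [h8, mul_add, mul_one] at h3
      generalize ((m ^ (j - a) : ℕ) : ℤ) = q at *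
      generalize q * W.level a s = Q at *
      omega
    · rw [h8, min_eq_right (by omega)] at h1 h2
      rw [sub_add_cancel] at h2
      rw [h8] at h9 h3
      generalize ((m ^ (j - a) : ℕ) : ℤ) = q at *
      generalize q * (W.level a s - 1) = Q' at *
      generalize q * W.level a s = Q at *
      omega

end TowerWalk

/-! ### Counting crossings, crossed edges, visited vertices and branchings -/

namespace TowerWalk

open LazyWalk

variable {m J : ℕ} (W : TowerWalk.{u} m J)

/-- This is `card_moves` for the levels of the tower: the normalized length does not decrease with
the level, and its increment pays for the steps back. -/
theorem card_crossings (hm : 0 < m) {a j : ℕ} (haj : a ≤ j) (hj : j ≤ J)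
    (h0 : ((m ^ (J - a) : ℕ) : ℤ) ∣ W.height 0) :
    m ^ (j - a) * (W.crossings a).card + 2 * (W.backTimes a j).card ≤ (W.crossings j).card := by
  have h := card_moves (Nat.pow_pos hm) (W.abs_level_le hm (dvd_height_of_le haj h0))
    (W.dvd_level_zero hm haj hj h0) W.len
  rw [← W.level_eq_coarsen hm haj hj h0] at h
  have h1 := abs_nonneg (W.level j W.len - (m ^ (j - a) : ℕ) * W.level a W.len)
  simp only [crossings, backTimes]
  zify
  push_cast at h h1
  linarith

theorem card_turns_succ_le (hm : 2 ≤ m) {a : ℕ} (ha : a + 1 ≤ J)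
    (h0 : ((m ^ (J - a) : ℕ) : ℤ) ∣ W.height 0) :
    (turns (W.level (a + 1)) W.len).card ≤
      (turns (W.level a) W.len).card + 2 * (W.backTimes a (a + 1)).card + 1 := by
  have h := card_turns_le (q := m ^ (a + 1 - a)) (by simpa using hm)
    (W.abs_level_le (by omega) (dvd_height_of_le (Nat.le_succ a) h0))
    (W.dvd_level_zero (by omega) (Nat.le_succ a) ha h0) W.len
  rw [← W.level_eq_coarsen (by omega) (Nat.le_succ a) ha h0] at h
  exact h

theorem card_crossed_le (i : ℕ) : (W.crossed i).card ≤ (W.crossings i).card := by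
  classical
  exact Finset.card_image_le

theorem card_turns_le_crossings (i : ℕ) :
    (turns (W.level i) W.len).card ≤ (W.crossings i).card := by
  refine Finset.card_le_card fun r hr => ?_
  simp only [turns, Finset.mem_filter] at hr
  simp only [crossings, moves, Finset.mem_filter]
  exact ⟨hr.1, hr.2.1⟩

/-- One crossed lift is chosen over each crossed edge at each of its `m ^ (j - a)` heights. An edge
in `multi` has a further crossed lift, which the choice has missed. -/
theorem card_crossed (hm : 0 < m) {a j : ℕ} (haj : a ≤ j) (hj : j ≤ J)
    (h0 : ((m ^ (J - a) : ℕ) : ℤ) ∣ W.height 0) :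
    m ^ (j - a) * (W.crossed a).card + (W.multi a j).card ≤ (W.crossed j).card := by
  classical
  have h1 : ∀ x : W.Ed a × ℕ, x ∈ W.crossed a ×ˢ Finset.range (m ^ (j - a)) →
      ∃ s ∈ W.crossings j, W.ht (W.src (W.edge s j)) =
        (m ^ (j - a) : ℕ) * W.ht (W.src x.1) + x.2 ∧ W.edge s a = x.1 := by
    rintro ⟨e, k⟩ hx
    simp only [Finset.mem_product, Finset.mem_range] at hx
    refine W.exists_crossing_over hm haj hj h0 hx.1 (by simp) ?_
    rw [mul_add, mul_one]
    have : (k : ℤ) < (m ^ (j - a) : ℕ) := by exact_mod_cast hx.2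
    simpa using this
  choose! s hs hht hed using h1
  have hq : ((m ^ (j - a) : ℕ) : ℤ) ≠ 0 := by exact_mod_cast (Nat.pow_pos hm).ne'
  set F : W.Ed a × ℕ → W.Ed j := fun x => W.edge (s x) j
  have hinj : Set.InjOn F (W.crossed a ×ˢ Finset.range (m ^ (j - a)) : Finset _) := by
    intro x hx y hy hxy
    have e1 : x.1 = y.1 := by rw [← hed x hx, ← hed y hy, W.edge_eq_of_edge_eq haj hxy]
    have e2 := hht x hx
    rw [show W.edge (s x) j = W.edge (s y) j from hxy, hht y hy, e1] at e2
    exact Prod.ext e1 (by omega)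
  have h2 : ∀ e : W.Ed a, e ∈ W.multi a j → ∃ t ∈ W.crossings j, W.edge t a = e ∧
      W.edge t j ∉ (W.crossed a ×ˢ Finset.range (m ^ (j - a))).image F := by
    intro e he
    simp only [multi, Finset.mem_filter] at he
    obtain ⟨-, t, ht, t', ht', h3, h4, h5, h6⟩ := he
    by_contra! hcon
    have h7 := hcon t ht h3
    have h8 := hcon t' ht' h4
    rw [Finset.mem_image] at h7 h8
    obtain ⟨x, hx, hx'⟩ := h7
    obtain ⟨y, hy, hy'⟩ := h8
    refine h6 ?_
    rw [← hx', ← hy']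
    congr 1
    have e1 : x.1 = e := by rw [← hed x hx, W.edge_eq_of_edge_eq haj hx', h3]
    have e2 : y.1 = e := by rw [← hed y hy, W.edge_eq_of_edge_eq haj hy', h4]
    have e3 := hht x hx
    have e4 := hht y hy
    rw [show W.edge (s x) j = _ from hx', e1] at e3
    rw [show W.edge (s y) j = _ from hy', e2] at e4
    -- The choice contains only one lift per edge and height, so it cannot contain both of two
    -- distinct lifts at the same height.
    exact Prod.ext (e1.trans e2.symm) (by omega)
  choose! t ht hta htF using h2
  have hinj2 : Set.InjOn (fun e => W.edge (t e) j) (W.multi a j) := by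
    intro e he e' he' h
    rw [← hta e he, ← hta e' he', W.edge_eq_of_edge_eq haj h]
  have hd : Disjoint ((W.crossed a ×ˢ Finset.range (m ^ (j - a))).image F)
      ((W.multi a j).image fun e => W.edge (t e) j) := by
    rw [Finset.disjoint_right]
    intro f hf
    obtain ⟨e, he, rfl⟩ := Finset.mem_image.1 hf
    exact htF e he
  have hsub : ((W.crossed a ×ˢ Finset.range (m ^ (j - a))).image F) ∪
      ((W.multi a j).image fun e => W.edge (t e) j) ⊆ W.crossed j := by
    refine Finset.union_subset ?_ ?_
    · intro f hf
      obtain ⟨x, hx, rfl⟩ := Finset.mem_image.1 hf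
      exact W.mem_crossed.2 ⟨_, hs x hx, rfl⟩
    · intro f hf
      obtain ⟨e, he, rfl⟩ := Finset.mem_image.1 hf
      exact W.mem_crossed.2 ⟨_, ht e he, rfl⟩
  have := Finset.card_le_card hsub
  rw [Finset.card_union_of_disjoint hd, Finset.card_image_of_injOn hinj,
    Finset.card_image_of_injOn hinj2, Finset.card_product, Finset.card_range] at this
  linarith [mul_comm (m ^ (j - a)) (W.crossed a).card]

/-- Every visited vertex has a visited lift, at a height divisible by `m`. Every crossed edge
contributes `m - 1` more vertices over its interior, at the other heights. With `card_crossed`, the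
number of crossed edges minus visited vertices grows by at most the surplus of crossed edges. -/
theorem card_visited_succ (hm : 0 < m) {i : ℕ} (hi : i + 1 ≤ J)
    (h0 : ((m ^ (J - i) : ℕ) : ℤ) ∣ W.height 0) :
    (W.visited i).card + (m - 1) * (W.crossed i).card ≤ (W.visited (i + 1)).card := by
  classical
  have h0' := dvd_height_of_le (Nat.le_succ i) h0
  have h1 : ∀ v : W.Pt i, v ∈ W.visited i → ∃ x ∈ W.visited (i + 1), W.pr x = v ∧
      (m : ℤ) ∣ W.ht x := by
    intro v hv
    obtain ⟨r, hr, rfl⟩ := Finset.mem_image.1 hv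
    rw [Finset.mem_range] at hr
    have hd := W.dvd_height_lastVisit h0 r
    have hle := W.lastVisit_le i r
    refine ⟨W.vert (i + 1) (W.lastVisit i r), W.vert_mem_visited (by omega), ?_, ?_⟩
    · rw [vert, W.lastVisit_of_dvd (dvd_height_of_le (Nat.le_succ i) hd), W.pr_pos]; rfl
    · rw [W.ht_vert hm hi h0', W.level_eq_of_dvd hm (Nat.le_succ i) hi hd]
      simp
  -- The value `0` is omitted because the lower end of such a lift lies over a vertex and is already
  -- counted.
  have h2 : ∀ x : W.Ed i × ℕ, x ∈ W.crossed i ×ˢ Finset.Ico 1 m →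
      ∃ f ∈ W.crossed (i + 1), W.ht (W.src f) = m * W.ht (W.src x.1) + x.2 ∧ W.up f = x.1 := by
    rintro ⟨e, k⟩ hx
    simp only [Finset.mem_product, Finset.mem_Ico] at hx
    obtain ⟨s, hs, h3, h4⟩ := W.exists_crossing_over hm (Nat.le_succ i) hi h0 hx.1
      (k := m * W.ht (W.src e) + k) (by simp) (by simp [mul_add]; omega)
    exact ⟨W.edge s (i + 1), W.mem_crossed.2 ⟨s, hs, rfl⟩, h3, by rw [W.up_edge, h4]⟩
  have : Nonempty (W.Pt (i + 1)) := ⟨W.vert (i + 1) 0⟩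
  have : Nonempty (W.Ed (i + 1)) := ⟨W.edge 0 (i + 1)⟩
  choose! g hg hpr hdvd using h1
  choose! f hf hht hup using h2
  have hm0 : (m : ℤ) ≠ 0 := by exact_mod_cast hm.ne'
  have hnd : ∀ x ∈ W.crossed i ×ˢ Finset.Ico 1 m, ¬ (m : ℤ) ∣ W.ht (W.src (f x)) := by
    intro x hx hd
    rw [hht x hx] at hd
    have h3 : (m : ℤ) ∣ (x.2 : ℤ) := (Int.dvd_add_right (Dvd.intro _ rfl)).1 hd
    simp only [Finset.mem_product, Finset.mem_Ico] at hx
    have := Nat.le_of_dvd (by omega) (Int.natCast_dvd_natCast.1 h3)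
    omega
  have hinj1 : Set.InjOn g (W.visited i) := by
    intro v hv v' hv' h
    rw [← hpr v hv, ← hpr v' hv', h]
  have hinj2 : Set.InjOn (fun x => W.src (f x)) (W.crossed i ×ˢ Finset.Ico 1 m : Finset _) := by
    intro x hx y hy hxy
    have e1 : x.1 = y.1 := by
      rw [← hup x hx, ← hup y hy]
      exact W.up_eq_of_pr_eq _ _ (by simpa using congrArg W.pr hxy) (hnd x hx)
    have e2 := hht x hx
    rw [show W.src (f x) = W.src (f y) from hxy, hht y hy, e1] at e2
    exact Prod.ext e1 (by omega)
  have hd : Disjoint ((W.visited i).image g)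
      ((W.crossed i ×ˢ Finset.Ico 1 m).image fun x => W.src (f x)) := by
    rw [Finset.disjoint_left]
    intro y hy hy'
    obtain ⟨v, hv, rfl⟩ := Finset.mem_image.1 hy
    obtain ⟨x, hx, hx'⟩ := Finset.mem_image.1 hy'
    exact hnd x hx (by rw [hx']; exact hdvd v hv)
  have hsub : ((W.visited i).image g) ∪
      ((W.crossed i ×ˢ Finset.Ico 1 m).image fun x => W.src (f x)) ⊆ W.visited (i + 1) := by
    refine Finset.union_subset ?_ ?_
    · intro y hy
      obtain ⟨v, hv, rfl⟩ := Finset.mem_image.1 hy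
      exact hg v hv
    · intro y hy
      obtain ⟨x, hx, rfl⟩ := Finset.mem_image.1 hy
      exact (W.ends_mem_visited hm hi h0' (hf x hx)).1
  have := Finset.card_le_card hsub
  rw [Finset.card_union_of_disjoint hd, Finset.card_image_of_injOn hinj1,
    Finset.card_image_of_injOn hinj2, Finset.card_product, Nat.card_Ico] at this
  linarith [mul_comm (m - 1) (W.crossed i).card]

open scoped Classical in
/-- The first and the last vertex, and the vertices at which the walk turns. -/
noncomputable def turnVerts (a : ℕ) : Finset (W.Pt a) :=
  {W.vert a 0, W.vert a W.len} ∪ (turns (W.level a) W.len).image (W.vert a)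

theorem card_turnVerts_le (a : ℕ) :
    (W.turnVerts a).card ≤ 2 + (turns (W.level a) W.len).card := by
  classical
  exact (Finset.card_union_le _ _).trans (add_le_add Finset.card_le_two Finset.card_image_le)

/-- If no crossing followed, the vertex would be the last one of the walk, which `turnVerts`
contains. -/
theorem exists_next_crossing {a r : ℕ} (hm : 0 < m) (ha : a ≤ J)
    (h0 : ((m ^ (J - a) : ℕ) : ℤ) ∣ W.height 0) (hr : r ≤ W.len)
    (hv : W.vert a r ∉ W.turnVerts a) :
    ∃ s ∈ W.crossings a, r ≤ s ∧ ∀ t, r ≤ t → t ≤ s → W.level a t = W.level a s := by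
  classical
  by_cases h : ∃ t, r ≤ t ∧ t ≤ W.len ∧ W.level a r ≠ W.level a t
  · obtain ⟨t, h1, h2, h3⟩ := h
    obtain ⟨s, h4, h5, h6, h7⟩ := exists_next_move h1 h3
    exact ⟨s, W.mem_crossings.2 ⟨by omega, h6⟩, h4, fun t h8 h9 => by
      rw [h7 t h8 h9, h7 s h4 le_rfl]⟩
  · push Not at h
    refine absurd ?_ hv
    have : W.vert a r = W.vert a W.len := W.vert_eq_of_const hm ha h0 hr fun t h1 h2 => by
      rw [← h t h1 h2, ← h W.len hr le_rfl]
    simp [turnVerts, this]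

/-- The walk passes monotonically through the vertices at which it does not turn. -/
theorem exists_pass {a r : ℕ} (hm : 0 < m) (ha : a ≤ J)
    (h0 : ((m ^ (J - a) : ℕ) : ℤ) ∣ W.height 0) (hr : r ≤ W.len)
    (hv : W.vert a r ∉ W.turnVerts a) :
    ∃ s ∈ W.crossings a, ∃ t ∈ W.crossings a, s < t ∧
      (∀ k, s < k → k ≤ t → W.level a k = W.level a t) ∧
      W.vert a (s + 1) = W.vert a r ∧ W.vert a t = W.vert a r ∧
      W.level a (t + 1) - W.level a t = W.level a t - W.level a s := by
  classical
  obtain ⟨t, ht, hrt, hct⟩ := W.exists_next_crossing hm ha h0 hr hv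
  have hvt : W.vert a r = W.vert a t := W.vert_eq_of_const hm ha h0 hrt hct
  have h1 : ∃ s ≤ t, W.level a s ≠ W.level a t := by
    by_contra! hcon
    have : W.vert a 0 = W.vert a t :=
      W.vert_eq_of_const hm ha h0 (Nat.zero_le _) fun k _ hk => hcon k hk
    exact hv (by simp [turnVerts, hvt, ← this])
  obtain ⟨s, hst, hs, hcs⟩ := exists_last_move h1
  rw [mem_crossings] at ht
  refine ⟨s, W.mem_crossings.2 ⟨by omega, hs⟩, t, W.mem_crossings.2 ht, hst, hcs, ?_, hvt.symm, ?_⟩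
  · rw [hvt]; exact W.vert_eq_of_const hm ha h0 hst fun k h2 h3 => hcs k h2 h3
  · have hp := previous_eq_of_last_move hst hs hcs
    have hnt : W.level a (t + 1) ≠ W.level a s := by
      intro h2
      refine hv ?_
      rw [hvt, turnVerts]
      refine Finset.mem_union_right _ (Finset.mem_image_of_mem _ ?_)
      simp only [turns, Finset.mem_filter, Finset.mem_range]
      exact ⟨ht.1, ht.2, by rw [hp, h2]⟩
    have e1 := W.abs_level_le hm h0 t
    have e2 := W.abs_level_le hm h0 s
    have e3 := ht.2
    have e4 := hcs (s + 1) (by omega) hst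
    rw [abs_le] at e1 e2
    omega

open scoped Classical in
/-- The vertices with two crossed edges going up, or two crossed edges going down. -/
noncomputable def branching (a : ℕ) : Finset (W.Pt a) :=
  ((W.visited a).filter fun v => ∃ e ∈ W.crossed a, ∃ f ∈ W.crossed a, e ≠ f ∧
    W.src e = v ∧ W.src f = v) ∪
  ((W.visited a).filter fun v => ∃ e ∈ W.crossed a, ∃ f ∈ W.crossed a, e ≠ f ∧
    W.tgt e = v ∧ W.tgt f = v)

end TowerWalk

-- Fibre by fibre: a fibre with at least two elements has one to spare over the count of vertices,
-- and an empty fibre is the only one that falls short of it.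
open scoped Classical in
theorem Finset.card_filter_two_preimages_le {α β : Type*} (E : Finset α) (V : Finset β) (f : α → β)
    (hf : ∀ e ∈ E, f e ∈ V) :
    (V.filter fun v => ∃ e ∈ E, ∃ e' ∈ E, e ≠ e' ∧ f e = v ∧ f e' = v).card + V.card ≤
      E.card + (V.filter fun v => ∀ e ∈ E, f e ≠ v).card := by
  rw [Finset.card_eq_sum_card_fiberwise hf, Finset.card_filter, Finset.card_filter,
    Finset.card_eq_sum_ones V, ← Finset.sum_add_distrib, ← Finset.sum_add_distrib]
  refine Finset.sum_le_sum fun v _ => ?_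
  by_cases h1 : ∀ e ∈ E, f e ≠ v
  · rw [if_pos h1, if_neg]
    · omega
    · rintro ⟨e, he, -, -, -, h, -⟩; exact h1 e he h
  · rw [if_neg h1]
    push Not at h1
    obtain ⟨e, he, hev⟩ := h1
    split_ifs with h2
    · obtain ⟨e, he, e', he', hne, h3, h4⟩ := h2
      have : 1 < (E.filter fun e => f e = v).card :=
        Finset.one_lt_card.2 ⟨e, by simp [he, h3], e', by simp [he', h4], hne⟩
      omega
    · have : 0 < (E.filter fun e => f e = v).card :=
        Finset.card_pos.2 ⟨e, by simp [he, hev]⟩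
      omega

/-! ### Bad vertices, and upward paths away from them -/

namespace TowerWalk

open LazyWalk

variable {m J : ℕ} (W : TowerWalk.{u} m J)

theorem exists_edges_of_notMem_turnVerts {a : ℕ} (hm : 0 < m) (ha : a ≤ J)
    (h0 : ((m ^ (J - a) : ℕ) : ℤ) ∣ W.height 0) {v : W.Pt a} (hv : v ∈ W.visited a)
    (hv' : v ∉ W.turnVerts a) :
    (∃ e ∈ W.crossed a, W.src e = v) ∧ ∃ e ∈ W.crossed a, W.tgt e = v := by
  classical
  obtain ⟨r, hr, rfl⟩ := Finset.mem_image.1 hv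
  rw [Finset.mem_range] at hr
  obtain ⟨s, hs, t, ht, hst, hc, h1, h2, h3⟩ := W.exists_pass hm ha h0 (by omega) hv'
  have h4 := hc (s + 1) (by omega) hst
  have hs' := (W.mem_crossings.1 hs).2
  rcases lt_or_gt_of_ne hs' with h | h
  · have e1 := W.vert_of_down hm ha h0 h
    have e2 := W.vert_of_down hm ha h0 (r := t) (by omega)
    exact ⟨⟨_, W.mem_crossed.2 ⟨s, hs, rfl⟩, by rw [← e1.2.1, h1]⟩,
      ⟨_, W.mem_crossed.2 ⟨t, ht, rfl⟩, by rw [← e2.1, h2]⟩⟩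
  · have e1 := W.vert_of_up hm ha h0 h
    have e2 := W.vert_of_up hm ha h0 (r := t) (by omega)
    exact ⟨⟨_, W.mem_crossed.2 ⟨t, ht, rfl⟩, by rw [← e2.1, h2]⟩,
      ⟨_, W.mem_crossed.2 ⟨s, hs, rfl⟩, by rw [← e1.2.1, h1]⟩⟩

/-- The fibre count is applied to lower and to upper ends. Only at vertices of `turnVerts` can one
of these fibres be empty, since the walk passes monotonically through the others. -/
theorem card_branching_le {a : ℕ} (hm : 0 < m) (ha : a ≤ J)
    (h0 : ((m ^ (J - a) : ℕ) : ℤ) ∣ W.height 0) :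
    (W.branching a).card + 2 * (W.visited a).card ≤
      2 * (W.crossed a).card + 2 * (2 + (turns (W.level a) W.len).card) := by
  classical
  have h1 := Finset.card_filter_two_preimages_le (W.crossed a) (W.visited a) W.src
    fun e he => (W.ends_mem_visited hm ha h0 he).1
  have h2 := Finset.card_filter_two_preimages_le (W.crossed a) (W.visited a) W.tgt
    fun e he => (W.ends_mem_visited hm ha h0 he).2
  have h3 : ((W.visited a).filter fun v => ∀ e ∈ W.crossed a, W.src e ≠ v).card ≤
      (W.turnVerts a).card := by
    refine Finset.card_le_card fun v hv => ?_
    rw [Finset.mem_filter] at hv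
    by_contra hv'
    obtain ⟨⟨e, he, h⟩, -⟩ := W.exists_edges_of_notMem_turnVerts hm ha h0 hv.1 hv'
    exact hv.2 e he h
  have h4 : ((W.visited a).filter fun v => ∀ e ∈ W.crossed a, W.tgt e ≠ v).card ≤
      (W.turnVerts a).card := by
    refine Finset.card_le_card fun v hv => ?_
    rw [Finset.mem_filter] at hv
    by_contra hv'
    obtain ⟨-, ⟨e, he, h⟩⟩ := W.exists_edges_of_notMem_turnVerts hm ha h0 hv.1 hv'
    exact hv.2 e he h
  have h5 := W.card_turnVerts_le a
  have h6 := Finset.card_union_le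
    ((W.visited a).filter fun v => ∃ e ∈ W.crossed a, ∃ f ∈ W.crossed a, e ≠ f ∧
      W.src e = v ∧ W.src f = v)
    ((W.visited a).filter fun v => ∃ e ∈ W.crossed a, ∃ f ∈ W.crossed a, e ≠ f ∧
      W.tgt e = v ∧ W.tgt f = v)
  simp only [branching]
  omega

open scoped Classical in
/-- The vertices of the `a`-th graph near which the walk in the `j`-th graph may fail to follow
a single monotone path. -/
noncomputable def bad (a j : ℕ) : Finset (W.Pt a) :=
  W.turnVerts a ∪ (W.backTimes a j).image (W.vert a) ∪ W.branching a ∪ (W.multi a j).image W.src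

theorem card_bad_le (a j : ℕ) : (W.bad a j).card ≤ (2 + (turns (W.level a) W.len).card) +
    (W.backTimes a j).card + (W.branching a).card + (W.multi a j).card := by
  classical
  refine (Finset.card_union_le _ _).trans (add_le_add ?_ Finset.card_image_le)
  refine (Finset.card_union_le _ _).trans (add_le_add ?_ le_rfl)
  exact (Finset.card_union_le _ _).trans (add_le_add (W.card_turnVerts_le a) Finset.card_image_le)

variable {W} in
theorem notMem_of_notMem_bad {a j : ℕ} {v : W.Pt a} (hv : v ∉ W.bad a j) :
    v ∉ W.turnVerts a ∧ (∀ t ∈ W.backTimes a j, W.vert a t ≠ v) ∧ v ∉ W.branching a ∧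
      ∀ e ∈ W.multi a j, W.src e ≠ v := by
  classical
  simp only [bad, Finset.mem_union, Finset.mem_image, not_or, not_exists, not_and] at hv
  exact ⟨hv.1.1.1, hv.1.1.2, hv.1.2, hv.2⟩

theorem edge_eq_of_src_eq {a j : ℕ} (hm : 0 < m) (ha : a ≤ J)
    (h0 : ((m ^ (J - a) : ℕ) : ℤ) ∣ W.height 0) {e f : W.Ed a} (he : e ∈ W.crossed a)
    (hf : f ∈ W.crossed a) (h : W.src e = W.src f) (hb : W.src e ∉ W.bad a j) : e = f := by
  classical
  by_contra hne
  refine (notMem_of_notMem_bad hb).2.2.1 (Finset.mem_union_left _ (Finset.mem_filter.2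
    ⟨(W.ends_mem_visited hm ha h0 he).1, e, he, f, hf, hne, rfl, h.symm⟩))

theorem edge_eq_of_tgt_eq {a j : ℕ} (hm : 0 < m) (ha : a ≤ J)
    (h0 : ((m ^ (J - a) : ℕ) : ℤ) ∣ W.height 0) {e f : W.Ed a} (he : e ∈ W.crossed a)
    (hf : f ∈ W.crossed a) (h : W.tgt e = W.tgt f) (hb : W.tgt e ∉ W.bad a j) : e = f := by
  classical
  by_contra hne
  refine (notMem_of_notMem_bad hb).2.2.1 (Finset.mem_union_right _ (Finset.mem_filter.2
    ⟨(W.ends_mem_visited hm ha h0 he).2, e, he, f, hf, hne, rfl, h.symm⟩))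

/-- Once off the vertex of level `a`, the walk could change its edge of level `a` without a crossing
only by returning to that vertex, and the last step of the return is a step back. -/
theorem edge_eq_of_no_back (hm : 0 < m) {a j : ℕ} (haj : a ≤ j) (hj : j ≤ J)
    (h0 : ((m ^ (J - a) : ℕ) : ℤ) ∣ W.height 0) {r s : ℕ} (hrs : r ≤ s) (hs : s < W.len)
    (hc : ∀ t, r ≤ t → t ≤ s → W.level a t = W.level a s)
    (hb : ∀ t, r ≤ t → t < s → t ∉ W.backTimes a j)
    (hne : W.level j r ≠ (m ^ (j - a) : ℕ) * W.level a r) : W.edge r a = W.edge s a := by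
  obtain ⟨k, rfl⟩ := Nat.exists_eq_add_of_le hrs
  induction k generalizing r with
  | zero => rfl
  | succ k ih =>
    have h1 := hb r le_rfl (by omega)
    have h2 := hc r le_rfl hrs
    have h3 := hc (r + 1) (by omega) (by omega)
    simp only [backTimes, backs, Finset.mem_filter, Finset.mem_range, not_and,
      ← W.level_eq_coarsen hm haj hj h0, not_lt] at h1
    have h4 : W.level j (r + 1) ≠ (m ^ (j - a) : ℕ) * W.level a (r + 1) := by
      intro h5
      rw [h3, ← h2] at h5
      have := h1 (by omega) (by rw [h5]; exact hne.symm)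
      rw [h5, sub_self, abs_zero] at this
      exact hne (sub_eq_zero.1 (abs_eq_zero.1 (le_antisymm this (abs_nonneg _))))
    have e : r + (k + 1) = r + 1 + k := by ring
    rw [e] at hs hc hb ⊢
    rw [← W.edge_succ_of_level_ne hm haj hj h4]
    exact ih h4 (by omega) hs (fun t h6 h7 => hc t (by omega) h7)
      (fun t h6 h7 => hb t (by omega) h7)

/-- Without steps back, the walk in the `j`-th graph follows a lift of the crossed edge of the
`a`-th graph. -/
theorem exists_upPath_of_no_back (hm : 0 < m) {a j : ℕ} (haj : a ≤ j) (hj : j ≤ J)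
    (h0 : ((m ^ (J - a) : ℕ) : ℤ) ∣ W.height 0) {r s : ℕ} (hrs : r ≤ s) (hs : s ∈ W.crossings a)
    (hc : ∀ t, r ≤ t → t ≤ s → W.level a t = W.level a s)
    (hb : ∀ t, r ≤ t → t < s → t ∉ W.backTimes a j) :
    ∃ l : List (W.Ed j),
      (W.level a s < W.level a (s + 1) → UpPath W.src W.tgt (W.vert j r) l (W.vert j (s + 1)) ∧
        (m ^ (j - a) : ℕ) * W.level a s ≤ W.level j r) ∧
      (W.level a (s + 1) < W.level a s → UpPath W.src W.tgt (W.vert j (s + 1)) l (W.vert j r) ∧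
        W.level j r ≤ (m ^ (j - a) : ℕ) * W.level a s) ∧
      (∀ f ∈ l, ∃ t ∈ W.crossings j, W.edge t j = f ∧ W.edge t a = W.edge s a) ∧
      ∃ f ∈ l, W.vert j r = W.src f ∨ W.vert j r = W.tgt f := by
  have h0j := dvd_height_of_le haj h0
  have hs' := W.mem_crossings.1 hs
  obtain ⟨k, rfl⟩ := Nat.exists_eq_add_of_le hrs
  induction k generalizing r with
  | zero =>
    have h1 := W.ne_of_level_ne hm haj hj h0 hs'.2
    have h2 := W.level_eq_of_level_ne hm haj hj h0 hs'.2
    have h3 := W.abs_level_sub_lt hm haj hj h0 r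
    have h4 := W.abs_level_le hm h0j r
    simp only [add_zero] at *
    rw [abs_lt] at h3
    rw [abs_le] at h4
    refine ⟨[W.edge r j], fun h => ?_, fun h => ?_, ?_, ?_⟩
    · obtain ⟨-, -, -, h5⟩ := W.vert_of_up hm (haj.trans hj) h0 h
      rw [h5, mul_add, mul_one] at h2
      obtain ⟨h6, h7, -⟩ := W.vert_of_up hm hj h0j (r := r) (by omega)
      rw [h6, h7]
      exact ⟨UpPath.singleton _, by omega⟩
    · obtain ⟨-, -, -, h5⟩ := W.vert_of_down hm (haj.trans hj) h0 h
      rw [h5, mul_sub, mul_one] at h2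
      obtain ⟨h6, h7, -⟩ := W.vert_of_down hm hj h0j (r := r) (by omega)
      rw [h6, h7]
      exact ⟨UpPath.singleton _, by omega⟩
    · intro f hf
      rw [List.mem_singleton] at hf
      exact ⟨r, W.mem_crossings.2 ⟨hs'.1, h1⟩, hf.symm, rfl⟩
    · refine ⟨_, List.mem_singleton_self _, ?_⟩
      rcases W.vert_cases hm hj h0j r with h | h
      · exact Or.inl h.2
      · exact Or.inr h.2
  | succ k ih =>
    have e : r + (k + 1) = r + 1 + k := by ring
    rw [e] at hs hs' hc hb ⊢
    obtain ⟨l, hu, hd, hl, f, hf, hfv⟩ := ih (r := r + 1) (by omega) hs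
      (fun t h6 h7 => hc t (by omega) h7) (fun t h6 h7 => hb t (by omega) h7) hs'
    have h1 := hb r le_rfl (by omega)
    have h2 := hc r le_rfl (by omega)
    have h3 := hc (r + 1) (by omega) (by omega)
    simp only [backTimes, backs, Finset.mem_filter, Finset.mem_range, not_and,
      ← W.level_eq_coarsen hm haj hj h0, not_lt] at h1
    by_cases hx : W.level j (r + 1) = W.level j r
    · rw [W.vert_succ_eq hm hj h0j hx, hx] at hu hd
      rw [W.vert_succ_eq hm hj h0j hx] at hfv
      exact ⟨l, hu, hd, hl, f, hf, hfv⟩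
    · have h4 := h1 (by omega) hx
      have h5 := W.abs_level_le hm h0j r
      rw [h2] at h4
      -- The move is not a step back, so it does not end at the vertex of level `a`. From there on
      -- the edge of level `a` is the one crossed at the end.
      have hne : W.level j (r + 1) ≠ (m ^ (j - a) : ℕ) * W.level a (r + 1) := by
        intro h6
        rw [h3] at h6
        rw [h6, sub_self, abs_zero] at h4
        refine hx (h6.trans ?_)
        exact (sub_eq_zero.1 (abs_eq_zero.1 (le_antisymm h4 (abs_nonneg _)))).symm
      have hed : W.edge r a = W.edge (r + 1 + k) a := by
        rw [← W.edge_succ_of_level_ne hm haj hj hne]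
        exact W.edge_eq_of_no_back hm haj hj h0 (by omega) hs'.1
          (fun t h6 h7 => hc t (by omega) h7) (fun t h6 h7 => hb t (by omega) h7) hne
      have hcr : r ∈ W.crossings j := W.mem_crossings.2 ⟨by omega, hx⟩
      rw [h3] at hne
      generalize ((m ^ (j - a) : ℕ) : ℤ) * W.level a (r + 1 + k) = Q at *
      rcases lt_or_gt_of_ne hs'.2 with h6 | h6
      · obtain ⟨h7, h8⟩ := hd h6
        obtain ⟨h9, h10, -⟩ := W.vert_of_down hm hj h0j (r := r) (by grind)
        -- A descent is recorded as an upward path read backwards in time, so the earlier step is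
        -- appended at the upper end. In an ascent it is prepended.
        refine ⟨l ++ [W.edge r j], fun h => absurd h (by omega), fun _ => ⟨?_, by grind⟩, ?_,
          W.edge r j, by simp, Or.inr h9⟩
        · rw [h9]; rw [h10] at h7; exact h7.append (UpPath.singleton _)
        · intro g hg
          rw [List.mem_append, List.mem_singleton] at hg
          rcases hg with hg | rfl
          · exact hl g hg
          · exact ⟨r, hcr, rfl, hed⟩
      · obtain ⟨h7, h8⟩ := hu h6
        obtain ⟨h9, h10, -⟩ := W.vert_of_up hm hj h0j (r := r) (by grind)
        refine ⟨W.edge r j :: l, fun _ => ⟨?_, by grind⟩, fun h => absurd h (by omega), ?_,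
          W.edge r j, by simp, Or.inl h9⟩
        · rw [h9]; rw [h10] at h7; exact ⟨rfl, h7⟩
        · intro g hg
          rw [List.mem_cons] at hg
          rcases hg with rfl | hg
          · exact ⟨r, hcr, rfl, hed⟩
          · exact hl g hg

/-- Away from bad vertices this attaches every moment of the walk, even one without a crossing of
its own, to an edge of level `j` that the walk crosses over a crossed edge of level `a`. -/
theorem exists_crossing_of_notMem_bad (hm : 0 < m) {a j : ℕ} (haj : a ≤ j) (hj : j ≤ J)
    (h0 : ((m ^ (J - a) : ℕ) : ℤ) ∣ W.height 0) {r : ℕ} (hr : r ≤ W.len)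
    (hv : W.vert a r ∉ W.bad a j) :
    ∃ e ∈ W.crossed a, (W.vert a r = W.src e ∨ W.vert a r = W.tgt e) ∧
      ∃ t ∈ W.crossings j, W.edge t a = e ∧
        (W.vert j r = W.src (W.edge t j) ∨ W.vert j r = W.tgt (W.edge t j)) := by
  have hb := notMem_of_notMem_bad hv
  obtain ⟨s, hs, hrs, hc⟩ := W.exists_next_crossing hm (haj.trans hj) h0 hr hb.1
  have hvc : ∀ t, r ≤ t → t ≤ s → W.vert a t = W.vert a s := fun t h1 h2 =>
    W.vert_eq_of_const hm (haj.trans hj) h0 h2 fun k h3 h4 => hc k (by omega) h4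
  obtain ⟨l, -, -, hl, f, hf, hfv⟩ := W.exists_upPath_of_no_back hm haj hj h0 hrs hs hc
    fun t h1 h2 h3 => hb.2.1 t h3 (by rw [hvc t h1 h2.le, hvc r le_rfl hrs])
  obtain ⟨t, ht, rfl, hta⟩ := hl f hf
  refine ⟨W.edge s a, W.mem_crossed.2 ⟨s, hs, rfl⟩, ?_, t, ht, hta, hfv⟩
  rw [hvc r le_rfl hrs]
  rcases W.vert_cases hm (haj.trans hj) h0 s with h | h
  · exact Or.inl h.2
  · exact Or.inr h.2

/-- The lift of an edge with good ends, starting from a given time. -/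
theorem exists_upPath_of_crossing (hm : 0 < m) {a j : ℕ} (haj : a ≤ j) (hj : j ≤ J)
    (h0 : ((m ^ (J - a) : ℕ) : ℤ) ∣ W.height 0) {r s : ℕ} (hrs : r ≤ s) (hs : s ∈ W.crossings a)
    (hc : ∀ t, r ≤ t → t ≤ s → W.level a t = W.level a s) (hv : W.vert a s ∉ W.bad a j) :
    ∃ l : List (W.Ed j),
      (W.level a s < W.level a (s + 1) →
        UpPath W.src W.tgt (W.vert j r) l (W.vert j (s + 1))) ∧
      (W.level a (s + 1) < W.level a s →
        UpPath W.src W.tgt (W.vert j (s + 1)) l (W.vert j r)) ∧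
      (∀ f ∈ l, ∃ t ∈ W.crossings j, W.edge t j = f ∧ W.edge t a = W.edge s a) := by
  have hb := notMem_of_notMem_bad hv
  have hvc : ∀ t, r ≤ t → t ≤ s → W.vert a t = W.vert a s := fun t h1 h2 =>
    W.vert_eq_of_const hm (haj.trans hj) h0 h2 fun k h3 h4 => hc k (by omega) h4
  obtain ⟨l, hu, hd, hl, -⟩ := W.exists_upPath_of_no_back hm haj hj h0 hrs hs hc
    fun t h1 h2 h3 => hb.2.1 t h3 (hvc t h1 h2.le)
  exact ⟨l, fun h => (hu h).1, fun h => (hd h).1, hl⟩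

/-- The path has an edge at the height of the given crossing. It lies over the same edge of level
`a`, because `P` holds for at most one edge at each height. Two distinct crossed lifts at one height
would put that edge in `multi`. -/
theorem mem_of_upPath (hm : 0 < m) {a j : ℕ} (haj : a ≤ j) (hj : j ≤ J) {P : W.Ed a → Prop}
    (hP : ∀ e f, P e → P f → W.ht (W.src e) = W.ht (W.src f) → e = f)
    (hPm : ∀ e, P e → e ∈ W.crossed a ∧ e ∉ W.multi a j) {u v : W.Pt j} {l : List (W.Ed j)}
    (h : UpPath W.src W.tgt u l v)
    (hl : ∀ f ∈ l, ∃ t ∈ W.crossings j, W.edge t j = f ∧ P (W.edge t a))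
    {t : ℕ} (ht : t ∈ W.crossings j) (hPt : P (W.edge t a))
    (h1 : W.ht u ≤ (m ^ (j - a) : ℕ) * W.ht (W.src (W.edge t a)))
    (h2 : (m ^ (j - a) : ℕ) * (W.ht (W.src (W.edge t a)) + 1) ≤ W.ht v) : W.edge t j ∈ l := by
  classical
  have hq : (0 : ℤ) < ((m ^ (j - a) : ℕ) : ℤ) := by exact_mod_cast Nat.pow_pos hm
  have h3 := W.ht_src_edge_div haj hj t
  have h4 := (Int.ediv_eq_iff_of_pos hq).1 h3.symm
  obtain ⟨f, hf, hk⟩ := h.exists_mem W.ht_tgt (k := W.ht (W.src (W.edge t j)))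
    (by nlinarith) (by nlinarith)
  obtain ⟨s, hs, rfl, hPs⟩ := hl f hf
  have h5 : W.edge s a = W.edge t a := hP _ _ hPs hPt (by
    rw [W.ht_src_edge_div haj hj, W.ht_src_edge_div haj hj, hk])
  by_contra hcon
  refine (hPm _ hPt).2 (Finset.mem_filter.2 ⟨(hPm _ hPt).1, t, ht, s, hs, rfl, h5, hk.symm, ?_⟩)
  intro h6
  exact hcon (h6 ▸ hf)

theorem ht_vert_of_level_eq (hm : 0 < m) {a j : ℕ} (haj : a ≤ j) (hj : j ≤ J)
    (h0 : ((m ^ (J - a) : ℕ) : ℤ) ∣ W.height 0) {r : ℕ}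
    (h : W.level j r = (m ^ (j - a) : ℕ) * W.level a r) :
    W.ht (W.vert j r) = (m ^ (j - a) : ℕ) * W.level a r := by
  rw [W.ht_vert hm hj (dvd_height_of_le haj h0), h]

theorem level_lastVisit (hm : 0 < m) {a j : ℕ} (haj : a ≤ j) (hj : j ≤ J)
    (h0 : ((m ^ (J - a) : ℕ) : ℤ) ∣ W.height 0) (s : ℕ) :
    (∀ t, W.lastVisit a s ≤ t → t ≤ s → W.level a t = W.level a s) ∧
    W.level j (W.lastVisit a s) = (m ^ (j - a) : ℕ) * W.level a (W.lastVisit a s) := by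
  refine ⟨fun t h1 h2 => ?_, W.level_eq_of_dvd hm haj hj (W.dvd_height_lastVisit h0 s)⟩
  have hM : ((m ^ (J - a) : ℕ) : ℤ) ≠ 0 := by exact_mod_cast (Nat.pow_pos hm).ne'
  have e1 := W.mul_level h0 t
  have e2 := W.mul_level h0 s
  rw [W.lastVisit_of_le h1 h2, ← e2] at e1
  exact mul_left_cancel₀ hM e1

/-- All crossed lifts of an edge with good ends are in a single upward path. -/
theorem exists_upPath_over_edge (hm : 0 < m) {a j : ℕ} (haj : a ≤ j) (hj : j ≤ J)
    (h0 : ((m ^ (J - a) : ℕ) : ℤ) ∣ W.height 0) {e : W.Ed a} (he : e ∈ W.crossed a)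
    (hsrc : W.src e ∉ W.bad a j) (htgt : W.tgt e ∉ W.bad a j) :
    ∃ u l v, UpPath W.src W.tgt u l v ∧
      ∀ t ∈ W.crossings j, W.edge t a = e → W.edge t j ∈ l := by
  have ha := haj.trans hj
  have hb := notMem_of_notMem_bad hsrc
  obtain ⟨s, hs, rfl⟩ := W.mem_crossed.1 he
  have hs' := W.mem_crossings.1 hs
  have hP : ∀ e f, e = W.edge s a → f = W.edge s a → W.ht (W.src e) = W.ht (W.src f) → e = f :=
    fun e f h1 h2 _ => h1.trans h2.symm
  have hPm : ∀ e, e = W.edge s a → e ∈ W.crossed a ∧ e ∉ W.multi a j := by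
    rintro e rfl
    exact ⟨he, fun h => hb.2.2.2 _ h rfl⟩
  -- Starting from the last visit to a vertex of level `a` makes the path cover the full range of
  -- heights over the edge.
  obtain ⟨hc, hlv⟩ := W.level_lastVisit hm haj hj h0 s
  have hle := W.lastVisit_le a s
  have hlv' := W.ht_vert_of_level_eq hm haj hj h0 hlv
  rw [hc _ le_rfl hle] at hlv'
  have hls := W.ht_vert_of_level_eq hm haj hj h0 (W.level_eq_of_level_ne hm haj hj h0 hs'.2)
  have hvs : W.vert a s ∉ W.bad a j := by
    rcases W.vert_cases hm ha h0 s with h | h <;> rw [h.2] <;> assumption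
  obtain ⟨l, hu, hd, hl⟩ := W.exists_upPath_of_crossing hm haj hj h0 hle hs hc hvs
  rcases lt_or_gt_of_ne hs'.2 with h | h
  · obtain ⟨-, -, h1, h2⟩ := W.vert_of_down hm ha h0 h
    refine ⟨_, l, _, hd h, fun t ht hta => W.mem_of_upPath hm haj hj (P := (· = W.edge s a))
      hP hPm (hd h) hl ht hta ?_ ?_⟩
    · rw [hls, hta, h1]
    · rw [hlv', hta, ← h1, h2, sub_add_cancel]
  · obtain ⟨-, -, h1, h2⟩ := W.vert_of_up hm ha h0 h
    refine ⟨_, l, _, hu h, fun t ht hta => W.mem_of_upPath hm haj hj (P := (· = W.edge s a))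
      hP hPm (hu h) hl ht hta ?_ ?_⟩
    · rw [hlv', hta, h1]
    · rw [hls, hta, ← h1, h2]

/-- All crossed lifts of two consecutive edges with good ends are in a single upward path. -/
theorem exists_upPath_over_edges (hm : 0 < m) {a j : ℕ} (haj : a ≤ j) (hj : j ≤ J)
    (h0 : ((m ^ (J - a) : ℕ) : ℤ) ∣ W.height 0) {e f : W.Ed a} (he : e ∈ W.crossed a)
    (hf : f ∈ W.crossed a) (hef : W.tgt e = W.src f)
    (hsrc : W.src e ∉ W.bad a j) (hmid : W.tgt e ∉ W.bad a j) (htgt : W.tgt f ∉ W.bad a j) :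
    ∃ u l v, UpPath W.src W.tgt u l v ∧
      ∀ t ∈ W.crossings j, W.edge t a = e ∨ W.edge t a = f → W.edge t j ∈ l := by
  classical
  have ha := haj.trans hj
  have hb := notMem_of_notMem_bad hsrc
  have hb' := notMem_of_notMem_bad hmid
  have hht : W.ht (W.src f) = W.ht (W.src e) + 1 := by rw [← hef, W.ht_tgt]
  have hP : ∀ e' f', (e' = e ∨ e' = f) → (f' = e ∨ f' = f) →
      W.ht (W.src e') = W.ht (W.src f') → e' = f' := by
    rintro e' f' (rfl | rfl) (rfl | rfl) h
    · rfl
    · omega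
    · omega
    · rfl
  have hPm : ∀ e', (e' = e ∨ e' = f) → e' ∈ W.crossed a ∧ e' ∉ W.multi a j := by
    rintro e' (rfl | rfl)
    · exact ⟨he, fun h => hb.2.2.2 _ h rfl⟩
    · exact ⟨hf, fun h => hb'.2.2.2 _ h hef.symm⟩
  obtain ⟨r, hr, hrv⟩ := Finset.mem_image.1 (W.ends_mem_visited hm ha h0 he).2
  rw [Finset.mem_range] at hr
  -- The walk passes through the middle vertex without turning. As the image does not branch there,
  -- the two edges crossed in this passage are `e` and `f`, in one order or the other.
  obtain ⟨s, hs, t, ht, hst, hc, h1, h2, h3⟩ := W.exists_pass hm ha h0 (r := r) (by omega)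
    (by rw [hrv]; exact hb'.1)
  rw [hrv] at h1 h2
  have h4 := hc (s + 1) (by omega) hst
  have hs' := W.mem_crossings.1 hs
  have ht' := W.mem_crossings.1 ht
  obtain ⟨hcs, hlv⟩ := W.level_lastVisit hm haj hj h0 s
  have hle := W.lastVisit_le a s
  have hlv' := W.ht_vert_of_level_eq hm haj hj h0 hlv
  rw [hcs _ le_rfl hle] at hlv'
  have hlt := W.ht_vert_of_level_eq hm haj hj h0 (W.level_eq_of_level_ne hm haj hj h0 ht'.2)
  rcases lt_or_gt_of_ne hs'.2 with h | h
  · have e1 := W.vert_of_down hm ha h0 h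
    have e2 := W.vert_of_down hm ha h0 (r := t) (by omega)
    have es : W.edge s a = f := W.edge_eq_of_src_eq (j := j) hm ha h0
      (W.mem_crossed.2 ⟨s, hs, rfl⟩) hf (by rw [← e1.2.1, h1, hef]) (by rwa [← e1.2.1, h1])
    have et : W.edge t a = e := W.edge_eq_of_tgt_eq (j := j) hm ha h0
      (W.mem_crossed.2 ⟨t, ht, rfl⟩) he (by rw [← e2.1, h2]) (by rwa [← e2.1, h2])
    obtain ⟨l, -, hd, hl⟩ := W.exists_upPath_of_crossing hm haj hj h0 hle hs hcs
      (by rw [e1.1, es]; exact htgt)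
    obtain ⟨l', -, hd', hl'⟩ := W.exists_upPath_of_crossing hm haj hj h0 hst ht hc
      (by rw [h2]; exact hmid)
    have hp := (hd' (by omega)).append (hd h)
    refine ⟨_, _, _, hp, fun k hk hka => W.mem_of_upPath hm haj hj hP hPm hp ?_ hk hka ?_ ?_⟩
    · intro g hg
      rcases List.mem_append.1 hg with hg | hg
      · obtain ⟨n, hn, hn1, hn2⟩ := hl' g hg
        exact ⟨n, hn, hn1, Or.inl (hn2.trans et)⟩
      · obtain ⟨n, hn, hn1, hn2⟩ := hl g hg
        exact ⟨n, hn, hn1, Or.inr (hn2.trans es)⟩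
    · rw [hlt]
      refine mul_le_mul_of_nonneg_left ?_ (by positivity)
      rw [e2.2.2.1, et]
      rcases hka with hka | hka <;> rw [hka] <;> omega
    · rw [hlv']
      refine mul_le_mul_of_nonneg_left ?_ (by positivity)
      rw [show W.level a s = W.ht (W.src f) + 1 by rw [← es]; omega]
      rcases hka with hka | hka <;> rw [hka] <;> omega
  · have e1 := W.vert_of_up hm ha h0 h
    have e2 := W.vert_of_up hm ha h0 (r := t) (by omega)
    have es : W.edge s a = e := W.edge_eq_of_tgt_eq (j := j) hm ha h0
      (W.mem_crossed.2 ⟨s, hs, rfl⟩) he (by rw [← e1.2.1, h1]) (by rwa [← e1.2.1, h1])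
    have et : W.edge t a = f := W.edge_eq_of_src_eq (j := j) hm ha h0
      (W.mem_crossed.2 ⟨t, ht, rfl⟩) hf (by rw [← e2.1, h2, hef]) (by rwa [← e2.1, h2])
    obtain ⟨l, hu, -, hl⟩ := W.exists_upPath_of_crossing hm haj hj h0 hle hs hcs
      (by rw [e1.1, es]; exact hsrc)
    obtain ⟨l', hu', -, hl'⟩ := W.exists_upPath_of_crossing hm haj hj h0 hst ht hc
      (by rw [h2]; exact hmid)
    have hp := (hu h).append (hu' (by omega))
    refine ⟨_, _, _, hp, fun k hk hka => W.mem_of_upPath hm haj hj hP hPm hp ?_ hk hka ?_ ?_⟩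
    · intro g hg
      rcases List.mem_append.1 hg with hg | hg
      · obtain ⟨n, hn, hn1, hn2⟩ := hl g hg
        exact ⟨n, hn, hn1, Or.inl (hn2.trans es)⟩
      · obtain ⟨n, hn, hn1, hn2⟩ := hl' g hg
        exact ⟨n, hn, hn1, Or.inr (hn2.trans et)⟩
    · rw [hlv']
      refine mul_le_mul_of_nonneg_left ?_ (by positivity)
      rw [e1.2.2.1, es]
      rcases hka with hka | hka <;> rw [hka] <;> omega
    · rw [hlt]
      refine mul_le_mul_of_nonneg_left ?_ (by positivity)
      rw [show W.level a (t + 1) = W.ht (W.src f) + 1 by rw [← et]; omega]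
      rcases hka with hka | hka <;> rw [hka] <;> omega

end TowerWalk

/-! ### Sums with geometric weights -/

theorem sum_le_of_contracting_recursion {κ : ℝ} (h1 : κ < 1) (r e : ℕ → ℝ) (L : ℕ)
    (hκ : 0 ≤ κ) (hr : ∀ n ≤ L, 0 ≤ r n)
    (h : ∀ n < L, r (n + 1) ≤ κ * r n + (e (n + 1) - e n)) :
    ∑ n ∈ Finset.range (L + 1), r n ≤ (r 0 + (e L - e 0)) / (1 - κ) := by
  rw [le_div_iff₀ (by linarith)]
  have h2 : ∑ n ∈ Finset.range L, r (n + 1) ≤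
      κ * ∑ n ∈ Finset.range L, r n + (e L - e 0) := by
    rw [← Finset.sum_range_sub, Finset.mul_sum, ← Finset.sum_add_distrib]
    exact Finset.sum_le_sum fun n hn => h n (Finset.mem_range.1 hn)
  have h3 := Finset.sum_range_succ' r L
  have h4 := Finset.sum_range_succ r L
  nlinarith [hr L le_rfl]

theorem geom_sum_le {κ : ℝ} (h0 : 0 ≤ κ) (h1 : κ < 1) (n : ℕ) :
    ∑ k ∈ Finset.range n, κ ^ k ≤ 1 / (1 - κ) := by
  have h2 := mul_neg_geom_sum κ n
  rw [le_div_iff₀ (by linarith)]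
  nlinarith [pow_nonneg h0 n]

/-- The inner sum is multiplied by `κ` and gains `p (n + 1)` when `n` grows by one, so the
contracting recursion applies. -/
theorem sum_sum_mul_pow_le {κ : ℝ} (h0 : 0 ≤ κ) (h1 : κ < 1) (p : ℕ → ℝ) (L : ℕ)
    (hp : ∀ n ≤ L, 0 ≤ p n) :
    ∑ n ∈ Finset.range (L + 1), ∑ k ∈ Finset.range (n + 1), κ ^ (n - k) * p k ≤
      (∑ n ∈ Finset.range (L + 1), p n) / (1 - κ) := by
  refine (sum_le_of_contracting_recursion h1
    (fun n => ∑ k ∈ Finset.range (n + 1), κ ^ (n - k) * p k)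
    (fun n => ∑ k ∈ Finset.range (n + 1), p k) L h0 (fun n hn => ?_) (fun n hn => ?_)).trans
      (le_of_eq ?_)
  · refine Finset.sum_nonneg fun k hk => mul_nonneg (pow_nonneg h0 _) (hp k ?_)
    have := Finset.mem_range.1 hk
    omega
  · rw [Finset.sum_range_succ, Finset.sum_range_succ (fun k => p k) (n + 1), Finset.mul_sum]
    simp only [Nat.sub_self, pow_zero, one_mul, add_sub_cancel_left]
    refine add_le_add (le_of_eq (Finset.sum_congr rfl fun k hk => ?_)) le_rfl
    have := Finset.mem_range.1 hk
    rw [show n + 1 - k = n - k + 1 by omega, pow_succ]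
    ring
  · simp

/-- When `n` grows by one, the inner sum is multiplied by `κ` and gains `E (n + 1) - E n` times a
geometric sum. The gain is at most an increment of `E / (1 - κ)`, and these telescope. -/
theorem sum_sum_pow_mul_sub_le {κ : ℝ} (h0 : 0 ≤ κ) (h1 : κ < 1) (E : ℕ → ℝ) (L : ℕ)
    (hE : ∀ k n, k ≤ n → n ≤ L → E k ≤ E n) :
    ∑ n ∈ Finset.range (L + 1), ∑ k ∈ Finset.range (n + 1), κ ^ (n - k) * (E n - E k) ≤
      (E L - E 0) / (1 - κ) / (1 - κ) := by
  refine (sum_le_of_contracting_recursion h1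
    (fun n => ∑ k ∈ Finset.range (n + 1), κ ^ (n - k) * (E n - E k))
    (fun n => E n / (1 - κ)) L h0 (fun n hn => ?_) (fun n hn => ?_)).trans (le_of_eq ?_)
  · refine Finset.sum_nonneg fun k hk => mul_nonneg (pow_nonneg h0 _) (sub_nonneg.2 ?_)
    have := Finset.mem_range.1 hk
    exact hE k n (by omega) hn
  · rw [Finset.sum_range_succ]
    simp only [sub_self, mul_zero, add_zero]
    have h2 : ∑ k ∈ Finset.range (n + 1), κ ^ (n + 1 - k) * (E (n + 1) - E k) =
        κ * (∑ k ∈ Finset.range (n + 1), κ ^ (n - k) * (E n - E k)) +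
        (E (n + 1) - E n) * (κ * ∑ k ∈ Finset.range (n + 1), κ ^ (n - k)) := by
      rw [Finset.mul_sum, Finset.mul_sum, Finset.mul_sum, ← Finset.sum_add_distrib]
      refine Finset.sum_congr rfl fun k hk => ?_
      have := Finset.mem_range.1 hk
      rw [show n + 1 - k = n - k + 1 by omega, pow_succ]
      ring
    have h3 : ∑ k ∈ Finset.range (n + 1), κ ^ (n - k) = ∑ k ∈ Finset.range (n + 1), κ ^ k := by
      have := Finset.sum_range_reflect (fun k => κ ^ k) (n + 1)
      rw [← this]
      refine Finset.sum_congr rfl fun k hk => ?_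
      congr 1
    rw [h2, h3, ← sub_div, div_eq_mul_one_div]
    have h4 := geom_sum_le h0 h1 (n + 1)
    have h5 := hE n (n + 1) (Nat.le_succ n) hn
    have h6 : (0 : ℝ) ≤ ∑ k ∈ Finset.range (n + 1), κ ^ k :=
      Finset.sum_nonneg fun k _ => pow_nonneg h0 k
    refine add_le_add le_rfl (mul_le_mul_of_nonneg_left ?_ (by linarith))
    nlinarith
  · simp [← sub_div]

/-! ### The weighted number of bad vertices over all pairs of levels -/

namespace TowerWalk

open LazyWalk

variable {m J : ℕ} (W : TowerWalk.{u} m J)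

theorem card_visited_le (hm : 0 < m) {i : ℕ} (hi : i ≤ J)
    (h0 : ((m ^ (J - i) : ℕ) : ℤ) ∣ W.height 0) :
    (W.visited i).card ≤ (W.crossings i).card + 1 := by
  classical
  have : W.visited i ⊆ insert (W.vert i 0) ((W.crossings i).image fun s => W.vert i (s + 1)) := by
    intro v hv
    obtain ⟨r, hr, rfl⟩ := Finset.mem_image.1 hv
    rw [Finset.mem_range] at hr
    clear hv
    induction r with
    | zero => simp
    | succ r ih =>
      by_cases h : W.level i (r + 1) = W.level i r
      · rw [W.vert_succ_eq hm hi h0 h]; exact ih (by omega)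
      · exact Finset.mem_insert_of_mem (Finset.mem_image_of_mem (fun s => W.vert i (s + 1))
          (W.mem_crossings.2 ⟨by omega, h⟩))
  refine (Finset.card_le_card this).trans ((Finset.card_insert_le _ _).trans ?_)
  exact Nat.add_le_add_right Finset.card_image_le 1

/-- The part of the bound of the number of bad vertices that refers to a single level. -/
noncomputable def defect (a : ℕ) : ℝ :=
  2 * ((W.crossed a).card - (W.visited a).card) + 3 * (turns (W.level a) W.len).card + 6

theorem card_bad_le_defect (hm : 0 < m) {a : ℕ} (ha : a ≤ J)
    (h0 : ((m ^ (J - a) : ℕ) : ℤ) ∣ W.height 0) (j : ℕ) :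
    ((W.bad a j).card : ℝ) ≤ W.defect a + (W.backTimes a j).card + (W.multi a j).card := by
  have h1 := W.card_bad_le a j
  have h2 := W.card_branching_le hm ha h0
  rify at h1 h2
  rw [defect]
  linarith

theorem defect_nonneg (hm : 0 < m) {a : ℕ} (ha : a ≤ J)
    (h0 : ((m ^ (J - a) : ℕ) : ℤ) ∣ W.height 0) : 0 ≤ W.defect a := by
  have h2 := W.card_branching_le hm ha h0
  rify at h2
  rw [defect]
  have : (0 : ℝ) ≤ (W.branching a).card := by positivity
  have : (0 : ℝ) ≤ (turns (W.level a) W.len).card := by positivity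
  linarith

/-- New vertices compensate for the `m` lifts of each edge up to the surplus of crossed edges, and
new turns are paid for by steps back. Only the surpluses over `m` times the preceding counts remain.
-/
theorem defect_succ_le (hm : 2 ≤ m) {a : ℕ} (ha : a + 1 ≤ J)
    (h0 : ((m ^ (J - a) : ℕ) : ℤ) ∣ W.height 0) :
    W.defect (a + 1) ≤ W.defect a + 2 * ((W.crossed (a + 1)).card - m * (W.crossed a).card) +
      3 * ((W.crossings (a + 1)).card - m * (W.crossings a).card) + 3 := by
  have h1 := W.card_turns_succ_le hm ha h0
  have h2 := W.card_crossings (by omega) (Nat.le_succ a) ha h0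
  have h3 := W.card_visited_succ (by omega) ha h0
  simp only [Nat.succ_eq_add_one, Nat.add_sub_cancel_left, pow_one] at h2
  have h4 : (((m - 1 : ℕ) : ℕ) : ℝ) = m - 1 := by
    rw [Nat.cast_sub (by omega)]; simp
  rify at h1 h2 h3
  rw [h4] at h3
  simp only [defect]
  linarith

variable {W} in
/-- The bound of the weighted number of bad vertices. -/
theorem sum_card_bad_le (hm : 2 ≤ m) {θ : ℝ} (hθ0 : 0 < θ) (hθ : m * θ < 1) {i₀ L : ℕ}
    (hJ : i₀ + L = J) (h0 : ((m ^ (J - i₀) : ℕ) : ℤ) ∣ W.height 0) :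
    ∑ n ∈ Finset.range (L + 1), ∑ k ∈ Finset.range (n + 1),
      ((m : ℝ) ^ (i₀ + k))⁻¹ * θ ^ (n - k) * (W.bad (i₀ + k) (i₀ + n)).card ≤
    (42 / (1 - m * θ) ^ 2) *
      (((m : ℝ) ^ J)⁻¹ * (W.crossings J).card + ((m : ℝ) ^ i₀)⁻¹) := by
  have hm0 : 0 < m := by omega
  have hmR : (2 : ℝ) ≤ m := by exact_mod_cast hm
  have hmp : (0 : ℝ) < m := by linarith
  have hpow : ∀ n, (0 : ℝ) < (m : ℝ) ^ n := fun n => pow_pos hmp n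
  have h0' : ∀ k, ((m ^ (J - (i₀ + k)) : ℕ) : ℤ) ∣ W.height 0 := fun k =>
    dvd_height_of_le (Nat.le_add_right _ _) h0
  set D : ℝ := ((m : ℝ) ^ J)⁻¹ * (W.crossings J).card with hD
  set H : ℝ := ((m : ℝ) ^ i₀)⁻¹ with hH
  have hD0 : 0 ≤ D := by positivity
  have hH0 : 0 ≤ H := by positivity
  set N : ℕ → ℝ := fun k => ((m : ℝ) ^ (i₀ + k))⁻¹ * (W.crossings (i₀ + k)).card with hN
  set G : ℕ → ℝ := fun k => ((m : ℝ) ^ (i₀ + k))⁻¹ * (W.crossed (i₀ + k)).card with hG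
  set p : ℕ → ℝ := fun k => ((m : ℝ) ^ (i₀ + k))⁻¹ * W.defect (i₀ + k) with hp
  have hsc : ∀ k n, k ≤ n → ((m : ℝ) ^ (i₀ + k))⁻¹ = m ^ (n - k) * ((m : ℝ) ^ (i₀ + n))⁻¹ := by
    intro k n hkn
    rw [show i₀ + n = (n - k) + (i₀ + k) by omega, pow_add _ (n - k), mul_inv,
      mul_inv_cancel_left₀ (hpow _).ne']
  -- The steps back are weighted at the coarse scale but paid for at the fine one. This costs the
  -- factor `m ^ (n - k)`, and is the reason why `m * θ < 1` is needed.
  have hback : ∀ k n, k ≤ n → n ≤ L → ((m : ℝ) ^ (i₀ + k))⁻¹ *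
      (W.backTimes (i₀ + k) (i₀ + n)).card ≤ m ^ (n - k) * (N n - N k) := by
    intro k n hkn hn
    have h1 := W.card_crossings hm0 (show i₀ + k ≤ i₀ + n by omega) (by omega) (h0' k)
    rw [show i₀ + n - (i₀ + k) = n - k by omega] at h1
    rify at h1
    simp only [hN]
    have e : (m : ℝ) ^ (n - k) * (((m : ℝ) ^ (i₀ + n))⁻¹ * (W.crossings (i₀ + n)).card -
        ((m : ℝ) ^ (i₀ + k))⁻¹ * (W.crossings (i₀ + k)).card) = ((m : ℝ) ^ (i₀ + k))⁻¹ *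
        ((W.crossings (i₀ + n)).card - m ^ (n - k) * (W.crossings (i₀ + k)).card) := by
      rw [mul_sub, ← mul_assoc, ← hsc k n hkn]; ring
    rw [e]
    refine mul_le_mul_of_nonneg_left ?_ (by positivity)
    have : (0 : ℝ) ≤ (W.backTimes (i₀ + k) (i₀ + n)).card := by positivity
    linarith
  have hmulti : ∀ k n, k ≤ n → n ≤ L → ((m : ℝ) ^ (i₀ + k))⁻¹ *
      (W.multi (i₀ + k) (i₀ + n)).card ≤ m ^ (n - k) * (G n - G k) := by
    intro k n hkn hn
    have h1 := W.card_crossed hm0 (show i₀ + k ≤ i₀ + n by omega) (by omega) (h0' k)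
    rw [show i₀ + n - (i₀ + k) = n - k by omega] at h1
    rify at h1
    simp only [hG]
    have e : (m : ℝ) ^ (n - k) * (((m : ℝ) ^ (i₀ + n))⁻¹ * (W.crossed (i₀ + n)).card -
        ((m : ℝ) ^ (i₀ + k))⁻¹ * (W.crossed (i₀ + k)).card) = ((m : ℝ) ^ (i₀ + k))⁻¹ *
        ((W.crossed (i₀ + n)).card - m ^ (n - k) * (W.crossed (i₀ + k)).card) := by
      rw [mul_sub, ← mul_assoc, ← hsc k n hkn]; ring
    rw [e]
    refine mul_le_mul_of_nonneg_left ?_ (by positivity)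
    linarith
  have hNmono : ∀ k n, k ≤ n → n ≤ L → N k ≤ N n := fun k n hkn hn => by
    have := (mul_nonneg (inv_nonneg.2 (hpow (i₀ + k)).le) (Nat.cast_nonneg _)).trans
      (hback k n hkn hn)
    exact sub_nonneg.1 (nonneg_of_mul_nonneg_right this (hpow (n - k)))
  have hGmono : ∀ k n, k ≤ n → n ≤ L → G k ≤ G n := fun k n hkn hn => by
    have := (mul_nonneg (inv_nonneg.2 (hpow (i₀ + k)).le) (Nat.cast_nonneg _)).trans
      (hmulti k n hkn hn)
    exact sub_nonneg.1 (nonneg_of_mul_nonneg_right this (hpow (n - k)))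
  have hNL : N L = D := by simp only [hN, hD, hJ]
  have hGN : ∀ k, G k ≤ N k := fun k => mul_le_mul_of_nonneg_left
    (by exact_mod_cast W.card_crossed_le (i₀ + k)) (by positivity)
  have hp0 : ∀ k ≤ L, 0 ≤ p k := fun k hk =>
    mul_nonneg (by positivity) (W.defect_nonneg hm0 (by omega) (h0' k))
  have hN0 : ∀ k, 0 ≤ N k := fun k => by positivity
  have hG0 : ∀ k, 0 ≤ G k := fun k => by positivity
  -- the sum of the defects
  have hpsum : ∑ n ∈ Finset.range (L + 1), p n ≤ 20 * (D + H) := by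
    -- The unscaled defect grows only by increments, so the scaled one loses a factor `m` per level.
    -- The increments add up to those of `2 * G + 3 * N` and a geometric series.
    have hrec := sum_le_of_contracting_recursion (κ := 1 / m)
      (by rw [div_lt_one hmp]; linarith) p
      (fun n => 2 * G n + 3 * N n + 3 * ∑ k ∈ Finset.range (n + 1), ((m : ℝ) ^ (i₀ + k))⁻¹) L
      (by positivity) hp0 (fun n hn => by
        have h1 := W.defect_succ_le hm (a := i₀ + n) (by omega) (h0' n)
        simp only [hp, hG, hN]
        rw [Finset.sum_range_succ _ (n + 1)]
        have e : ((m : ℝ) ^ (i₀ + n))⁻¹ = m * ((m : ℝ) ^ (i₀ + (n + 1)))⁻¹ := by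
          rw [hsc n (n + 1) (Nat.le_succ n)]; simp
        have e2 : i₀ + (n + 1) = i₀ + n + 1 := rfl
        rw [e2] at e ⊢
        rw [e]
        have h2 := mul_le_mul_of_nonneg_left h1 (inv_nonneg.2 (hpow (i₀ + n + 1)).le)
        refine h2.trans (le_of_eq ?_)
        field_simp
        ring)
    have h1 : (∑ k ∈ Finset.range (L + 1), ((m : ℝ) ^ (i₀ + k))⁻¹) - H ≤ H := by
      have h2 : ∑ k ∈ Finset.range (L + 1), ((m : ℝ) ^ (i₀ + k))⁻¹ =
          H * ∑ k ∈ Finset.range (L + 1), (1 / (m : ℝ)) ^ k := by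
        rw [Finset.mul_sum]
        refine Finset.sum_congr rfl fun k _ => ?_
        rw [hH, pow_add, one_div, inv_pow, mul_inv]
      have h3 := geom_sum_le (κ := 1 / (m : ℝ)) (by positivity)
        (by rw [div_lt_one hmp]; linarith) (L + 1)
      have h4 : 1 / (1 - 1 / (m : ℝ)) ≤ 2 := by
        have : 1 / (m : ℝ) ≤ 1 / 2 := one_div_le_one_div_of_le (by norm_num) hmR
        rw [div_le_iff₀ (by linarith)]
        linarith
      rw [h2]
      nlinarith
    have h5 : p 0 ≤ 5 * D + 6 * H := by
      have h6 : W.defect i₀ ≤ 5 * (W.crossings i₀).card + 6 := by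
        have h7 := W.card_crossed_le i₀
        have h8 := W.card_turns_le_crossings i₀
        rify at h7 h8
        have : (0 : ℝ) ≤ (W.visited i₀).card := by positivity
        rw [defect]; linarith
      have h9 := hNmono 0 L (by omega) le_rfl
      rw [hNL] at h9
      simp only [hN, add_zero] at h9
      simp only [hp, add_zero]
      have := mul_le_mul_of_nonneg_left h6 (inv_nonneg.2 (hpow i₀).le)
      rw [hH]
      nlinarith
    refine hrec.trans ?_
    have h7 : 1 / (m : ℝ) ≤ 1 / 2 := one_div_le_one_div_of_le (by norm_num) hmR
    rw [div_le_iff₀ (by linarith)]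
    simp only [zero_add, Finset.sum_range_one, add_zero, ← hH]
    have h8 : 2 * G L + 3 * N L ≤ 5 * D := by rw [← hNL]; linarith [hGN L]
    have h9 := hG0 0
    have h10 := hN0 0
    have h11 : 10 * (D + H) ≤ 20 * (D + H) * (1 - 1 / (m : ℝ)) := by nlinarith
    linarith
  -- comparison
  have hκ0 : 0 ≤ m * θ := by positivity
  have hθ1 : θ < 1 := by nlinarith
  -- The defect depends on the coarse level alone and keeps the weight `θ ^ (n - k)`. The increments
  -- get the weight `(m * θ) ^ (n - k)`.
  have hterm : ∀ n ∈ Finset.range (L + 1), ∀ k ∈ Finset.range (n + 1),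
      ((m : ℝ) ^ (i₀ + k))⁻¹ * θ ^ (n - k) * (W.bad (i₀ + k) (i₀ + n)).card ≤
      θ ^ (n - k) * p k + (m * θ) ^ (n - k) * ((N n + G n) - (N k + G k)) := by
    intro n hn k hk
    rw [Finset.mem_range] at hn hk
    have h1 := W.card_bad_le_defect hm0 (a := i₀ + k) (by omega) (h0' k) (i₀ + n)
    have h2 := hback k n (by omega) (by omega)
    have h3 := hmulti k n (by omega) (by omega)
    have h4 := mul_le_mul_of_nonneg_left h1 (inv_nonneg.2 (hpow (i₀ + k)).le)
    have h5 : ((m : ℝ) ^ (i₀ + k))⁻¹ * (W.bad (i₀ + k) (i₀ + n)).card ≤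
        p k + m ^ (n - k) * ((N n + G n) - (N k + G k)) := by
      simp only [hp]; nlinarith
    have h6 := mul_le_mul_of_nonneg_left h5 (pow_nonneg hθ0.le (n - k))
    rw [mul_pow]
    nlinarith
  refine (Finset.sum_le_sum fun n hn => Finset.sum_le_sum (hterm n hn)).trans ?_
  simp only [Finset.sum_add_distrib]
  have hA := sum_sum_mul_pow_le hθ0.le hθ1 p L hp0
  have hB := sum_sum_pow_mul_sub_le hκ0 hθ (fun k => N k + G k) L
    fun k n h1 h2 => add_le_add (hNmono k n h1 h2) (hGmono k n h1 h2)
  have hθκ : θ ≤ m * θ := by nlinarith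
  have hA' : (∑ n ∈ Finset.range (L + 1), p n) / (1 - θ) ≤ 20 * (D + H) / (1 - m * θ) ^ 2 := by
    have : (1 - m * θ) ^ 2 ≤ 1 - θ := by nlinarith
    exact div_le_div₀ (by positivity) hpsum (by nlinarith) this
  have hB' : (N L + G L - (N 0 + G 0)) / (1 - m * θ) / (1 - m * θ) ≤
      2 * (D + H) / (1 - m * θ) ^ 2 := by
    rw [div_div, ← sq]
    refine div_le_div_of_nonneg_right ?_ (by positivity)
    linarith [hGN L, hN0 0, hG0 0]
  -- The defects account for `20` and the increments for `2`; the remaining `20` is slack.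
  have e : 42 / (1 - m * θ) ^ 2 * (D + H) = 20 * (D + H) / (1 - m * θ) ^ 2 +
    2 * (D + H) / (1 - m * θ) ^ 2 + 20 * (D + H) / (1 - m * θ) ^ 2 := by ring
  have e2 : 0 ≤ 20 * (D + H) / (1 - m * θ) ^ 2 := by positivity
  linarith

-- This bounds the contribution of the balls near which no bad vertex appears before the depth `J`.
-- At each level the scaled number of visited vertices is at most the scaled number of steps plus
-- one initial edge length.
variable {W} in
theorem sum_card_visited_le (hm : 2 ≤ m) {θ : ℝ} (hθ0 : 0 < θ) (hθ : m * θ < 1) {i₀ L : ℕ}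
    (hJ : i₀ + L = J) (h0 : ((m ^ (J - i₀) : ℕ) : ℤ) ∣ W.height 0) :
    ∑ k ∈ Finset.range (L + 1),
      ((m : ℝ) ^ (i₀ + k))⁻¹ * θ ^ (L - k) * (W.visited (i₀ + k)).card ≤
    (1 / (1 - m * θ)) *
      (((m : ℝ) ^ J)⁻¹ * (W.crossings J).card + ((m : ℝ) ^ i₀)⁻¹) := by
  have hm0 : 0 < m := by omega
  have hmR : (2 : ℝ) ≤ m := by exact_mod_cast hm
  have hmp : (0 : ℝ) < m := by linarith
  have hpow : ∀ n, (0 : ℝ) < (m : ℝ) ^ n := fun n => pow_pos hmp n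
  have hθ1 : θ ≤ m * θ := by nlinarith
  set S : ℝ := ((m : ℝ) ^ J)⁻¹ * (W.crossings J).card + ((m : ℝ) ^ i₀)⁻¹ with hS
  have hS0 : 0 ≤ S := by positivity
  have h1 : ∀ k ∈ Finset.range (L + 1),
      ((m : ℝ) ^ (i₀ + k))⁻¹ * θ ^ (L - k) * (W.visited (i₀ + k)).card ≤ θ ^ (L - k) * S := by
    intro k hk
    rw [Finset.mem_range] at hk
    have h2 := W.card_visited_le hm0 (i := i₀ + k) (by omega)
      (dvd_height_of_le (Nat.le_add_right _ _) h0)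
    have h3 := W.card_crossings hm0 (a := i₀ + k) (j := J) (by omega) le_rfl
      (dvd_height_of_le (Nat.le_add_right _ _) h0)
    rify at h2 h3
    have h4 : ((m : ℝ) ^ (i₀ + k))⁻¹ = m ^ (J - (i₀ + k)) * ((m : ℝ) ^ J)⁻¹ := by
      have : (m : ℝ) ^ J = m ^ (J - (i₀ + k)) * m ^ (i₀ + k) := by
        rw [← pow_add]; congr 1; omega
      rw [this]; field_simp
    have h5 : ((m : ℝ) ^ (i₀ + k))⁻¹ ≤ ((m : ℝ) ^ i₀)⁻¹ :=
      inv_anti₀ (hpow _) (pow_le_pow_right₀ (by linarith) (by omega))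
    have h6 : ((m : ℝ) ^ (i₀ + k))⁻¹ * (W.visited (i₀ + k)).card ≤ S := by
      calc _ ≤ ((m : ℝ) ^ (i₀ + k))⁻¹ * ((W.crossings (i₀ + k)).card + 1) := by gcongr
        _ = ((m : ℝ) ^ J)⁻¹ * (m ^ (J - (i₀ + k)) * (W.crossings (i₀ + k)).card) +
            ((m : ℝ) ^ (i₀ + k))⁻¹ := by rw [h4]; ring
        _ ≤ S := by
          rw [hS]
          have : (0 : ℝ) ≤ (W.backTimes (i₀ + k) J).card := by positivity
          gcongr
          linarith
    calc _ = θ ^ (L - k) * (((m : ℝ) ^ (i₀ + k))⁻¹ * (W.visited (i₀ + k)).card) := by ring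
      _ ≤ _ := by gcongr
  refine (Finset.sum_le_sum h1).trans ?_
  rw [← Finset.sum_mul]
  refine mul_le_mul_of_nonneg_right ?_ hS0
  have h3 : ∑ k ∈ Finset.range (L + 1), θ ^ (L - k) = ∑ k ∈ Finset.range (L + 1), θ ^ k := by
    rw [← Finset.sum_range_reflect (fun k => θ ^ k) (L + 1)]
    refine Finset.sum_congr rfl fun k hk => ?_
    congr 1
  rw [h3]
  refine (geom_sum_le hθ0.le (by linarith) _).trans ?_
  exact one_div_le_one_div_of_le (by linarith) (by linarith)

end TowerWalk

/-! ### Metric graphs: Lipschitz test functions, local structure, counting edges -/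

namespace GraphData

theorem PathLength.append {X : Type u} {G : GraphData X} {x y z : X} {L L' : ℝ} (h : G.PathLength x y L)
    (h' : G.PathLength y z L') : G.PathLength x z (L + L') := by
  induction h with
  | nil x => simpa using h'
  | cons e s t hs ht y L _ ih =>
    rw [add_assoc]
    exact PathLength.cons e s t hs ht z _ (ih h')

variable {X : Type u} [MetricSpace X] {G : GraphData X}

namespace IsMetricGraph

/-- In a path metric a Lipschitz bound need only be checked along edges. All lower bounds of
distances below come from test functions of this kind. -/
theorem abs_sub_le_dist (hG : G.IsMetricGraph) {ψ : X → ℝ}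
    (h : ∀ e, ∀ s ∈ Icc 0 G.edgeLength, ∀ t ∈ Icc 0 G.edgeLength,
      |ψ (G.edge e s) - ψ (G.edge e t)| ≤ |s - t|) (x y : X) : |ψ x - ψ y| ≤ dist x y := by
  refine (hG.isGLB_dist x y).2 ?_
  intro L hL
  induction hL with
  | nil x => simp
  | cons e s t hs ht y L _ ih =>
    exact (abs_sub_le _ (ψ (G.edge e t)) _).trans (add_le_add (h e s hs t ht) ih)

theorem dist_le_of_pathLength (hG : G.IsMetricGraph) {x y : X} {L : ℝ}
    (h : G.PathLength x y L) : dist x y ≤ L := (hG.isGLB_dist x y).1 h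

theorem edge_injOn (hG : G.IsMetricGraph) (e : G.Edge) :
    InjOn (G.edge e) (Icc 0 G.edgeLength) := by
  intro s hs t ht h
  have := hG.dist_edge e s hs t ht
  rw [h, dist_self] at this
  exact sub_eq_zero.1 (abs_eq_zero.1 this.symm)

theorem zero_mem (hG : G.IsMetricGraph) : (0 : ℝ) ∈ Icc 0 G.edgeLength :=
  ⟨le_rfl, hG.edgeLength_pos.le⟩

theorem edgeLength_mem (hG : G.IsMetricGraph) : G.edgeLength ∈ Icc 0 G.edgeLength :=
  ⟨hG.edgeLength_pos.le, le_rfl⟩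

theorem edge_zero_mem (hG : G.IsMetricGraph) (e : G.Edge) : G.edge e 0 ∈ G.edgeSet e :=
  ⟨0, hG.zero_mem, rfl⟩

theorem edge_edgeLength_mem (hG : G.IsMetricGraph) (e : G.Edge) :
    G.edge e G.edgeLength ∈ G.edgeSet e := ⟨_, hG.edgeLength_mem, rfl⟩

theorem eq_of_mem_of_notMem_vertices (hG : G.IsMetricGraph) {e e' : G.Edge} {x : X}
    (h : x ∈ G.edgeSet e) (h' : x ∈ G.edgeSet e') (hx : x ∉ G.vertices) : e = e' := by
  by_contra hne
  exact hx (hG.inter_subset e e' hne ⟨h, h'⟩)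

/-- The extension of a function on the vertices that is affine on the edges. -/
theorem exists_affine (hG : G.IsMetricGraph) (n : X → ℝ)
    (hn : ∀ e, |n (G.edge e G.edgeLength) - n (G.edge e 0)| ≤ G.edgeLength) : ∃ ψ : X → ℝ,
    (∀ e, ∀ s ∈ Icc 0 G.edgeLength, ψ (G.edge e s) = n (G.edge e 0) +
      s / G.edgeLength * (n (G.edge e G.edgeLength) - n (G.edge e 0))) ∧
    (∀ x, (∀ e, x ∉ G.edgeSet e) → ψ x = n x) ∧ ∀ x y, |ψ x - ψ y| ≤ dist x y := by
  classical
  have hl := hG.edgeLength_pos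
  set F : G.Edge → ℝ → ℝ := fun e s => n (G.edge e 0) +
      s / G.edgeLength * (n (G.edge e G.edgeLength) - n (G.edge e 0)) with hF
  have hend : ∀ e, ∀ s ∈ Icc 0 G.edgeLength, G.edge e s ∈ G.vertices →
      F e s = n (G.edge e s) := by
    intro e s hs hv
    rcases (hG.edge_mem_vertices e s hs).1 hv with rfl | rfl
    · simp [hF]
    · simp [hF, div_self hl.ne']
  have hcons : ∀ e e', ∀ s ∈ Icc 0 G.edgeLength, ∀ s' ∈ Icc 0 G.edgeLength,
      G.edge e s = G.edge e' s' → F e s = F e' s' := by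
    intro e e' s hs s' hs' h
    by_cases hv : G.edge e s ∈ G.vertices
    · rw [hend e s hs hv, hend e' s' hs' (h ▸ hv), h]
    · obtain rfl := hG.eq_of_mem_of_notMem_vertices (e := e) (e' := e') ⟨s, hs, rfl⟩
        ⟨s', hs', h.symm⟩ hv
      rw [hG.edge_injOn e hs hs' h]
  have hex : ∀ x, ∃ r : ℝ, (∀ e, ∀ s ∈ Icc 0 G.edgeLength, G.edge e s = x → r = F e s) ∧
      ((∀ e, x ∉ G.edgeSet e) → r = n x) := by
    intro x
    by_cases h : ∃ e, x ∈ G.edgeSet e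
    · obtain ⟨e, s, hs, rfl⟩ := h
      exact ⟨F e s, fun e' s' hs' h => hcons e e' s hs s' hs' h.symm,
        fun h => absurd ⟨s, hs, rfl⟩ (h e)⟩
    · exact ⟨n x, fun e s hs hx => absurd ⟨e, s, hs, hx⟩ h, fun _ => rfl⟩
  choose ψ hψ hψ' using hex
  have hval : ∀ e, ∀ s ∈ Icc 0 G.edgeLength, ψ (G.edge e s) = F e s :=
    fun e s hs => hψ _ e s hs rfl
  refine ⟨ψ, hval, hψ', fun x y => hG.abs_sub_le_dist (fun e s hs t ht => ?_) x y⟩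
  rw [hval e s hs, hval e t ht]
  have : F e s - F e t =
      (s - t) * ((n (G.edge e G.edgeLength) - n (G.edge e 0)) / G.edgeLength) := by
    simp only [hF]; ring
  rw [this, abs_mul, abs_div, abs_of_pos hl]
  refine mul_le_of_le_one_right (abs_nonneg _) ?_
  rw [div_le_one hl]
  exact hn e

/-- Edges that are close to each other are adjacent. -/
theorem exists_mem_of_dist_lt (hG : G.IsMetricGraph) {e e' : G.Edge} {x x' : X}
    (hx : x ∈ G.edgeSet e) (hx' : x' ∈ G.edgeSet e') (h : dist x x' < G.edgeLength) :
    ∃ v ∈ G.vertices, v ∈ G.edgeSet e ∧ v ∈ G.edgeSet e' := by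
  classical
  have hl := hG.edgeLength_pos
  by_contra! hcon
  -- The test function vanishes on `e`. Without a common vertex it is constantly the edge length on
  -- `e'`.
  obtain ⟨ψ, hψ, -, hψl⟩ := hG.exists_affine
    (fun v => if v ∈ G.edgeSet e then 0 else G.edgeLength) fun f => by
      split_ifs <;> simp [abs_of_pos hl, hl.le]
  replace hψl := hψl x x'
  obtain ⟨s, hs, rfl⟩ := hx
  obtain ⟨s', hs', rfl⟩ := hx'
  rw [hψ e s hs, hψ e' s' hs', if_pos (hG.edge_zero_mem e), if_pos (hG.edge_edgeLength_mem e),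
    if_neg (fun h => hcon _ ((hG.edge_mem_vertices e' _ hG.zero_mem).2 (Or.inl rfl)) h
      (hG.edge_zero_mem e')),
    if_neg (fun h => hcon _ ((hG.edge_mem_vertices e' _ hG.edgeLength_mem).2 (Or.inr rfl)) h
      (hG.edge_edgeLength_mem e'))] at hψl
  simp [abs_of_pos hl] at hψl
  linarith

/-- For a vertex, the test function is `0` there and one edge length at all other vertices. For an
interior point, it is a tent supported in the edge. Either one keeps all points away that share no
edge with `x`. This makes openness of the projections usable. -/
theorem exists_radius (hG : G.IsMetricGraph) (x : X) : ∃ ρ > 0, ∀ y, dist x y < ρ → y ≠ x →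
    ∃ e, x ∈ G.edgeSet e ∧ y ∈ G.edgeSet e := by
  classical
  have hl := hG.edgeLength_pos
  by_cases hv : x ∈ G.vertices
  · refine ⟨G.edgeLength, hl, fun y hy hne => ?_⟩
    by_contra! hcon
    obtain ⟨ψ, hψ, hψ', hψl⟩ := hG.exists_affine
      (fun v => if v = x then 0 else G.edgeLength) fun f => by
        split_ifs <;> simp [abs_of_pos hl, hl.le]
    replace hψl := hψl x y
    have h1 : ψ x = 0 := by
      by_cases hx : ∃ e, x ∈ G.edgeSet e
      · obtain ⟨e, s, hs, rfl⟩ := hx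
        rw [hψ e s hs]
        rcases (hG.edge_mem_vertices e s hs).1 hv with rfl | rfl <;> simp [hl.ne']
      · rw [hψ' x (by simpa using hx), if_pos rfl]
    have h2 : ψ y = G.edgeLength := by
      by_cases hx : ∃ e, y ∈ G.edgeSet e
      · obtain ⟨e, hye⟩ := hx
        have hxe : x ∉ G.edgeSet e := fun h => hcon e h hye
        obtain ⟨s, hs, rfl⟩ := hye
        rw [hψ e s hs, if_neg (fun h : G.edge e 0 = x => hxe (h ▸ hG.edge_zero_mem e)),
          if_neg (fun h : G.edge e G.edgeLength = x => hxe (h ▸ hG.edge_edgeLength_mem e))]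
        simp
      · rw [hψ' y (by simpa using hx), if_neg hne]
    rw [h1, h2, zero_sub, abs_neg, abs_of_pos hl] at hψl
    linarith
  · rcases hG.cover x with h | ⟨e, s, hs, rfl⟩
    · exact absurd h hv
    · have hs0 : s ≠ 0 := fun h => hv ((hG.edge_mem_vertices e s hs).2 (Or.inl h))
      have hsl : s ≠ G.edgeLength := fun h => hv ((hG.edge_mem_vertices e s hs).2 (Or.inr h))
      have h1 : 0 < s := lt_of_le_of_ne hs.1 hs0.symm
      have h2 : 0 < G.edgeLength - s := sub_pos.2 (lt_of_le_of_ne hs.2 hsl)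
      refine ⟨min s (G.edgeLength - s), lt_min h1 h2, fun y hy hne => ⟨e, ⟨s, hs, rfl⟩, ?_⟩⟩
      by_contra hcon
      set ψ : X → ℝ := fun z => if z ∈ G.edgeSet e then
        max 0 (min s (G.edgeLength - s) - dist (G.edge e s) z) else 0 with hψ
      have hlip := hG.abs_sub_le_dist (ψ := ψ) (fun f t ht t' ht' => ?_) (G.edge e s) y
      · simp only [hψ] at hlip
        rw [if_neg hcon, if_pos ⟨s, hs, rfl⟩, dist_self, sub_zero, sub_zero,
          max_eq_right (lt_min h1 h2).le, abs_of_pos (lt_min h1 h2)] at hlip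
        linarith
      · by_cases hfe : f = e
        · subst hfe
          simp only [hψ]
          rw [if_pos ⟨t, ht, rfl⟩, if_pos ⟨t', ht', rfl⟩, ← hG.dist_edge f t ht t' ht']
          have h3 := abs_max_sub_max_le_abs (min s (G.edgeLength - s) -
            dist (G.edge f s) (G.edge f t)) (min s (G.edgeLength - s) -
            dist (G.edge f s) (G.edge f t')) 0
          rw [max_comm, max_comm 0 (min s (G.edgeLength - s) -
            dist (G.edge f s) (G.edge f t'))]
          refine h3.trans ?_
          rw [sub_sub_sub_cancel_left, dist_comm (G.edge f s), dist_comm (G.edge f s),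
            dist_comm (G.edge f t) (G.edge f t')]
          exact abs_dist_sub_le _ _ _
        · have h0 : ∀ t ∈ Icc 0 G.edgeLength, ψ (G.edge f t) = 0 := by
            intro t ht
            simp only [hψ]
            split_ifs with h
            · have hvt := hG.inter_subset f e hfe ⟨⟨t, ht, rfl⟩, h⟩
              obtain ⟨t', ht', hte⟩ := h
              rw [← hte] at hvt ⊢
              rw [hG.dist_edge e s hs t' ht']
              refine max_eq_left ?_
              rcases (hG.edge_mem_vertices e t' ht').1 hvt with rfl | rfl
              · rw [sub_zero, abs_of_pos h1]; linarith [min_le_left s (G.edgeLength - s)]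
              · rw [abs_sub_comm, abs_of_pos h2]; linarith [min_le_right s (G.edgeLength - s)]
            · rfl
          rw [h0 t ht, h0 t' ht', sub_zero, abs_zero]
          exact abs_nonneg _

end IsMetricGraph

/-- The edges that can be reached from a point in a given number of steps. -/
def near (G : GraphData X) (x : X) : ℕ → Set G.Edge
  | 0 => {e | x ∈ G.edgeSet e}
  | k + 1 => {e | ∃ f ∈ near G x k, (G.edgeSet e ∩ G.edgeSet f).Nonempty}

namespace IsMetricGraph

/-- The summand `1` serves the points that are not vertices, which lie in at most one edge. -/
theorem ncard_edges_le (hG : G.IsMetricGraph) {Δ : ℝ} (hΔ : G.ValenceLE Δ) (x : X) :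
    {e | x ∈ G.edgeSet e}.Finite ∧ {e | x ∈ G.edgeSet e}.ncard ≤ ⌈Δ⌉₊ + 1 := by
  by_cases hv : x ∈ G.vertices
  · refine ⟨(hΔ x hv).1, ?_⟩
    have h := (hΔ x hv).2.trans (Nat.le_ceil Δ)
    have : {e | x ∈ G.edgeSet e}.ncard ≤ ⌈Δ⌉₊ := by exact_mod_cast h
    omega
  · have hs : {e | x ∈ G.edgeSet e}.Subsingleton := fun e he e' he' =>
      hG.eq_of_mem_of_notMem_vertices he he' hv
    have : Finite {e | x ∈ G.edgeSet e} := hs.finite.to_subtype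
    refine ⟨hs.finite, ?_⟩
    have := Set.ncard_le_one_iff_subsingleton.2 hs
    omega

theorem ncard_adjacent_le (hG : G.IsMetricGraph) {Δ : ℝ} (hΔ : G.ValenceLE Δ) (f : G.Edge) :
    {e | (G.edgeSet e ∩ G.edgeSet f).Nonempty}.Finite ∧
      {e | (G.edgeSet e ∩ G.edgeSet f).Nonempty}.ncard ≤ 2 * (⌈Δ⌉₊ + 1) + 1 := by
  have hsub : {e | (G.edgeSet e ∩ G.edgeSet f).Nonempty} ⊆
      ({e | G.edge f 0 ∈ G.edgeSet e} ∪ {e | G.edge f G.edgeLength ∈ G.edgeSet e}) ∪ {f} := by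
    rintro e ⟨y, hy, hy'⟩
    by_cases hef : e = f
    · exact Or.inr hef
    · have hv := hG.inter_subset e f hef ⟨hy, hy'⟩
      obtain ⟨t, ht, rfl⟩ := hy'
      rcases (hG.edge_mem_vertices f t ht).1 hv with rfl | rfl
      · exact Or.inl (Or.inl hy)
      · exact Or.inl (Or.inr hy)
  obtain ⟨h1, h2⟩ := hG.ncard_edges_le hΔ (G.edge f 0)
  obtain ⟨h3, h4⟩ := hG.ncard_edges_le hΔ (G.edge f G.edgeLength)
  have hfin := (h1.union h3).union (finite_singleton f)
  refine ⟨hfin.subset hsub, (ncard_le_ncard hsub hfin).trans ?_⟩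
  refine (ncard_union_le _ _).trans ?_
  have := ncard_union_le {e | G.edge f 0 ∈ G.edgeSet e} {e | G.edge f G.edgeLength ∈ G.edgeSet e}
  rw [ncard_singleton]
  omega

theorem ncard_near_le (hG : G.IsMetricGraph) {Δ : ℝ} (hΔ : G.ValenceLE Δ) (x : X) (k : ℕ) :
    (G.near x k).Finite ∧ (G.near x k).ncard ≤ (⌈Δ⌉₊ + 1) * (2 * (⌈Δ⌉₊ + 1) + 1) ^ k := by
  classical
  induction k with
  | zero => simpa [near] using hG.ncard_edges_le hΔ x
  | succ k ih =>
    obtain ⟨hf, hc⟩ := ih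
    have heq : G.near x (k + 1) =
        ⋃ f ∈ hf.toFinset, {e | (G.edgeSet e ∩ G.edgeSet f).Nonempty} := by
      ext e; simp [near]
    have hfin : (G.near x (k + 1)).Finite := by
      rw [heq]
      exact Set.Finite.biUnion (Finset.finite_toSet _) fun f _ => (hG.ncard_adjacent_le hΔ f).1
    refine ⟨hfin, ?_⟩
    rw [heq]
    refine (Finset.set_ncard_biUnion_le _ _).trans ?_
    refine (Finset.sum_le_card_nsmul _ _ _ fun f _ => (hG.ncard_adjacent_le hΔ f).2).trans ?_
    rw [← Set.ncard_eq_toFinset_card _ hf, smul_eq_mul, pow_succ, ← mul_assoc]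
    exact Nat.mul_le_mul_right _ hc

/-- The test function counts the `k < R + 2` for which a point is not reached in `k` steps. It
changes by at most one along an edge, vanishes at `x`, and is `R + 2` on an edge outside `near x (R
+ 2)`, so such an edge is farther away than `R` edge lengths. -/
theorem mem_near_of_dist_le (hG : G.IsMetricGraph) {x z : X} {e : G.Edge} (hz : z ∈ G.edgeSet e)
    {R : ℕ} (h : dist x z ≤ R * G.edgeLength) : e ∈ G.near x (R + 2) := by
  classical
  have hl := hG.edgeLength_pos
  by_contra hcon
  set V : ℕ → Set X := fun k => {x} ∪ {y | ∃ f ∈ G.near x k, y ∈ G.edgeSet f} with hV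
  set c : X → ℕ := fun y => ((Finset.range (R + 2)).filter fun k => y ∉ V k).card with hc
  have hstep : ∀ f u v, u ∈ G.edgeSet f → v ∈ G.edgeSet f → ∀ k, u ∈ V k → v ∈ V (k + 1) := by
    rintro f u v hu hv k (rfl | ⟨g, hg, hug⟩)
    · have hsub : ∀ k, f ∈ G.near u k := by
        intro k
        induction k with
        | zero => exact hu
        | succ k ih => exact ⟨f, ih, u, hu, hu⟩
      exact Or.inr ⟨f, hsub _, hv⟩
    · exact Or.inr ⟨f, ⟨g, hg, u, hu, hug⟩, hv⟩
  have hcl : ∀ f u v, u ∈ G.edgeSet f → v ∈ G.edgeSet f → c v ≤ c u + 1 := by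
    intro f u v hu hv
    have hsub : ((Finset.range (R + 2)).filter fun k => v ∉ V k) ⊆
        insert 0 (((Finset.range (R + 2)).filter fun k => u ∉ V k).image Nat.succ) := by
      intro k hk
      rw [Finset.mem_filter, Finset.mem_range] at hk
      cases k with
      | zero => exact Finset.mem_insert_self _ _
      | succ k =>
        refine Finset.mem_insert_of_mem (Finset.mem_image_of_mem _ ?_)
        rw [Finset.mem_filter, Finset.mem_range]
        exact ⟨by omega, fun huk => hk.2 (hstep f u v hu hv k huk)⟩
    refine (Finset.card_le_card hsub).trans ((Finset.card_insert_le _ _).trans ?_)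
    exact Nat.add_le_add_right Finset.card_image_le 1
  obtain ⟨ψ, hψ, hψ', hψl⟩ := hG.exists_affine (fun y => (c y : ℝ) * G.edgeLength) fun f => by
    rw [← sub_mul, abs_mul, abs_of_pos hl]
    refine mul_le_of_le_one_left hl.le ?_
    have h1 := hcl f _ _ (hG.edge_zero_mem f) (hG.edge_edgeLength_mem f)
    have h2 := hcl f _ _ (hG.edge_edgeLength_mem f) (hG.edge_zero_mem f)
    rify at h1 h2
    rw [abs_le]
    constructor <;> linarith
  replace hψl := hψl x z
  have hx0 : ψ x = 0 := by
    by_cases hx : ∃ f, x ∈ G.edgeSet f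
    · obtain ⟨f, hxf⟩ := hx
      have hsub : ∀ k, f ∈ G.near x k := by
        intro k
        induction k with
        | zero => exact hxf
        | succ k ih => exact ⟨f, ih, x, hxf, hxf⟩
      have h0 : ∀ y ∈ G.edgeSet f, c y = 0 := by
        intro y hy
        rw [hc, Finset.card_eq_zero, Finset.filter_eq_empty_iff]
        intro k _ h
        exact h (Or.inr ⟨f, hsub k, hy⟩)
      obtain ⟨s, hs, rfl⟩ := hxf
      rw [hψ f s hs, h0 _ (hG.edge_zero_mem f), h0 _ (hG.edge_edgeLength_mem f)]
      simp
    · rw [hψ' x (by simpa using hx)]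
      have : c x = 0 := by
        rw [hc, Finset.card_eq_zero, Finset.filter_eq_empty_iff]
        intro k _ h
        exact h (Or.inl rfl)
      simp [this]
  have hfar : ∀ y ∈ G.edgeSet e, c y = R + 2 ∨ y = x := by
    intro y hy
    by_cases hyx : y = x
    · exact Or.inr hyx
    · left
      rw [hc]
      simp only
      rw [Finset.filter_true_of_mem, Finset.card_range]
      rintro k hk (h | ⟨f, hf, hyf⟩)
      · exact hyx h
      · rw [Finset.mem_range] at hk
        have hmono : ∀ n, e ∈ G.near x (k + 1 + n) := by
          intro n
          induction n with
          | zero => exact ⟨f, hf, y, hy, hyf⟩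
          | succ n ih => exact ⟨e, ih, y, hy, hy⟩
        have := hmono (R + 2 - (k + 1))
        rw [show k + 1 + (R + 2 - (k + 1)) = R + 2 by omega] at this
        exact hcon this
  have hfar' : ∀ y ∈ G.edgeSet e, c y = R + 2 := by
    intro y hy
    rcases hfar y hy with h | rfl
    · exact h
    · exfalso
      have hsub : ∀ k, e ∈ G.near y k := by
        intro k
        induction k with
        | zero => exact hy
        | succ k ih => exact ⟨e, ih, y, hy, hy⟩
      exact hcon (hsub _)
  obtain ⟨s, hs, rfl⟩ := hz
  rw [hx0, hψ e s hs, hfar' _ (hG.edge_zero_mem e), hfar' _ (hG.edge_edgeLength_mem e), sub_self,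
    mul_zero, add_zero, zero_sub, abs_neg, abs_of_nonneg (by positivity)] at hψl
  push_cast at hψl
  nlinarith

/-- The number of edges within a bounded distance of a point is bounded. -/
theorem ncard_edges_dist_le (hG : G.IsMetricGraph) {Δ : ℝ} (hΔ : G.ValenceLE Δ) (x : X) (R : ℕ) :
    {e | ∃ z ∈ G.edgeSet e, dist x z ≤ R * G.edgeLength}.Finite ∧
      {e | ∃ z ∈ G.edgeSet e, dist x z ≤ R * G.edgeLength}.ncard ≤
        (⌈Δ⌉₊ + 1) * (2 * (⌈Δ⌉₊ + 1) + 1) ^ (R + 2) := by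
  obtain ⟨h1, h2⟩ := hG.ncard_near_le hΔ x (R + 2)
  have hsub : {e | ∃ z ∈ G.edgeSet e, dist x z ≤ R * G.edgeLength} ⊆ G.near x (R + 2) := by
    rintro e ⟨z, hz, h⟩
    exact hG.mem_near_of_dist_le hz h
  exact ⟨h1.subset hsub, (ncard_le_ncard hsub h1).trans h2⟩

end IsMetricGraph

end GraphData

/-- The length of the edges of the `i`-th graph. -/
noncomputable def mesh (m i : ℕ) : ℝ := ((m : ℝ) ^ i)⁻¹

/-! ### Heights, orientation of the edges, and lifting of paths -/

namespace AdmissibleSystem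

variable {m : ℕ} {η Δ : ℝ} (S : AdmissibleSystem.{u} m η Δ)

theorem edgeLength_eq_mesh (i : ℕ) : (S.graph i).edgeLength = mesh m i := S.edgeLength_eq i

theorem mesh_pos {m : ℕ} {η Δ : ℝ} (S : AdmissibleSystem.{u} m η Δ) (i : ℕ) : 0 < mesh m i := by
  rw [← S.edgeLength_eq_mesh]; exact (S.isMetricGraph i).edgeLength_pos

theorem m_pos {m : ℕ} {η Δ : ℝ} (S : AdmissibleSystem.{u} m η Δ) : 0 < m := by
  rcases Nat.eq_zero_or_pos m with h | h
  · have := S.mesh_pos 1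
    simp [mesh, h] at this
  · exact h

theorem mesh_succ {m : ℕ} {η Δ : ℝ} (S : AdmissibleSystem.{u} m η Δ)
    (i : ℕ) : mesh m i = m * mesh m (i + 1) := by
  have : (m : ℝ) ≠ 0 := by exact_mod_cast S.m_pos.ne'
  rw [mesh, mesh, pow_succ]; field_simp

/-- The height of a point: its projection to the zeroth graph, identified with `[0, 1]`. -/
noncomputable def hgt : ∀ i, S.Space i → ℝ
  | 0 => fun x => (S.isometric_unitInterval.some x : ℝ)
  | i + 1 => fun x => hgt i (S.proj i x)

theorem hgt_mem (i : ℕ) (x : S.Space i) : S.hgt i x ∈ Icc (0 : ℝ) 1 := by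
  induction i with
  | zero => exact (S.isometric_unitInterval.some x).2
  | succ i ih => exact ih _

theorem abs_hgt_sub_zero (x y : S.Space 0) : |S.hgt 0 x - S.hgt 0 y| = dist x y := by
  rw [← S.isometric_unitInterval.some.isometry.dist_eq x y]
  rfl

theorem exists_up (i : ℕ) (f : (S.graph (i + 1)).Edge) :
    ∃ (e : (S.graph i).Edge) (k : Fin m), S.proj i '' (S.graph (i + 1)).edgeSet f =
      (S.graph i).edge e '' Icc (k * mesh m (i + 1)) (k * mesh m (i + 1) + mesh m (i + 1)) := by
  obtain ⟨e', he'⟩ := (S.isSimplicial_proj i).2 f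
  refine ⟨e'.1, e'.2, he'.trans ?_⟩
  have hm : (m : ℝ) ≠ 0 := by exact_mod_cast S.m_pos.ne'
  have hl : (S.graph i).edgeLength / m = mesh m (i + 1) := by
    rw [S.edgeLength_eq_mesh, S.mesh_succ i]; field_simp
  simp only [GraphData.edgeSet, GraphData.subdivide, hl]
  rw [← Set.image_image (fun t => (S.graph i).edge e'.1 t)
    (fun t => ((e'.2 : ℕ) : ℝ) * mesh m (i + 1) + t)]
  rw [Set.image_const_add_Icc, add_zero]

/-- The edge that contains the projection of a given edge. -/
noncomputable def up {i : ℕ} (f : (S.graph (i + 1)).Edge) : (S.graph i).Edge :=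
  (S.exists_up i f).choose

theorem sub_mem_Icc {i : ℕ} (k : Fin m) {t : ℝ}
    (ht : t ∈ Icc (k * mesh m (i + 1)) (k * mesh m (i + 1) + mesh m (i + 1))) :
    t ∈ Icc 0 (S.graph i).edgeLength := by
  have h1 := S.mesh_pos (i + 1)
  rw [S.edgeLength_eq_mesh, S.mesh_succ]
  have h2 : ((k : ℕ) : ℝ) + 1 ≤ m := by exact_mod_cast k.2
  refine ⟨le_trans (by positivity) ht.1, ht.2.trans ?_⟩
  nlinarith

theorem proj_mem {i : ℕ} {f : (S.graph (i + 1)).Edge} {x : S.Space (i + 1)}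
    (hx : x ∈ (S.graph (i + 1)).edgeSet f) : S.proj i x ∈ (S.graph i).edgeSet (S.up f) := by
  obtain ⟨k, hk⟩ := (S.exists_up i f).choose_spec
  have : S.proj i x ∈ S.proj i '' (S.graph (i + 1)).edgeSet f := ⟨x, hx, rfl⟩
  rw [hk] at this
  obtain ⟨t, ht, h⟩ := this
  exact ⟨t, S.sub_mem_Icc k ht, h⟩

/-- On every edge the distance is the difference of the heights. -/
theorem abs_hgt_sub {i : ℕ} {f : (S.graph i).Edge} {x y : S.Space i}
    (hx : x ∈ (S.graph i).edgeSet f) (hy : y ∈ (S.graph i).edgeSet f) :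
    |S.hgt i x - S.hgt i y| = dist x y := by
  induction i with
  | zero => exact S.abs_hgt_sub_zero x y
  | succ i ih => rw [← S.isometry_on_edge i f x hx y hy]; exact ih (S.proj_mem hx) (S.proj_mem hy)

theorem abs_hgt_edge {i : ℕ} (f : (S.graph i).Edge) {s t : ℝ} (hs : s ∈ Icc 0 (mesh m i))
    (ht : t ∈ Icc 0 (mesh m i)) :
    |S.hgt i ((S.graph i).edge f s) - S.hgt i ((S.graph i).edge f t)| = |s - t| := by
  rw [← S.edgeLength_eq_mesh] at hs ht
  rw [S.abs_hgt_sub ⟨s, hs, rfl⟩ ⟨t, ht, rfl⟩, (S.isMetricGraph i).dist_edge f s hs t ht]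

/-- The height is an isometry from an edge to the line, hence affine with slope `1` or `-1`. -/
theorem hgt_edge {i : ℕ} (f : (S.graph i).Edge) :
    (∀ s ∈ Icc 0 (mesh m i), S.hgt i ((S.graph i).edge f s) =
      S.hgt i ((S.graph i).edge f 0) + s) ∨
    (∀ s ∈ Icc 0 (mesh m i), S.hgt i ((S.graph i).edge f s) =
      S.hgt i ((S.graph i).edge f 0) - s) := by
  have h0 := S.mesh_pos i
  have hz : (0 : ℝ) ∈ Icc 0 (mesh m i) := ⟨le_rfl, h0.le⟩
  have hl : mesh m i ∈ Icc 0 (mesh m i) := ⟨h0.le, le_rfl⟩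
  have h1 := S.abs_hgt_edge f hl hz
  rw [sub_zero, abs_of_pos h0] at h1
  rcases (abs_eq h0.le).1 h1 with h | h
  · left
    intro s hs
    have h2 := S.abs_hgt_edge f hs hz
    have h3 := S.abs_hgt_edge f hl hs
    rw [sub_zero, abs_of_nonneg hs.1] at h2
    rw [abs_of_nonneg (sub_nonneg.2 hs.2)] at h3
    have h4 := (abs_le.1 h2.le).2
    have h5 := (abs_le.1 h3.le).2
    linarith
  · right
    intro s hs
    have h2 := S.abs_hgt_edge f hs hz
    have h3 := S.abs_hgt_edge f hl hs
    rw [sub_zero, abs_of_nonneg hs.1] at h2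
    rw [abs_of_nonneg (sub_nonneg.2 hs.2)] at h3
    have h4 := (abs_le.1 h2.le).1
    have h5 := (abs_le.1 h3.le).1
    linarith

open scoped Classical in
/-- The lower end of an edge. -/
noncomputable def src {i : ℕ} (f : (S.graph i).Edge) : S.Space i :=
  if S.hgt i ((S.graph i).edge f 0) ≤ S.hgt i ((S.graph i).edge f (S.graph i).edgeLength)
  then (S.graph i).edge f 0 else (S.graph i).edge f (S.graph i).edgeLength

open scoped Classical in
/-- The upper end of an edge. -/
noncomputable def tgt {i : ℕ} (f : (S.graph i).Edge) : S.Space i :=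
  if S.hgt i ((S.graph i).edge f 0) ≤ S.hgt i ((S.graph i).edge f (S.graph i).edgeLength)
  then (S.graph i).edge f (S.graph i).edgeLength else (S.graph i).edge f 0

theorem src_mem {i : ℕ} (f : (S.graph i).Edge) : S.src f ∈ (S.graph i).edgeSet f := by
  rw [src]; split_ifs
  · exact (S.isMetricGraph i).edge_zero_mem f
  · exact (S.isMetricGraph i).edge_edgeLength_mem f

theorem tgt_mem {i : ℕ} (f : (S.graph i).Edge) : S.tgt f ∈ (S.graph i).edgeSet f := by
  rw [tgt]; split_ifs
  · exact (S.isMetricGraph i).edge_edgeLength_mem f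
  · exact (S.isMetricGraph i).edge_zero_mem f

theorem hgt_edge_src {i : ℕ} (f : (S.graph i).Edge) :
    (S.src f = (S.graph i).edge f 0 ∧ S.tgt f = (S.graph i).edge f (mesh m i) ∧
      ∀ s ∈ Icc 0 (mesh m i), S.hgt i ((S.graph i).edge f s) = S.hgt i (S.src f) + s) ∨
    (S.src f = (S.graph i).edge f (mesh m i) ∧ S.tgt f = (S.graph i).edge f 0 ∧
      ∀ s ∈ Icc 0 (mesh m i), S.hgt i ((S.graph i).edge f s) =
        S.hgt i (S.src f) + (mesh m i - s)) := by
  have h0 := S.mesh_pos i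
  have hl : mesh m i ∈ Icc 0 (mesh m i) := ⟨h0.le, le_rfl⟩
  simp only [src, tgt, S.edgeLength_eq_mesh]
  rcases S.hgt_edge f with h | h
  · left
    rw [if_pos (by rw [h _ hl]; linarith), if_pos (by rw [h _ hl]; linarith)]
    exact ⟨rfl, rfl, h⟩
  · right
    rw [if_neg (by rw [h _ hl]; linarith), if_neg (by rw [h _ hl]; linarith)]
    refine ⟨rfl, rfl, fun s hs => ?_⟩
    rw [h _ hs, h _ hl]; ring

theorem hgt_tgt {i : ℕ} (f : (S.graph i).Edge) :
    S.hgt i (S.tgt f) = S.hgt i (S.src f) + mesh m i := by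
  have h0 := S.mesh_pos i
  rcases S.hgt_edge_src f with ⟨-, h2, h3⟩ | ⟨-, h2, h3⟩
  · rw [h2, h3 _ ⟨h0.le, le_rfl⟩]
  · rw [h2, h3 _ ⟨le_rfl, h0.le⟩, sub_zero]

theorem hgt_mem_of_mem {i : ℕ} {f : (S.graph i).Edge} {x : S.Space i}
    (hx : x ∈ (S.graph i).edgeSet f) :
    S.hgt i (S.src f) ≤ S.hgt i x ∧ S.hgt i x ≤ S.hgt i (S.src f) + mesh m i := by
  obtain ⟨s, hs, rfl⟩ := hx
  rw [S.edgeLength_eq_mesh] at hs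
  have h1 := hs.1
  have h2 := hs.2
  rcases S.hgt_edge_src f with ⟨-, -, h3⟩ | ⟨-, -, h3⟩ <;> rw [h3 s hs] <;>
    constructor <;> linarith

theorem exists_mem_of_hgt {i : ℕ} (f : (S.graph i).Edge) {t : ℝ} (h1 : S.hgt i (S.src f) ≤ t)
    (h2 : t ≤ S.hgt i (S.src f) + mesh m i) : ∃ x ∈ (S.graph i).edgeSet f, S.hgt i x = t := by
  rcases S.hgt_edge_src f with ⟨-, -, h3⟩ | ⟨-, -, h3⟩
  · have : t - S.hgt i (S.src f) ∈ Icc 0 (mesh m i) := ⟨by linarith, by linarith⟩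
    exact ⟨_, ⟨_, by rwa [S.edgeLength_eq_mesh], rfl⟩, by rw [h3 _ this]; ring⟩
  · have : mesh m i - (t - S.hgt i (S.src f)) ∈ Icc 0 (mesh m i) := ⟨by linarith, by linarith⟩
    exact ⟨_, ⟨_, by rwa [S.edgeLength_eq_mesh], rfl⟩, by rw [h3 _ this]; ring⟩

theorem eq_of_hgt_eq {i : ℕ} {f : (S.graph i).Edge} {x y : S.Space i}
    (hx : x ∈ (S.graph i).edgeSet f) (hy : y ∈ (S.graph i).edgeSet f)
    (h : S.hgt i x = S.hgt i y) : x = y := by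
  have := S.abs_hgt_sub hx hy
  rw [h, sub_self, abs_zero] at this
  exact dist_eq_zero.1 this.symm

theorem mem_vertices_iff {i : ℕ} {f : (S.graph i).Edge} {x : S.Space i}
    (hx : x ∈ (S.graph i).edgeSet f) :
    x ∈ (S.graph i).vertices ↔ x = S.src f ∨ x = S.tgt f := by
  obtain ⟨s, hs, rfl⟩ := hx
  have h0 := S.mesh_pos i
  have hl : mesh m i ∈ Icc 0 (mesh m i) := ⟨h0.le, le_rfl⟩
  rw [(S.isMetricGraph i).edge_mem_vertices f s hs]
  have hinj := (S.isMetricGraph i).edge_injOn f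
  simp only [S.edgeLength_eq_mesh] at hs hinj ⊢
  rcases S.hgt_edge_src f with ⟨h1, h2, -⟩ | ⟨h1, h2, -⟩ <;> rw [h1, h2]
  · exact or_congr (hinj.eq_iff hs ⟨le_rfl, h0.le⟩).symm (hinj.eq_iff hs hl).symm
  · rw [or_comm]
    exact or_congr (hinj.eq_iff hs hl).symm (hinj.eq_iff hs ⟨le_rfl, h0.le⟩).symm

theorem eq_of_mem_of_hgt {i : ℕ} {e f : (S.graph i).Edge} {x : S.Space i}
    (he : x ∈ (S.graph i).edgeSet e) (hf : x ∈ (S.graph i).edgeSet f)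
    (h1 : S.hgt i (S.src e) < S.hgt i x) (h2 : S.hgt i x < S.hgt i (S.src e) + mesh m i) :
    e = f := by
  refine (S.isMetricGraph i).eq_of_mem_of_notMem_vertices he hf fun hv => ?_
  rcases (S.mem_vertices_iff he).1 hv with h | h
  · rw [h] at h1; exact lt_irrefl _ h1
  · rw [h, S.hgt_tgt] at h2; exact lt_irrefl _ h2

/-- An edge of the zeroth graph has length `1` and fills the whole of `[0, 1]`. An edge of a later
graph projects onto one of the `m` equal parts of an edge, whose lower end is on the finer grid. -/
theorem exists_int_hgt_src {i : ℕ} (f : (S.graph i).Edge) :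
    ∃ n : ℤ, S.hgt i (S.src f) = n * mesh m i := by
  induction i with
  | zero =>
    refine ⟨0, ?_⟩
    have h1 := S.hgt_tgt f
    have h2 := S.hgt_mem 0 (S.tgt f)
    have h3 := S.hgt_mem 0 (S.src f)
    have h4 : mesh m 0 = 1 := by simp [mesh]
    rw [h4] at h1
    have := h2.2
    have := h3.1
    simp only [Int.cast_zero, zero_mul]
    linarith
  | succ i ih =>
    obtain ⟨k, hk⟩ := (S.exists_up i f).choose_spec
    change S.proj i '' _ = (S.graph i).edge (S.up f) '' _ at hk
    obtain ⟨n, hn⟩ := ih (S.up f)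
    have h0 := S.mesh_pos (i + 1)
    -- The parameter `ha` is that of the lower end of the part: its left end if the parametrization
    -- ascends, its right end if it descends.
    obtain ⟨a, ha, hmin, hle⟩ : ∃ a : ℤ, ∃ t₀ ∈ Icc ((k : ℕ) * mesh m (i + 1))
        ((k : ℕ) * mesh m (i + 1) + mesh m (i + 1)),
        S.hgt i ((S.graph i).edge (S.up f) t₀) = a * mesh m (i + 1) ∧
        ∀ t ∈ Icc ((k : ℕ) * mesh m (i + 1)) ((k : ℕ) * mesh m (i + 1) + mesh m (i + 1)),
        a * mesh m (i + 1) ≤ S.hgt i ((S.graph i).edge (S.up f) t) := by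
      rcases S.hgt_edge_src (S.up f) with ⟨-, -, h3⟩ | ⟨-, -, h3⟩
      · refine ⟨n * m + k, (k : ℕ) * mesh m (i + 1), ⟨le_rfl, by linarith⟩, ?_, fun t ht => ?_⟩
        · rw [h3 _ (by rw [← S.edgeLength_eq_mesh]; exact S.sub_mem_Icc k ⟨le_rfl, by linarith⟩),
            hn, S.mesh_succ]
          push_cast; ring
        · rw [h3 _ (by rw [← S.edgeLength_eq_mesh]; exact S.sub_mem_Icc k ht), hn, S.mesh_succ i]
          have := ht.1
          push_cast
          linarith
      · refine ⟨n * m + m - k - 1, (k : ℕ) * mesh m (i + 1) + mesh m (i + 1),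
          ⟨by linarith, le_rfl⟩, ?_, fun t ht => ?_⟩
        · rw [h3 _ (by rw [← S.edgeLength_eq_mesh]; exact S.sub_mem_Icc k ⟨by linarith, le_rfl⟩),
            hn, S.mesh_succ]
          push_cast; ring
        · rw [h3 _ (by rw [← S.edgeLength_eq_mesh]; exact S.sub_mem_Icc k ht), hn, S.mesh_succ i]
          have := ht.2
          push_cast
          linarith
    refine ⟨a, le_antisymm ?_ ?_⟩
    · have : (S.graph i).edge (S.up f) ha ∈ S.proj i '' (S.graph (i + 1)).edgeSet f := by
        rw [hk]; exact ⟨ha, hmin, rfl⟩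
      obtain ⟨z, hz, hz'⟩ := this
      rw [← hle.1, ← hz']
      exact (S.hgt_mem_of_mem hz).1
    · have : S.proj i (S.src f) ∈ S.proj i '' (S.graph (i + 1)).edgeSet f := ⟨_, S.src_mem f, rfl⟩
      rw [hk] at this
      obtain ⟨t, ht, h⟩ := this
      have := hle.2 t ht
      rwa [h] at this

theorem eq_of_mem_of_not_int {i : ℕ} {e f : (S.graph i).Edge} {x : S.Space i}
    (he : x ∈ (S.graph i).edgeSet e) (hf : x ∈ (S.graph i).edgeSet f)
    (h : ∀ n : ℤ, S.hgt i x ≠ n * mesh m i) : e = f := by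
  obtain ⟨n, hn⟩ := S.exists_int_hgt_src e
  obtain ⟨h1, h2⟩ := S.hgt_mem_of_mem he
  refine S.eq_of_mem_of_hgt he hf (lt_of_le_of_ne h1 ?_) (lt_of_le_of_ne h2 ?_)
  · rw [hn]; exact (h n).symm
  · rw [hn]; intro h'; refine h (n + 1) ?_
    rw [h']; push_cast; ring

/-- Openness: the image of a small ball around `x` contains a point of `e` slightly above the
projection of `x`. Its preimage in that ball shares an edge with `x`, and this edge must project
into `e`. -/
theorem exists_lift_above {i : ℕ} {x : S.Space (i + 1)} {e : (S.graph i).Edge}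
    (hx : S.proj i x ∈ (S.graph i).edgeSet e)
    (h : S.hgt (i + 1) x < S.hgt i (S.src e) + mesh m i) :
    ∃ f, x ∈ (S.graph (i + 1)).edgeSet f ∧ S.up f = e ∧
      S.hgt (i + 1) x < S.hgt (i + 1) (S.src f) + mesh m (i + 1) := by
  obtain ⟨ρ, hρ, hxρ⟩ := (S.isMetricGraph (i + 1)).exists_radius x
  have hop := S.isOpenMap_proj i _ (Metric.isOpen_ball (x := x) (ε := ρ))
  obtain ⟨ε, hε, hsub⟩ := Metric.isOpen_iff.1 hop (S.proj i x) ⟨x, Metric.mem_ball_self hρ, rfl⟩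
  have hxe := S.hgt_mem_of_mem hx
  change S.hgt i (S.proj i x) < _ at h
  set δ := min (ε / 2) ((S.hgt i (S.src e) + mesh m i - S.hgt i (S.proj i x)) / 2) with hδ
  have hδ0 : 0 < δ := lt_min (by linarith) (by linarith)
  have hδ1 : δ ≤ ε / 2 := min_le_left _ _
  have hδ2 : δ ≤ (S.hgt i (S.src e) + mesh m i - S.hgt i (S.proj i x)) / 2 := min_le_right _ _
  obtain ⟨y, hy, hyt⟩ := S.exists_mem_of_hgt e (t := S.hgt i (S.proj i x) + δ)
    (by linarith) (by linarith)
  have hyd : y ∈ Metric.ball (S.proj i x) ε := by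
    rw [Metric.mem_ball, ← S.abs_hgt_sub hy hx, hyt, add_sub_cancel_left, abs_of_pos hδ0]
    linarith
  obtain ⟨x', hx', rfl⟩ := hsub hyd
  rw [Metric.mem_ball, dist_comm] at hx'
  obtain ⟨f, hxf, hxf'⟩ := hxρ x' hx' (by rintro rfl; linarith)
  refine ⟨f, hxf, (S.eq_of_mem_of_hgt hy (S.proj_mem hxf') (by linarith) (by linarith)).symm, ?_⟩
  have h4 := (S.hgt_mem_of_mem hxf').2
  change S.hgt i (S.proj i x') ≤ _ at h4
  change S.hgt i (S.proj i x) < _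
  linarith

theorem exists_lift_below {i : ℕ} {x : S.Space (i + 1)} {e : (S.graph i).Edge}
    (hx : S.proj i x ∈ (S.graph i).edgeSet e) (h : S.hgt i (S.src e) < S.hgt (i + 1) x) :
    ∃ f, x ∈ (S.graph (i + 1)).edgeSet f ∧ S.up f = e ∧
      S.hgt (i + 1) (S.src f) < S.hgt (i + 1) x := by
  obtain ⟨ρ, hρ, hxρ⟩ := (S.isMetricGraph (i + 1)).exists_radius x
  have hop := S.isOpenMap_proj i _ (Metric.isOpen_ball (x := x) (ε := ρ))
  obtain ⟨ε, hε, hsub⟩ := Metric.isOpen_iff.1 hop (S.proj i x) ⟨x, Metric.mem_ball_self hρ, rfl⟩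
  have hxe := S.hgt_mem_of_mem hx
  change _ < S.hgt i (S.proj i x) at h
  set δ := min (ε / 2) ((S.hgt i (S.proj i x) - S.hgt i (S.src e)) / 2) with hδ
  have hδ0 : 0 < δ := lt_min (by linarith) (by linarith)
  have hδ1 : δ ≤ ε / 2 := min_le_left _ _
  have hδ2 : δ ≤ (S.hgt i (S.proj i x) - S.hgt i (S.src e)) / 2 := min_le_right _ _
  obtain ⟨y, hy, hyt⟩ := S.exists_mem_of_hgt e (t := S.hgt i (S.proj i x) - δ)
    (by linarith) (by linarith)
  have hyd : y ∈ Metric.ball (S.proj i x) ε := by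
    rw [Metric.mem_ball, dist_comm, ← S.abs_hgt_sub hx hy, hyt, sub_sub_cancel, abs_of_pos hδ0]
    linarith
  obtain ⟨x', hx', rfl⟩ := hsub hyd
  rw [Metric.mem_ball, dist_comm] at hx'
  obtain ⟨f, hxf, hxf'⟩ := hxρ x' hx' (by rintro rfl; linarith)
  refine ⟨f, hxf, (S.eq_of_mem_of_hgt hy (S.proj_mem hxf') (by linarith) (by linarith)).symm, ?_⟩
  have h4 := (S.hgt_mem_of_mem hxf').1
  change _ ≤ S.hgt i (S.proj i x') at h4
  change _ < S.hgt i (S.proj i x)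
  linarith

/-- Without edges only constant paths exist, and the distance of two points would be the infimum of
the empty set. -/
theorem nonempty_edge_zero : Nonempty (S.graph 0).Edge := by
  by_contra hne
  rw [not_nonempty_iff] at hne
  set φ := S.isometric_unitInterval.some with hφ
  have hnil : ∀ x y L, (S.graph 0).PathLength x y L → x = y := by
    intro x y L h
    cases h with
    | nil => rfl
    | cons e => exact isEmptyElim e
  have hxy : φ.symm ⟨0, by simp⟩ ≠ φ.symm ⟨1, by simp⟩ := by
    intro h
    have := φ.symm.injective h
    simp at this
  have h := (S.isMetricGraph 0).isGLB_dist (φ.symm ⟨0, by simp⟩) (φ.symm ⟨1, by simp⟩)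
  have hemp : {L : ℝ | (S.graph 0).PathLength (φ.symm ⟨0, by simp⟩) (φ.symm ⟨1, by simp⟩) L} = ∅ := by
    ext L
    simp only [Set.mem_ofPred_eq, mem_empty_iff_false, iff_false]
    exact fun hL => hxy (hnil _ _ _ hL)
  rw [hemp, isGLB_empty_iff] at h
  have := h (dist (φ.symm ⟨0, by simp⟩) (φ.symm ⟨1, by simp⟩) + 1)
  linarith

theorem hgt_src_zero (e : (S.graph 0).Edge) : S.hgt 0 (S.src e) = 0 := by
  have h1 := S.hgt_tgt e
  have h2 := (S.hgt_mem 0 (S.tgt e)).2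
  have h3 := (S.hgt_mem 0 (S.src e)).1
  have h4 : mesh m 0 = 1 := by simp [mesh]
  rw [h4] at h1
  linarith

theorem mem_edge_zero (x : S.Space 0) (e : (S.graph 0).Edge) : x ∈ (S.graph 0).edgeSet e := by
  have h1 := S.hgt_mem 0 x
  have h4 : mesh m 0 = 1 := by simp [mesh]
  obtain ⟨y, hy, hyt⟩ := S.exists_mem_of_hgt e (t := S.hgt 0 x)
    (by rw [S.hgt_src_zero]; exact h1.1) (by rw [S.hgt_src_zero, h4, zero_add]; exact h1.2)
  have := S.abs_hgt_sub_zero y x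
  rw [hyt, sub_self, abs_zero] at this
  rwa [← dist_eq_zero.1 this.symm]

theorem exists_edge {i : ℕ} (x : S.Space i) : ∃ e, x ∈ (S.graph i).edgeSet e := by
  induction i with
  | zero =>
    obtain ⟨e⟩ := S.nonempty_edge_zero
    exact ⟨e, S.mem_edge_zero x e⟩
  | succ i ih =>
    obtain ⟨e, he⟩ := ih (S.proj i x)
    by_cases h : S.hgt (i + 1) x < S.hgt i (S.src e) + mesh m i
    · obtain ⟨f, hf, -⟩ := S.exists_lift_above he h
      exact ⟨f, hf⟩
    · obtain ⟨f, hf, -⟩ := S.exists_lift_below he (by linarith [S.mesh_pos i])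
      exact ⟨f, hf⟩

theorem exists_edge_above {i : ℕ} {x : S.Space i} (hx : S.hgt i x < 1) :
    ∃ e, x ∈ (S.graph i).edgeSet e ∧ S.hgt i x < S.hgt i (S.src e) + mesh m i := by
  induction i with
  | zero =>
    obtain ⟨e⟩ := S.nonempty_edge_zero
    refine ⟨e, S.mem_edge_zero x e, ?_⟩
    simpa [S.hgt_src_zero, mesh] using hx
  | succ i ih =>
    obtain ⟨e, he, h⟩ := ih (x := S.proj i x) hx
    obtain ⟨f, hf, -, hf'⟩ := S.exists_lift_above he h
    exact ⟨f, hf, hf'⟩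

theorem exists_edge_below {i : ℕ} {x : S.Space i} (hx : 0 < S.hgt i x) :
    ∃ e, x ∈ (S.graph i).edgeSet e ∧ S.hgt i (S.src e) < S.hgt i x := by
  induction i with
  | zero =>
    obtain ⟨e⟩ := S.nonempty_edge_zero
    refine ⟨e, S.mem_edge_zero x e, ?_⟩
    simpa [S.hgt_src_zero, mesh] using hx
  | succ i ih =>
    obtain ⟨e, he, h⟩ := ih (x := S.proj i x) hx
    obtain ⟨f, hf, -, hf'⟩ := S.exists_lift_below he h
    exact ⟨f, hf, hf'⟩

theorem pathLength_of_mem {i : ℕ} {f : (S.graph i).Edge} {x y : S.Space i}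
    (hx : x ∈ (S.graph i).edgeSet f) (hy : y ∈ (S.graph i).edgeSet f) :
    (S.graph i).PathLength x y |S.hgt i x - S.hgt i y| := by
  rw [S.abs_hgt_sub hx hy]
  obtain ⟨s, hs, rfl⟩ := hx
  obtain ⟨t, ht, rfl⟩ := hy
  rw [(S.isMetricGraph i).dist_edge f s hs t ht]
  simpa using GraphData.PathLength.cons f s t hs ht _ 0 (GraphData.PathLength.nil _)

/-- Edges above `x` that project into `e` are stacked until the height of `y` is reached. The number
`n` bounds the grid heights still to be climbed. -/
theorem exists_path_above {i : ℕ} {e : (S.graph i).Edge} {y : S.Space i}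
    (hy : y ∈ (S.graph i).edgeSet e) {N : ℤ} (hN : S.hgt i y ≤ N * mesh m (i + 1)) (n : ℕ)
    {x : S.Space (i + 1)} (hx : S.proj i x ∈ (S.graph i).edgeSet e)
    (hn : (N - n) * mesh m (i + 1) ≤ S.hgt (i + 1) x) (hxy : S.hgt (i + 1) x ≤ S.hgt i y) :
    ∃ y', S.proj i y' = y ∧
      (S.graph (i + 1)).PathLength x y' (S.hgt i y - S.hgt (i + 1) x) := by
  induction n generalizing x with
  | zero =>
    have h : S.hgt i (S.proj i x) = S.hgt i y := by
      refine le_antisymm hxy ?_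
      change _ ≤ S.hgt i (S.proj i x) at hn
      simp only [Nat.cast_zero, sub_zero] at hn
      exact hN.trans hn
    refine ⟨x, S.eq_of_hgt_eq hx hy h, ?_⟩
    rw [← h]
    change (S.graph (i + 1)).PathLength x x (S.hgt (i + 1) x - S.hgt (i + 1) x)
    rw [sub_self]
    exact GraphData.PathLength.nil x
  | succ n ih =>
    rcases hxy.eq_or_lt with h | h
    · refine ⟨x, S.eq_of_hgt_eq hx hy h, ?_⟩
      rw [h, sub_self]
      exact GraphData.PathLength.nil x
    · obtain ⟨f, hf, hfe, hft⟩ := S.exists_lift_above hx (h.trans_le (S.hgt_mem_of_mem hy).2)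
      by_cases hend : S.hgt i y ≤ S.hgt (i + 1) (S.src f) + mesh m (i + 1)
      · obtain ⟨y', hy', hyt⟩ := S.exists_mem_of_hgt f (t := S.hgt i y)
          ((S.hgt_mem_of_mem hf).1.trans hxy) hend
        refine ⟨y', S.eq_of_hgt_eq (hfe ▸ S.proj_mem hy') hy hyt, ?_⟩
        have := S.pathLength_of_mem hf hy'
        rwa [hyt, abs_sub_comm, abs_of_pos (by linarith)] at this
      · push Not at hend
        obtain ⟨k, hk⟩ := S.exists_int_hgt_src f
        have h0 := S.mesh_pos (i + 1)
        have hkn : N - (n + 1) < k + 1 := by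
          have : ((N - (n + 1) : ℤ) : ℝ) * mesh m (i + 1) < ((k + 1 : ℤ) : ℝ) * mesh m (i + 1) := by
            push_cast at hn ⊢
            rw [hk] at hft
            linarith
          exact_mod_cast lt_of_mul_lt_mul_right this h0.le
        have hkn' : (N : ℝ) - n ≤ k + 1 := by
          have : N - n ≤ k + 1 := by omega
          exact_mod_cast this
        obtain ⟨y', hy', hp⟩ := ih (x := S.tgt f) (hfe ▸ S.proj_mem (S.tgt_mem f))
          (by rw [S.hgt_tgt, hk]; nlinarith) (by rw [S.hgt_tgt]; exact hend.le)
        refine ⟨y', hy', ?_⟩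
        have hp' := (S.pathLength_of_mem hf (S.tgt_mem f)).append hp
        rw [S.hgt_tgt, abs_sub_comm, abs_of_pos (by linarith)] at hp'
        convert hp' using 1
        ring

theorem exists_path_below {i : ℕ} {e : (S.graph i).Edge} {y : S.Space i}
    (hy : y ∈ (S.graph i).edgeSet e) {N : ℤ} (hN : N * mesh m (i + 1) ≤ S.hgt i y) (n : ℕ)
    {x : S.Space (i + 1)} (hx : S.proj i x ∈ (S.graph i).edgeSet e)
    (hn : S.hgt (i + 1) x ≤ (N + n) * mesh m (i + 1)) (hxy : S.hgt i y ≤ S.hgt (i + 1) x) :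
    ∃ y', S.proj i y' = y ∧
      (S.graph (i + 1)).PathLength x y' (S.hgt (i + 1) x - S.hgt i y) := by
  induction n generalizing x with
  | zero =>
    have h : S.hgt i (S.proj i x) = S.hgt i y := by
      refine le_antisymm ?_ hxy
      change S.hgt i (S.proj i x) ≤ _ at hn
      simp only [Nat.cast_zero, add_zero] at hn
      exact hn.trans hN
    refine ⟨x, S.eq_of_hgt_eq hx hy h, ?_⟩
    rw [← h]
    change (S.graph (i + 1)).PathLength x x (S.hgt (i + 1) x - S.hgt (i + 1) x)
    rw [sub_self]
    exact GraphData.PathLength.nil x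
  | succ n ih =>
    rcases hxy.eq_or_lt with h | h
    · refine ⟨x, S.eq_of_hgt_eq hx hy h.symm, ?_⟩
      rw [h, sub_self]
      exact GraphData.PathLength.nil x
    · obtain ⟨f, hf, hfe, hft⟩ := S.exists_lift_below hx ((S.hgt_mem_of_mem hy).1.trans_lt h)
      by_cases hend : S.hgt (i + 1) (S.src f) ≤ S.hgt i y
      · obtain ⟨y', hy', hyt⟩ := S.exists_mem_of_hgt f (t := S.hgt i y)
          hend (hxy.trans (S.hgt_mem_of_mem hf).2)
        refine ⟨y', S.eq_of_hgt_eq (hfe ▸ S.proj_mem hy') hy hyt, ?_⟩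
        have := S.pathLength_of_mem hf hy'
        rwa [hyt, abs_of_pos (by linarith)] at this
      · push Not at hend
        obtain ⟨k, hk⟩ := S.exists_int_hgt_src f
        have h0 := S.mesh_pos (i + 1)
        have hkn : k < N + (n + 1) := by
          have : ((k : ℤ) : ℝ) * mesh m (i + 1) < ((N + (n + 1) : ℤ) : ℝ) * mesh m (i + 1) := by
            push_cast at hn ⊢
            rw [hk] at hft
            linarith
          exact_mod_cast lt_of_mul_lt_mul_right this h0.le
        have hkn' : (k : ℝ) ≤ N + n := by
          have : k ≤ N + n := by omega
          exact_mod_cast this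
        obtain ⟨y', hy', hp⟩ := ih (x := S.src f) (hfe ▸ S.proj_mem (S.src_mem f))
          (by rw [hk]; nlinarith) hend.le
        refine ⟨y', hy', ?_⟩
        have hp' := (S.pathLength_of_mem hf (S.src_mem f)).append hp
        rw [abs_of_pos (by linarith)] at hp'
        convert hp' using 1
        ring

theorem exists_pathLength_lift_edge {i : ℕ} {e : (S.graph i).Edge} {y : S.Space i}
    {x : S.Space (i + 1)} (hx : S.proj i x ∈ (S.graph i).edgeSet e)
    (hy : y ∈ (S.graph i).edgeSet e) :
    ∃ y', S.proj i y' = y ∧ (S.graph (i + 1)).PathLength x y' |S.hgt (i + 1) x - S.hgt i y| := by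
  have h0 := S.mesh_pos (i + 1)
  obtain ⟨N, hN⟩ : ∃ N : ℕ, S.hgt i y ≤ N * mesh m (i + 1) ∧
      S.hgt (i + 1) x ≤ N * mesh m (i + 1) := by
    obtain ⟨N, hN⟩ := exists_nat_ge (1 / mesh m (i + 1))
    rw [div_le_iff₀ h0] at hN
    exact ⟨N, (S.hgt_mem _ _).2.trans hN, (S.hgt_mem _ _).2.trans hN⟩
  rcases le_total (S.hgt (i + 1) x) (S.hgt i y) with h | h
  · obtain ⟨y', hy', hp⟩ := S.exists_path_above hy (N := N) (by exact_mod_cast hN.1) N hx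
      (by simpa using (S.hgt_mem _ _).1) h
    refine ⟨y', hy', ?_⟩
    rwa [abs_sub_comm, abs_of_nonneg (by linarith)]
  · obtain ⟨y', hy', hp⟩ := S.exists_path_below hy (N := 0) (by simpa using (S.hgt_mem _ _).1) N hx
      (by simpa using hN.2) h
    refine ⟨y', hy', ?_⟩
    rwa [abs_of_nonneg (by linarith)]

/-- Each segment of a path lies in one edge, where heights measure length, and lifts with its length
by climbing or descending from any point over its start. -/
theorem exists_pathLength_lift {i : ℕ} {y z : S.Space i} {L : ℝ}
    (h : (S.graph i).PathLength z y L) {x : S.Space (i + 1)} (hx : S.proj i x = z) :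
    ∃ y', S.proj i y' = y ∧ (S.graph (i + 1)).PathLength x y' L := by
  induction h generalizing x with
  | nil z => exact ⟨x, hx, GraphData.PathLength.nil x⟩
  | cons e s t hs ht y L _ ih =>
    obtain ⟨x', hx', hp⟩ := S.exists_pathLength_lift_edge (x := x) (e := e)
      (y := (S.graph i).edge e t) (by rw [hx]; exact ⟨s, hs, rfl⟩) ⟨t, ht, rfl⟩
    obtain ⟨y', hy', hp'⟩ := ih hx'
    refine ⟨y', hy', ?_⟩
    rw [show S.hgt (i + 1) x = S.hgt i (S.proj i x) from rfl, hx,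
      S.abs_hgt_edge e (by rwa [← S.edgeLength_eq_mesh]) (by rwa [← S.edgeLength_eq_mesh])] at hp
    exact hp.append hp'

theorem exists_pathLength_lt {i : ℕ} (x y : S.Space i) {ε : ℝ} (hε : 0 < ε) :
    ∃ L < dist x y + ε, (S.graph i).PathLength x y L := by
  have h := (S.isMetricGraph i).isGLB_dist x y
  obtain ⟨L, hL, -, h2⟩ := h.exists_between (show dist x y < dist x y + ε by linarith)
  exact ⟨L, h2, hL⟩

theorem proj_surjective (i : ℕ) : Function.Surjective (S.proj i) := by
  intro y
  obtain ⟨x⟩ := (S.isMetricGraph (i + 1)).nonempty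
  obtain ⟨L, -, hL⟩ := S.exists_pathLength_lt (S.proj i x) y one_pos
  obtain ⟨y', hy', -⟩ := S.exists_pathLength_lift hL rfl
  exact ⟨y', hy'⟩

/-- An almost shortest path between the projections lifts to one of the same length from `x` that
ends in the fibre of `y`. The diameter of the fibre is the error. -/
theorem dist_le_dist_proj (hη : 0 ≤ η) {i : ℕ} (x y : S.Space (i + 1)) :
    dist x y ≤ dist (S.proj i x) (S.proj i y) + η * mesh m i := by
  refine le_of_forall_pos_le_add fun ε hε => ?_
  obtain ⟨L, hL, hp⟩ := S.exists_pathLength_lt (S.proj i x) (S.proj i y) hε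
  obtain ⟨y', hy', hp'⟩ := S.exists_pathLength_lift hp rfl
  have h1 := (S.isMetricGraph (i + 1)).dist_le_of_pathLength hp'
  have h2 : dist y' y ≤ η * mesh m i := by
    have h3 : edist y' y ≤ ENNReal.ofReal (η * ((m : ℝ) ^ i)⁻¹) :=
      (Metric.edist_le_ediam_of_mem (s := S.proj i ⁻¹' {S.proj i y}) hy' rfl).trans
        (S.ediam_fiber_le i _)
    rw [edist_dist] at h3
    exact (ENNReal.ofReal_le_ofReal_iff (mul_nonneg hη (S.mesh_pos i).le)).1 h3
  linarith [dist_triangle x y' y]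

theorem up_surjective (i : ℕ) : Function.Surjective (S.up (i := i)) := by
  intro e
  obtain ⟨x, hx⟩ := S.proj_surjective i (S.src e)
  obtain ⟨f, -, hf, -⟩ := S.exists_lift_above (x := x) (e := e) (by rw [hx]; exact S.src_mem e)
    (by
      change S.hgt i (S.proj i x) < _
      rw [hx]; linarith [S.mesh_pos i])
  exact ⟨f, hf⟩

end AdmissibleSystem

/-- Below `j` the thread is obtained by projection, above `j` by choosing preimages. It serves for
points, for edges and for chains of edges. -/
theorem exists_thread {E : ℕ → Type u} {p : ∀ i, E (i + 1) → E i}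
    (hp : ∀ i, Function.Surjective (p i)) (j : ℕ) (x : E j) :
    ∃ F : ∀ i, E i, F j = x ∧ ∀ i, p i (F (i + 1)) = F i := by
  induction j generalizing E with
  | zero =>
    choose g hg using hp
    exact ⟨fun i => Nat.rec x (fun i y => g i y) i, rfl, fun i => hg i _⟩
  | succ j ih =>
    obtain ⟨F, hF, hF'⟩ := ih (E := fun i => E (i + 1)) (p := fun i => p (i + 1))
      (fun i => hp (i + 1)) x
    refine ⟨fun i => Nat.casesOn i (p 0 (F 0)) F, hF, fun i => ?_⟩
    cases i with
    | zero => rfl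
    | succ i => exact hF' i

/-! ### Comparison of the limit metric with the metrics of the graphs -/

namespace AdmissibleSystem

variable {m : ℕ} {η Δ : ℝ} (S : AdmissibleSystem.{u} m η Δ)

theorem exists_limit_coord_eq (j : ℕ) (x : S.Space j) : ∃ v : S.Limit, v.coord j = x := by
  obtain ⟨F, h1, h2⟩ := exists_thread S.proj_surjective j x
  exact ⟨⟨F, h2⟩, h1⟩

theorem exists_edge_thread (j : ℕ) (e : (S.graph j).Edge) :
    ∃ F : ∀ i, (S.graph i).Edge, F j = e ∧ ∀ i, S.up (F (i + 1)) = F i :=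
  exists_thread S.up_surjective j e

theorem dist_coord_mono (v w : S.Limit) {i j : ℕ} (hij : i ≤ j) :
    dist (v.coord i) (w.coord i) ≤ dist (v.coord j) (w.coord j) := by
  induction j, hij using Nat.le_induction with
  | base => rfl
  | succ j _ ih =>
    refine ih.trans ?_
    rw [← v.proj_coord j, ← w.proj_coord j]
    exact S.dist_proj_le j _ _

theorem mesh_nonneg {m : ℕ} {η Δ : ℝ} (S : AdmissibleSystem.{u} m η Δ)
    (i : ℕ) : 0 ≤ mesh m i := (S.mesh_pos i).le

theorem dist_coord_le (hm : 2 ≤ m) (hη : 0 ≤ η) (v w : S.Limit) (i j : ℕ) :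
    dist (v.coord i) (w.coord i) ≤ dist (v.coord j) (w.coord j) + 2 * η * mesh m j := by
  rcases le_total i j with hij | hij
  · have := S.dist_coord_mono v w hij
    have := mul_nonneg (mul_nonneg two_pos.le hη) (S.mesh_nonneg j)
    linarith
  · have key : dist (v.coord i) (w.coord i) + 2 * η * mesh m i ≤
        dist (v.coord j) (w.coord j) + 2 * η * mesh m j := by
      induction i, hij using Nat.le_induction with
      | base => rfl
      | succ i _ ih =>
        refine le_trans ?_ ih
        have h1 := S.dist_le_dist_proj hη (v.coord (i + 1)) (w.coord (i + 1))
        rw [v.proj_coord, w.proj_coord] at h1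
        have h2 := S.mesh_succ i
        have h3 := S.mesh_pos (i + 1)
        have h4 : 2 * mesh m (i + 1) ≤ mesh m i := by
          rw [h2]
          have : (2 : ℝ) ≤ m := by exact_mod_cast hm
          nlinarith
        nlinarith
    have := mul_nonneg (mul_nonneg two_pos.le hη) (S.mesh_nonneg i)
    linarith

theorem edist_le_of_dist_coord (hm : 2 ≤ m) (hη : 0 ≤ η) (v w : S.Limit) (j : ℕ) :
    edist v w ≤ ENNReal.ofReal (dist (v.coord j) (w.coord j) + 2 * η * mesh m j) := by
  rw [edist_def]
  refine iSup_le fun i => ?_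
  rw [edist_dist]
  exact ENNReal.ofReal_le_ofReal (S.dist_coord_le hm hη v w i j)

theorem ofReal_dist_coord_le (v w : S.Limit) (j : ℕ) :
    ENNReal.ofReal (dist (v.coord j) (w.coord j)) ≤ edist v w := by
  rw [edist_def, ← edist_dist]
  exact le_iSup (fun i => edist (v.coord i) (w.coord i)) j

theorem hgt_coord (v : S.Limit) (i : ℕ) : S.hgt i (v.coord i) = S.hgt 0 (v.coord 0) := by
  induction i with
  | zero => rfl
  | succ i ih => rw [← ih, ← v.proj_coord i]; rfl

theorem abs_hgt_sub_le_dist {i : ℕ} (x y : S.Space i) : |S.hgt i x - S.hgt i y| ≤ dist x y := by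
  refine (S.isMetricGraph i).abs_sub_le_dist (fun e s hs t ht => ?_) x y
  rw [S.edgeLength_eq_mesh] at hs ht
  exact (S.abs_hgt_edge e hs ht).le

end AdmissibleSystem

/-! ### Upward paths, chains of full height, and monotone geodesics -/

namespace UpPath

variable {P E : Type*} {src tgt : E → P}

theorem consecutive {u v : P} {l : List E} (h : UpPath src tgt u l v) (k : ℕ)
    (hk : k + 1 < l.length) : tgt (l[k]'(by omega)) = src l[k + 1] := by
  induction l generalizing u k with
  | nil => simp at hk
  | cons f l ih =>
    cases k with
    | zero =>
      cases l with
      | nil => simp at hk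
      | cons g l => exact h.2.1.symm
    | succ k => exact ih h.2 k (by simpa using hk)

theorem apply_src_getElem {u v : P} {l : List E} (h : UpPath src tgt u l v) {φ : P → ℝ} {s : ℝ}
    (hφ : ∀ f, φ (tgt f) = φ (src f) + s) (k : ℕ) (hk : k < l.length) :
    φ (src l[k]) = φ u + k * s := by
  induction l generalizing u k with
  | nil => simp at hk
  | cons f l ih =>
    cases k with
    | zero => simp [h.1]
    | succ k =>
      have := ih h.2 k (by simpa using hk)
      rw [hφ, h.1] at this
      simp only [List.getElem_cons_succ]
      rw [this]; push_cast; ring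

theorem apply_end {u v : P} {l : List E} (h : UpPath src tgt u l v) {φ : P → ℝ} {s : ℝ}
    (hφ : ∀ f, φ (tgt f) = φ (src f) + s) : φ v = φ u + l.length * s := by
  induction l generalizing u with
  | nil => rw [show u = v from h]; simp
  | cons f l ih =>
    rw [ih h.2, hφ, h.1]; push_cast [List.length_cons]; ring

end UpPath

namespace AdmissibleSystem

variable {m : ℕ} {η Δ : ℝ} (S : AdmissibleSystem.{u} m η Δ)

theorem mesh_mul_pow {m : ℕ} {η Δ : ℝ} (S : AdmissibleSystem.{u} m η Δ) (i : ℕ) :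
    (m : ℝ) ^ i * mesh m i = 1 := by
  have : (m : ℝ) ≠ 0 := by exact_mod_cast S.m_pos.ne'
  rw [mesh]; field_simp

theorem eq_src_of_int {i : ℕ} {e : (S.graph i).Edge} {x : S.Space i}
    (hx : x ∈ (S.graph i).edgeSet e) (hint : ∃ n : ℤ, S.hgt i x = n * mesh m i)
    (h : S.hgt i x < S.hgt i (S.src e) + mesh m i) : x = S.src e := by
  obtain ⟨n, hn⟩ := hint
  obtain ⟨k, hk⟩ := S.exists_int_hgt_src e
  have h0 := S.mesh_pos i
  have h1 := (S.hgt_mem_of_mem hx).1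
  refine S.eq_of_hgt_eq hx (S.src_mem e) ?_
  rw [hn, hk] at h1 h ⊢
  have h2 : (k : ℝ) ≤ n := le_of_mul_le_mul_right h1 h0
  have h3 : (n : ℝ) < k + 1 := lt_of_mul_lt_mul_right (by linarith : (n : ℝ) * mesh m i <
    (k + 1) * mesh m i) h0.le
  have : n = k := by
    have h2' : k ≤ n := by exact_mod_cast h2
    have h3' : n < k + 1 := by exact_mod_cast h3
    omega
  rw [this]

theorem eq_tgt_of_int {i : ℕ} {e : (S.graph i).Edge} {x : S.Space i}
    (hx : x ∈ (S.graph i).edgeSet e) (hint : ∃ n : ℤ, S.hgt i x = n * mesh m i)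
    (h : S.hgt i (S.src e) < S.hgt i x) : x = S.tgt e := by
  by_contra hne
  have h1 := (S.hgt_mem_of_mem hx).2
  rcases h1.eq_or_lt with h2 | h2
  · exact hne (S.eq_of_hgt_eq hx (S.tgt_mem e) (by rw [h2, S.hgt_tgt]))
  · rw [S.eq_src_of_int hx hint h2] at h; exact lt_irrefl _ h

theorem exists_upPath_to_top {i : ℕ} (n : ℕ) {x : S.Space i}
    (hx : S.hgt i x + n * mesh m i = 1) :
    ∃ l v, UpPath S.src S.tgt x l v ∧ S.hgt i v = 1 := by
  have h0 := S.mesh_pos i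
  induction n generalizing x with
  | zero => exact ⟨[], x, rfl, by simpa using hx⟩
  | succ n ih =>
    have hn : (0 : ℝ) ≤ n * mesh m i := by positivity
    push_cast at hx
    obtain ⟨e, he, hlt⟩ := S.exists_edge_above (x := x) (by nlinarith)
    have hint : ∃ k : ℤ, S.hgt i x = k * mesh m i := by
      refine ⟨(m ^ i : ℕ) - (n + 1), ?_⟩
      have := S.mesh_mul_pow i
      push_cast
      linarith
    have hxe := S.eq_src_of_int he hint hlt
    obtain ⟨l, v, hl, hv⟩ := ih (x := S.tgt e) (by rw [S.hgt_tgt, ← hxe]; linarith)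
    exact ⟨e :: l, v, ⟨hxe.symm, hl⟩, hv⟩

theorem exists_upPath_from_bot {i : ℕ} (n : ℕ) {x : S.Space i}
    (hx : S.hgt i x = n * mesh m i) :
    ∃ l v, UpPath S.src S.tgt v l x ∧ S.hgt i v = 0 := by
  have h0 := S.mesh_pos i
  induction n generalizing x with
  | zero => exact ⟨[], x, rfl, by simpa using hx⟩
  | succ n ih =>
    have hn : (0 : ℝ) ≤ n * mesh m i := by positivity
    push_cast at hx
    obtain ⟨e, he, hlt⟩ := S.exists_edge_below (x := x) (by nlinarith)
    have hxe := S.eq_tgt_of_int he ⟨n + 1, by push_cast; linarith⟩ hlt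
    obtain ⟨l, v, hl, hv⟩ := ih (x := S.src e) (by
      have := S.hgt_tgt e
      rw [← hxe] at this; linarith)
    refine ⟨l ++ [e], v, hl.append ?_, hv⟩
    rw [hxe]; exact UpPath.singleton e

/-- Sequences of edges of the `i`-th graph that form an upward path of full length. -/
def IsChain (i : ℕ) (F : ℕ → (S.graph i).Edge) : Prop :=
  (∀ k < m ^ i, S.hgt i (S.src (F k)) = k * mesh m i) ∧
    ∀ k, k + 1 < m ^ i → S.tgt (F k) = S.src (F (k + 1))

theorem exists_chain_of_full {i : ℕ} {u v : S.Space i} {l : List (S.graph i).Edge}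
    (h : UpPath S.src S.tgt u l v) (hu : S.hgt i u = 0) (hv : S.hgt i v = 1) :
    ∃ F, S.IsChain i F ∧ ∀ f ∈ l, ∃ k < m ^ i, F k = f := by
  have h0 := S.mesh_pos i
  have hlen : l.length = m ^ i := by
    have h1 := h.apply_end (φ := S.hgt i) S.hgt_tgt
    rw [hu, hv, zero_add, ← S.mesh_mul_pow i] at h1
    exact_mod_cast (mul_right_cancel₀ h0.ne' h1).symm
  obtain ⟨f₀, -⟩ := S.exists_edge u
  refine ⟨fun k => l.getD k f₀, ⟨fun k hk => ?_, fun k hk => ?_⟩, fun f hf => ?_⟩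
  · rw [← hlen] at hk
    have := h.apply_src_getElem (φ := S.hgt i) S.hgt_tgt k hk
    rw [hu, zero_add] at this
    simpa only [List.getD_eq_getElem _ f₀ hk] using this
  · rw [← hlen] at hk
    have := h.consecutive k hk
    simpa only [List.getD_eq_getElem _ f₀ hk,
      List.getD_eq_getElem _ f₀ (show k < l.length by omega)] using this
  · obtain ⟨k, hk, rfl⟩ := List.getElem_of_mem hf
    exact ⟨k, hlen ▸ hk, List.getD_eq_getElem _ f₀ hk⟩

theorem exists_nat_hgt_src {i : ℕ} (f : (S.graph i).Edge) :
    ∃ n : ℕ, n < m ^ i ∧ S.hgt i (S.src f) = n * mesh m i := by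
  obtain ⟨n, hn⟩ := S.exists_int_hgt_src f
  have h0 := S.mesh_pos i
  have h1 := (S.hgt_mem i (S.src f)).1
  have h2 := (S.hgt_mem i (S.tgt f)).2
  rw [S.hgt_tgt, ← S.mesh_mul_pow i, hn] at h2
  rw [hn] at h1
  have h1' : (0 : ℝ) ≤ n := le_of_mul_le_mul_right (by linarith) h0
  have h2' : ((n : ℝ) + 1) ≤ m ^ i := le_of_mul_le_mul_right (by linarith) h0
  lift n to ℕ using (by exact_mod_cast h1')
  refine ⟨n, ?_, by exact_mod_cast hn⟩
  exact_mod_cast h2'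

theorem exists_chain_of_upPath {i : ℕ} {u v : S.Space i} {l : List (S.graph i).Edge}
    (h : UpPath S.src S.tgt u l v) : ∃ F, S.IsChain i F ∧ ∀ f ∈ l, ∃ k < m ^ i, F k = f := by
  -- An empty path may sit at a point that is not a vertex and cannot be prolonged. It is replaced
  -- by a chain through the lower end of some edge.
  suffices H : ∀ (u : S.Space i) (l : List (S.graph i).Edge), UpPath S.src S.tgt u l v → l ≠ [] →
      ∃ F, S.IsChain i F ∧ ∀ f ∈ l, ∃ k < m ^ i, F k = f by
    rcases eq_or_ne l [] with rfl | hl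
    · obtain ⟨f, -⟩ := S.exists_edge u
      obtain ⟨l', v', h1, h2⟩ := S.exists_upPath_from_bot (x := S.src f)
        (S.exists_nat_hgt_src f).choose (S.exists_nat_hgt_src f).choose_spec.2
      obtain ⟨n, hn, hn'⟩ := S.exists_nat_hgt_src f
      obtain ⟨l'', v'', h3, h4⟩ := S.exists_upPath_to_top (x := S.src f) (m ^ i - n) (by
        rw [hn', Nat.cast_sub hn.le]; push_cast; rw [sub_mul, S.mesh_mul_pow]; ring)
      obtain ⟨F, hF, -⟩ := S.exists_chain_of_full (h1.append h3) h2 h4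
      exact ⟨F, hF, by simp⟩
    · exact H u l h hl
  intro u l h hl
  obtain ⟨f, l, rfl⟩ := List.exists_cons_of_ne_nil hl
  obtain ⟨n, hn, hn'⟩ := S.exists_nat_hgt_src f
  have hv := h.apply_end (φ := S.hgt i) S.hgt_tgt
  rw [← h.1, hn', ← add_mul] at hv
  have h0 := S.mesh_pos i
  have hle : n + (f :: l).length ≤ m ^ i := by
    have h2 := (S.hgt_mem i v).2
    rw [hv, ← S.mesh_mul_pow i] at h2
    exact_mod_cast le_of_mul_le_mul_right h2 h0
  obtain ⟨l', v', h1, h2⟩ := S.exists_upPath_from_bot n hn'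
  obtain ⟨l'', v'', h3, h4⟩ := S.exists_upPath_to_top (x := v) (m ^ i - (n + (f :: l).length)) (by
    rw [hv, Nat.cast_sub hle]; push_cast; rw [sub_mul, S.mesh_mul_pow]; ring)
  rw [h.1] at h1
  obtain ⟨F, hF, hF'⟩ := S.exists_chain_of_full ((h1.append h).append h3) h2 h4
  exact ⟨F, hF, fun g hg => hF' g (by simp only [List.mem_append]; tauto)⟩

section Chain

variable {S}

/-- Consecutive edges of a chain meet at a height that is a multiple of the coarse mesh only at
indices divisible by `m`. At all others the common vertex projects to the interior of one edge, so
blocks of `m` edges have the same image. -/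
theorem IsChain.coarsen {i : ℕ} {F : ℕ → (S.graph (i + 1)).Edge} (hF : S.IsChain (i + 1) F) :
    S.IsChain i (fun k => S.up (F (m * k))) ∧
      ∀ k < m ^ (i + 1), S.up (F k) = S.up (F (m * (k / m))) := by
  have hm := S.m_pos
  have h0 := S.mesh_pos (i + 1)
  have hms := S.mesh_succ i
  have key : ∀ k r, r < m → m * k + r < m ^ (i + 1) →
      S.up (F (m * k + r)) = S.up (F (m * k)) := by
    intro k r
    induction r with
    | zero => intros; rfl
    | succ r ih =>
      intro hr hk
      rw [← ih (by omega) (by omega)]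
      have h1 : S.tgt (F (m * k + r)) = S.src (F (m * k + (r + 1))) := hF.2 _ (by omega)
      refine S.eq_of_mem_of_not_int (x := S.proj i (S.src (F (m * k + (r + 1)))))
        (S.proj_mem (S.src_mem _)) (S.proj_mem (by rw [← h1]; exact S.tgt_mem _)) ?_
      intro n hn
      change S.hgt (i + 1) _ = _ at hn
      rw [hF.1 _ hk, hms, ← mul_assoc] at hn
      have h2 := mul_right_cancel₀ h0.ne' hn
      have h3 : ((m * k + (r + 1) : ℕ) : ℤ) = n * m := by exact_mod_cast h2
      have h4 : (m : ℤ) ∣ (r + 1 : ℕ) := by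
        refine ⟨n - k, ?_⟩
        push_cast at h3 ⊢
        linarith
      have h5 := Nat.le_of_dvd (by omega) (Int.natCast_dvd_natCast.1 h4)
      omega
  have hkey : ∀ k < m ^ (i + 1), S.up (F k) = S.up (F (m * (k / m))) := by
    intro k hk
    have h1 := Nat.div_add_mod k m
    conv_lhs => rw [← h1]
    exact key _ _ (Nat.mod_lt _ hm) (by rw [h1]; exact hk)
  have hlt : ∀ k < m ^ i, m * k + m ≤ m ^ (i + 1) := by
    intro k hk
    rw [pow_succ, mul_comm (m ^ i)]
    calc m * k + m = m * (k + 1) := by ring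
      _ ≤ _ := Nat.mul_le_mul_left _ hk
  have hsrc : ∀ k < m ^ i, S.proj i (S.src (F (m * k))) = S.src (S.up (F (m * k))) := by
    intro k hk
    have h1 : S.hgt i (S.proj i (S.src (F (m * k)))) = k * mesh m i := by
      change S.hgt (i + 1) _ = _
      rw [hF.1 _ (by have := hlt k hk; omega), hms]; push_cast; ring
    refine S.eq_src_of_int (S.proj_mem (S.src_mem _)) ⟨k, by exact_mod_cast h1⟩ ?_
    have h2 := S.hgt_mem_of_mem (S.proj_mem (S.tgt_mem (F (m * k))))
    change _ ≤ S.hgt (i + 1) (S.tgt (F (m * k))) ∧ S.hgt (i + 1) (S.tgt (F (m * k))) ≤ _ at h2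
    rw [S.hgt_tgt] at h2
    change S.hgt (i + 1) (S.src _) < _
    linarith [h2.2]
  refine ⟨⟨fun k hk => ?_, fun k hk => ?_⟩, hkey⟩
  · change S.hgt i (S.src (S.up (F (m * k)))) = _
    rw [← hsrc k hk]
    change S.hgt (i + 1) _ = _
    rw [hF.1 _ (by have := hlt k hk; omega), hms]; push_cast; ring
  · change S.tgt (S.up (F (m * k))) = S.src (S.up (F (m * (k + 1))))
    rw [← hsrc _ hk]
    have h1 := hlt (k + 1) hk
    have h2 : m * (k + 1) = (m * k + (m - 1)) + 1 := by rw [mul_add]; omega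
    have h3 := hF.2 (m * k + (m - 1)) (by omega)
    rw [← h2] at h3
    have h4 : S.src (F (m * (k + 1))) ∈ (S.graph (i + 1)).edgeSet (F (m * k + (m - 1))) := by
      rw [← h3]; exact S.tgt_mem _
    have h5 := S.proj_mem h4
    rw [key k (m - 1) (by omega) (by omega)] at h5
    refine (S.eq_tgt_of_int h5 ⟨k + 1, ?_⟩ ?_).symm
    · change S.hgt (i + 1) _ = _
      rw [hF.1 _ (by omega), hms]; push_cast; ring
    · rw [← hsrc k (by omega)]
      change S.hgt (i + 1) _ < S.hgt (i + 1) _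
      rw [hF.1 _ (by omega), hF.1 _ (by omega)]
      refine mul_lt_mul_of_pos_right ?_ h0
      exact_mod_cast Nat.mul_lt_mul_of_pos_left (Nat.lt_succ_self k) hm

theorem IsChain.exists_refine {i : ℕ} {F : ℕ → (S.graph i).Edge} (hF : S.IsChain i F) :
    ∃ F' : ℕ → (S.graph (i + 1)).Edge, S.IsChain (i + 1) F' ∧ ∀ k, S.up (F' k) = F (k / m) := by
  have hm := S.m_pos
  have h0 := S.mesh_pos (i + 1)
  have hms := S.mesh_succ i
  -- Indices beyond `m ^ (i + 1)` only have to lie over the given sequence. They are irrelevant to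
  -- the chain, but make coarsening a surjection on sequences indexed by all naturals.
  set Q : ℕ → (S.graph (i + 1)).Edge → Prop := fun k f => S.up f = F (k / m) ∧
    (k < m ^ (i + 1) → S.hgt (i + 1) (S.src f) = k * mesh m (i + 1)) with hQ
  have hdiv : ∀ k < m ^ (i + 1), k / m < m ^ i := fun k hk => by
    rw [Nat.div_lt_iff_lt_mul hm, ← pow_succ]; exact hk
  have hlow : ∀ k : ℕ, ((k / m : ℕ) : ℝ) * mesh m i ≤ k * mesh m (i + 1) := fun k => by
    rw [hms, ← mul_assoc]
    refine mul_le_mul_of_nonneg_right ?_ h0.le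
    exact_mod_cast Nat.div_mul_le_self k m
  have hhigh : ∀ k : ℕ, k * mesh m (i + 1) < ((k / m : ℕ) : ℝ) * mesh m i + mesh m i := fun k => by
    rw [hms, ← mul_assoc, ← add_mul]
    refine mul_lt_mul_of_pos_right ?_ h0
    have h1 := Nat.div_add_mod k m
    have h2 := Nat.mod_lt k hm
    have : k < k / m * m + m := by nlinarith
    exact_mod_cast this
  have hext : ∀ k < m ^ (i + 1), ∀ x : S.Space (i + 1), S.hgt (i + 1) x = k * mesh m (i + 1) →
      S.proj i x ∈ (S.graph i).edgeSet (F (k / m)) → ∃ f, Q k f ∧ S.src f = x := by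
    intro k hk x hx hxF
    obtain ⟨f, hf, hup, hlt⟩ := S.exists_lift_above hxF (by
      rw [hx, hF.1 _ (hdiv k hk)]; exact hhigh k)
    have := S.eq_src_of_int hf ⟨k, by exact_mod_cast hx⟩ hlt
    exact ⟨f, ⟨hup, fun _ => by rw [← this, hx]⟩, this.symm⟩
  have hstart : ∃ f, Q 0 f := by
    obtain ⟨x, hx⟩ := S.proj_surjective i (S.src (F 0))
    obtain ⟨f, hf, -⟩ := hext 0 (by positivity) x (by
      change S.hgt i (S.proj i x) = _
      rw [hx, hF.1 0 (by positivity)]; simp) (by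
      rw [hx, Nat.zero_div]; exact S.src_mem _)
    exact ⟨f, hf⟩
  have hstep : ∀ k f, Q k f → ∃ g, Q (k + 1) g ∧
      (k + 1 < m ^ (i + 1) → S.tgt f = S.src g) := by
    intro k f hf
    by_cases hk : k + 1 < m ^ (i + 1)
    · have hh : S.hgt (i + 1) (S.tgt f) = (k + 1 : ℕ) * mesh m (i + 1) := by
        rw [S.hgt_tgt, hf.2 (by omega)]; push_cast; ring
      have hp : S.proj i (S.tgt f) ∈ (S.graph i).edgeSet (F (k / m)) := by
        rw [← hf.1]; exact S.proj_mem (S.tgt_mem f)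
      obtain ⟨g, hg, hgs⟩ := hext (k + 1) hk (S.tgt f) hh (by
        by_cases hd : m ∣ k + 1
        · rw [Nat.succ_div_of_dvd hd]
          have h1 := hdiv _ hk
          rw [Nat.succ_div_of_dvd hd] at h1
          have h2 : S.proj i (S.tgt f) = S.tgt (F (k / m)) := by
            refine S.eq_of_hgt_eq hp (S.tgt_mem _) ?_
            change S.hgt (i + 1) _ = _
            obtain ⟨c, hc⟩ := hd
            have hc' : k / m + 1 = c := by
              rw [← Nat.succ_div_of_dvd ⟨c, hc⟩, hc, Nat.mul_div_cancel_left _ hm]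
            rw [hh, S.hgt_tgt, hF.1 _ (by omega), hc, ← hc', hms]; push_cast; ring
          rw [h2, hF.2 _ h1]
          exact S.src_mem _
        · rwa [Nat.succ_div_of_not_dvd hd])
      exact ⟨g, hg, fun _ => hgs.symm⟩
    · obtain ⟨g, hg⟩ := S.up_surjective i (F ((k + 1) / m))
      exact ⟨g, ⟨hg, fun h => absurd h hk⟩, fun h => absurd h hk⟩
  choose! g hg using hstep
  obtain ⟨f₀, hf₀⟩ := hstart
  let F' : ℕ → (S.graph (i + 1)).Edge := fun k => Nat.rec f₀ (fun k f => g k f) k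
  have hF' : ∀ k, Q k (F' k) := by
    intro k
    induction k with
    | zero => exact hf₀
    | succ k ih => exact (hg k _ ih).1
  exact ⟨F', ⟨fun k hk => (hF' k).2 hk, fun k hk => (hg k _ (hF' k)).2 hk⟩, fun k => (hF' k).1⟩

theorem IsChain.dist_le {i : ℕ} {F : ℕ → (S.graph i).Edge} (hF : S.IsChain i F) {k l : ℕ}
    (hl : l < m ^ i) {x y : S.Space i} (hx : x ∈ (S.graph i).edgeSet (F k))
    (hy : y ∈ (S.graph i).edgeSet (F l)) (hk : k < l) : dist x y ≤ S.hgt i y - S.hgt i x := by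
  induction l, hk using Nat.le_induction generalizing y with
  | base =>
    have h := hF.2 k hl
    have h1 := S.abs_hgt_sub hx (S.tgt_mem _)
    have h2 := S.abs_hgt_sub (S.src_mem _) hy
    have h3 := S.hgt_mem_of_mem hx
    have h4 := S.hgt_mem_of_mem hy
    rw [S.hgt_tgt, abs_sub_comm, abs_of_nonneg (by linarith), ← S.hgt_tgt] at h1
    rw [abs_sub_comm, abs_of_nonneg (by linarith)] at h2
    have := dist_triangle x (S.tgt (F k)) y
    rw [← h1] at this
    rw [h, ← h2] at this
    linarith
  | succ l hkl ih =>
    have h := hF.2 l hl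
    have h1 := ih (y := S.tgt (F l)) (by omega) (S.tgt_mem _)
    have h2 := S.abs_hgt_sub (S.src_mem _) hy
    have h4 := S.hgt_mem_of_mem hy
    rw [abs_sub_comm, abs_of_nonneg (by linarith)] at h2
    have := dist_triangle x (S.tgt (F l)) y
    rw [h] at this h1
    linarith

/-- A chain joins two of its points by a path as long as their difference of heights, and no path is
shorter since the height is `1`-Lipschitz. -/
theorem IsChain.dist_eq {i : ℕ} {F : ℕ → (S.graph i).Edge} (hF : S.IsChain i F) {k l : ℕ}
    (hk : k < m ^ i) (hl : l < m ^ i) {x y : S.Space i} (hx : x ∈ (S.graph i).edgeSet (F k))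
    (hy : y ∈ (S.graph i).edgeSet (F l)) : dist x y = |S.hgt i x - S.hgt i y| := by
  refine le_antisymm ?_ (S.abs_hgt_sub_le_dist x y)
  rcases lt_trichotomy k l with h | rfl | h
  · rw [abs_sub_comm]; exact (hF.dist_le hl hx hy h).trans (le_abs_self _)
  · exact (S.abs_hgt_sub hx hy).ge
  · rw [dist_comm]; exact (hF.dist_le hk hy hx h).trans (le_abs_self _)

end Chain

theorem exists_chain_thread {j : ℕ} {F : ℕ → (S.graph j).Edge} (hF : S.IsChain j F) :
    ∃ G : ∀ i, ℕ → (S.graph i).Edge, G j = F ∧ (∀ i, S.IsChain i (G i)) ∧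
      ∀ i, ∀ k < m ^ (i + 1), S.up (G (i + 1) k) = G i (k / m) := by
  let p : ∀ i, {F // S.IsChain (i + 1) F} → {F // S.IsChain i F} :=
    fun i F => ⟨_, F.2.coarsen.1⟩
  have hp : ∀ i, Function.Surjective (p i) := by
    intro i F
    obtain ⟨F', h1, h2⟩ := F.2.exists_refine
    refine ⟨⟨F', h1⟩, Subtype.ext (funext fun k => ?_)⟩
    change S.up (F' (m * k)) = _
    rw [h2, Nat.mul_div_cancel_left _ S.m_pos]
  obtain ⟨G, h1, h2⟩ := exists_thread hp j ⟨F, hF⟩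
  refine ⟨fun i => (G i).1, congrArg Subtype.val h1, fun i => (G i).2, fun i k hk => ?_⟩
  rw [(G (i + 1)).2.coarsen.2 k hk]
  exact congrFun (congrArg Subtype.val (h2 i)) (k / m)

/-- At each level the point of height `t` is taken on the edge with index `⌊t * m ^ i⌋`. These
indices are compatible with division by `m`. -/
theorem exists_point_of_thread {G : ∀ i, ℕ → (S.graph i).Edge} (hG : ∀ i, S.IsChain i (G i))
    (hup : ∀ i, ∀ k < m ^ (i + 1), S.up (G (i + 1) k) = G i (k / m)) {t : ℝ}
    (ht : t ∈ Icc (0 : ℝ) 1) :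
    ∃ v : S.Limit, S.hgt 0 (v.coord 0) = t ∧
      ∀ i, ∃ k < m ^ i, v.coord i ∈ (S.graph i).edgeSet (G i k) := by
  have hm := S.m_pos
  -- The minimum matters only for `t = 1`, where the floor would be one beyond the last edge.
  set κ : ℕ → ℕ := fun i => min ⌊t * m ^ i⌋₊ (m ^ i - 1) with hκ
  have hpow : ∀ i, 0 < m ^ i := fun i => by positivity
  have hκlt : ∀ i, κ i < m ^ i := fun i =>
    lt_of_le_of_lt (min_le_right _ _) (by have := hpow i; omega)
  have hκdiv : ∀ i, κ (i + 1) / m = κ i := by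
    intro i
    have h1 : ⌊t * m ^ (i + 1)⌋₊ / m = ⌊t * m ^ i⌋₊ := by
      rw [← Nat.floor_div_natCast, pow_succ]
      congr 1
      have : (m : ℝ) ≠ 0 := by exact_mod_cast hm.ne'
      field_simp
    have h2 : (m ^ (i + 1) - 1) / m = m ^ i - 1 := by
      have h3 : m ^ (i + 1) - 1 = (m - 1) + m * (m ^ i - 1) := by
        have := hpow i
        rw [pow_succ, mul_comm, Nat.mul_sub]
        have : m * 1 ≤ m * m ^ i := Nat.mul_le_mul_left _ this
        omega
      rw [h3, Nat.add_mul_div_left _ _ hm, Nat.div_eq_of_lt (by omega), zero_add]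
    rw [hκ]
    simp only
    rw [(Monotone.map_min (f := fun k => k / m) (fun a b h => Nat.div_le_div_right h)), h1, h2]
  have hex : ∀ i, ∃ x ∈ (S.graph i).edgeSet (G i (κ i)), S.hgt i x = t := by
    intro i
    have h0 := S.mesh_pos i
    have h1 := S.mesh_mul_pow i
    have hp : (0 : ℝ) < (m : ℝ) ^ i := by exact_mod_cast hpow i
    have ht0 : 0 ≤ t * m ^ i := mul_nonneg ht.1 hp.le
    refine S.exists_mem_of_hgt _ ?_ ?_
    · rw [(hG i).1 _ (hκlt i)]
      calc (κ i : ℝ) * mesh m i ≤ (t * m ^ i) * mesh m i := by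
            refine mul_le_mul_of_nonneg_right ?_ h0.le
            exact (Nat.cast_le.2 (min_le_left _ _)).trans (Nat.floor_le ht0)
        _ = t := by rw [mul_assoc, h1, mul_one]
    · rw [(hG i).1 _ (hκlt i)]
      calc t = (t * m ^ i) * mesh m i := by rw [mul_assoc, h1, mul_one]
        _ ≤ (κ i + 1) * mesh m i := by
            refine mul_le_mul_of_nonneg_right ?_ h0.le
            rcases min_choice ⌊t * (m : ℝ) ^ i⌋₊ (m ^ i - 1) with h | h
            · rw [hκ]; simp only; rw [h]; exact (Nat.lt_floor_add_one _).le
            · rw [hκ]; simp only; rw [h, Nat.cast_sub (hpow i)]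
              push_cast
              nlinarith [ht.2]
        _ = _ := by ring
  choose x hx hxt using hex
  refine ⟨⟨x, fun i => ?_⟩, hxt 0, fun i => ⟨κ i, hκlt i, hx i⟩⟩
  refine S.eq_of_hgt_eq (f := G i (κ i)) ?_ (hx i) ?_
  · rw [← hκdiv i, ← hup i _ (hκlt (i + 1))]
    exact S.proj_mem (hx (i + 1))
  · change S.hgt (i + 1) _ = _
    rw [hxt, hxt]

/-- Every upward path in one of the graphs is contained in the projection of a monotone
geodesic. -/
theorem exists_monotoneGeodesic {j : ℕ} {u v : S.Space j} {l : List (S.graph j).Edge}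
    (h : UpPath S.src S.tgt u l v) : ∃ L, S.IsMonotoneGeodesic L ∧
      ∀ f ∈ l, ∀ x ∈ (S.graph j).edgeSet f, ∃ w ∈ L, w.coord j = x := by
  obtain ⟨F, hF, hFl⟩ := S.exists_chain_of_upPath h
  obtain ⟨G, rfl, hG, hup⟩ := S.exists_chain_thread hF
  -- The geodesic consists of the limit points whose coordinate at every level lies on the chain of
  -- that level.
  refine ⟨{v | ∀ i, ∃ k < m ^ i, v.coord i ∈ (S.graph i).edgeSet (G i k)}, ⟨?_, ?_⟩, ?_⟩
  · intro x hx y hy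
    rw [edist_def]
    refine le_antisymm (le_iSup (fun i => edist (x.coord i) (y.coord i)) 0) (iSup_le fun i => ?_)
    obtain ⟨k, hk, hxk⟩ := hx i
    obtain ⟨l, hl, hyl⟩ := hy i
    rw [edist_dist, edist_dist, (hG i).dist_eq hk hl hxk hyl, S.hgt_coord x, S.hgt_coord y,
      S.abs_hgt_sub_zero]
  · refine eq_univ_of_forall fun x => ?_
    obtain ⟨v, hv, hv'⟩ := S.exists_point_of_thread hG hup (S.hgt_mem 0 x)
    refine ⟨v, hv', ?_⟩
    have := S.abs_hgt_sub_zero (v.coord 0) x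
    rw [hv, sub_self, abs_zero] at this
    exact dist_eq_zero.1 this.symm
  · intro f hf x hx
    obtain ⟨k, hk, rfl⟩ := hFl f hf
    obtain ⟨w, hw, hw'⟩ := S.exists_point_of_thread hG hup (S.hgt_mem j x)
    refine ⟨w, hw', ?_⟩
    obtain ⟨l, hl, hwl⟩ := hw' j
    have := (hG j).dist_eq hl hk hwl hx
    rw [S.hgt_coord, hw, sub_self, abs_zero] at this
    exact dist_eq_zero.1 this

end AdmissibleSystem

/-! ### Edge paths covering a connected set of edges -/

/-- Paths in an oriented graph that may use the edges in both directions. -/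
def EdgePath {P E : Type*} (src tgt : E → P) : P → List E → P → Prop
  | u, [], v => u = v
  | u, f :: l, v => (src f = u ∧ EdgePath src tgt (tgt f) l v) ∨
      (tgt f = u ∧ EdgePath src tgt (src f) l v)

theorem UpPath.edgePath {P E : Type*} {src tgt : E → P} {u v : P} {l : List E}
    (h : UpPath src tgt u l v) : EdgePath src tgt u l v := by
  induction l generalizing u with
  | nil => exact h
  | cons f l ih => exact Or.inl ⟨h.1, ih h.2⟩

namespace EdgePath

variable {P E : Type*} {src tgt : E → P}

theorem append {u v w : P} {l l' : List E} (h : EdgePath src tgt u l v)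
    (h' : EdgePath src tgt v l' w) : EdgePath src tgt u (l ++ l') w := by
  induction l generalizing u with
  | nil => rw [show u = v from h]; exact h'
  | cons f l ih =>
    rcases h with ⟨h1, h2⟩ | ⟨h1, h2⟩
    · exact Or.inl ⟨h1, ih h2⟩
    · exact Or.inr ⟨h1, ih h2⟩

theorem exists_split {u v w : P} {l : List E} (h : EdgePath src tgt u l v) {f : E} (hf : f ∈ l)
    (hw : w = src f ∨ w = tgt f) :
    ∃ l₁ l₂, l = l₁ ++ l₂ ∧ EdgePath src tgt u l₁ w ∧ EdgePath src tgt w l₂ v := by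
  induction l generalizing u with
  | nil => simp at hf
  | cons g l ih =>
    rcases List.mem_cons.1 hf with rfl | hf
    · rcases hw with rfl | rfl <;> rcases h with ⟨h1, h2⟩ | ⟨h1, h2⟩
      · exact ⟨[], f :: l, rfl, h1.symm, Or.inl ⟨rfl, h2⟩⟩
      · exact ⟨[f], l, rfl, Or.inr ⟨h1, rfl⟩, h2⟩
      · exact ⟨[f], l, rfl, Or.inl ⟨h1, rfl⟩, h2⟩
      · exact ⟨[], f :: l, rfl, h1.symm, Or.inr ⟨rfl, h2⟩⟩
    · rcases h with ⟨h1, h2⟩ | ⟨h1, h2⟩ <;> obtain ⟨l₁, l₂, rfl, h3, h4⟩ := ih h2 hf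
      · exact ⟨g :: l₁, l₂, rfl, Or.inl ⟨h1, h3⟩, h4⟩
      · exact ⟨g :: l₁, l₂, rfl, Or.inr ⟨h1, h3⟩, h4⟩

theorem pair {f : E} {w : P} (hw : w = src f ∨ w = tgt f) : EdgePath src tgt w [f, f] w := by
  rcases hw with rfl | rfl
  · exact Or.inl ⟨rfl, Or.inr ⟨rfl, rfl⟩⟩
  · exact Or.inr ⟨rfl, Or.inl ⟨rfl, rfl⟩⟩

/-- A connected finite set of edges is covered by a closed path that uses every edge twice. -/
theorem exists_closed {H : Finset E} {e₀ : E} (he₀ : e₀ ∈ H) {u : P} (hu : u = src e₀ ∨ u = tgt e₀)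
    (hconn : ∀ A ⊂ H, A.Nonempty → ∃ a ∈ A, ∃ b ∈ H, b ∉ A ∧ ∃ w, (w = src a ∨ w = tgt a) ∧
      (w = src b ∨ w = tgt b)) :
    ∃ l, EdgePath src tgt u l u ∧ l.length = 2 * H.card ∧ ∀ f ∈ H, f ∈ l := by
  classical
  have key : ∀ n, n < H.card → ∃ A ⊆ H, A.card = n + 1 ∧ ∃ l, EdgePath src tgt u l u ∧
      l.length = 2 * A.card ∧ ∀ f ∈ A, f ∈ l := by
    intro n
    induction n with
    | zero =>
      intro _
      exact ⟨{e₀}, by simpa using he₀, by simp, [e₀, e₀], pair hu, by simp, by simp⟩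
    | succ n ih =>
      intro hn
      obtain ⟨A, hA, hAc, l, hl, hlen, hmem⟩ := ih (by omega)
      have hss : A ⊂ H := hA.ssubset_of_ne (by rintro rfl; omega)
      obtain ⟨a, ha, b, hb, hbA, w, hwa, hwb⟩ := hconn A hss (Finset.card_pos.1 (by omega))
      -- The closed path is cut at the common vertex, and the new edge is inserted there and back.
      obtain ⟨l₁, l₂, rfl, h1, h2⟩ := hl.exists_split (hmem a ha) hwa
      refine ⟨insert b A, Finset.insert_subset hb hA, by rw [Finset.card_insert_of_notMem hbA, hAc],
        l₁ ++ ([b, b] ++ l₂), h1.append ((pair hwb).append h2), ?_, ?_⟩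
      · rw [Finset.card_insert_of_notMem hbA]
        simp only [List.length_append, List.length_cons, List.length_nil] at hlen ⊢
        omega
      · intro f hf
        rcases Finset.mem_insert.1 hf with rfl | hf
        · simp
        · have := hmem f hf
          simp only [List.mem_append] at this ⊢
          tauto
  have hpos : 0 < H.card := Finset.card_pos.2 ⟨e₀, he₀⟩
  obtain ⟨A, hA, hAc, l, hl, hlen, hmem⟩ := key (H.card - 1) (by omega)
  have : A = H := Finset.eq_of_subset_of_card_le hA (by omega)
  subst this
  exact ⟨l, hl, hlen, hmem⟩

/-- The condition that the sequence `w` of points runs along the sequence `e` of edges. -/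
def Runs (src tgt : E → P) (w : ℕ → P) (e : ℕ → E) : Prop :=
  ∀ r, (w r = src (e r) ∧ w (r + 1) = tgt (e r)) ∨ (w r = tgt (e r) ∧ w (r + 1) = src (e r))

/-- Walks are infinite sequences. When the path is exhausted, the walk goes to and fro on an edge at
its end, and only the first `l.length` steps count. -/
theorem exists_runs {u v : P} {l : List E} (h : EdgePath src tgt u l v)
    (hv : ∃ f, v = src f ∨ v = tgt f) :
    ∃ w e, Runs src tgt w e ∧ w 0 = u ∧ ∀ f ∈ l, ∃ r < l.length, e r = f := by
  induction l generalizing u with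
  | nil =>
    obtain rfl : u = v := h
    obtain ⟨f, hf⟩ := hv
    rcases hf with rfl | rfl
    · refine ⟨fun r => if Even r then src f else tgt f, fun _ => f, fun r => ?_, by simp, by simp⟩
      by_cases hr : Even r <;> simp [hr, Nat.even_add_one]
    · refine ⟨fun r => if Even r then tgt f else src f, fun _ => f, fun r => ?_, by simp, by simp⟩
      by_cases hr : Even r <;> simp [hr, Nat.even_add_one]
  | cons g l ih =>
    obtain ⟨x, hx, hgx⟩ : ∃ x, EdgePath src tgt x l v ∧ ((u = src g ∧ x = tgt g) ∨
        (u = tgt g ∧ x = src g)) := by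
      rcases h with ⟨h1, h2⟩ | ⟨h1, h2⟩
      · exact ⟨_, h2, Or.inl ⟨h1.symm, rfl⟩⟩
      · exact ⟨_, h2, Or.inr ⟨h1.symm, rfl⟩⟩
    obtain ⟨w, e, h1, h2, h3⟩ := ih hx
    refine ⟨fun r => Nat.casesOn r u w, fun r => Nat.casesOn r g e, ?_, rfl, ?_⟩
    · rintro (_ | r)
      · simpa [h2] using hgx
      · exact h1 r
    · intro f hf
      rcases List.mem_cons.1 hf with rfl | hf
      · exact ⟨0, by simp, rfl⟩
      · obtain ⟨r, hr, hrf⟩ := h3 f hf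
        exact ⟨r + 1, by simpa using hr, hrf⟩

end EdgePath

/-! ### Walks in one graph as walks in the tower -/

namespace AdmissibleSystem

variable {m : ℕ} {η Δ : ℝ} (S : AdmissibleSystem.{u} m η Δ)

/-- The integral height, in units of the length of the edges. -/
noncomputable def intHgt {i : ℕ} (x : S.Space i) : ℤ := ⌊S.hgt i x * (m : ℝ) ^ i⌋

theorem intHgt_eq {i : ℕ} {x : S.Space i} {n : ℤ} (h : S.hgt i x = n * mesh m i) :
    S.intHgt x = n := by
  rw [intHgt, h, mul_assoc, mul_comm (mesh m i), S.mesh_mul_pow, mul_one, Int.floor_intCast]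

theorem hgt_src_eq {i : ℕ} (f : (S.graph i).Edge) :
    S.hgt i (S.src f) = S.intHgt (S.src f) * mesh m i := by
  obtain ⟨n, hn⟩ := S.exists_int_hgt_src f
  rw [S.intHgt_eq hn, hn]

theorem intHgt_tgt {i : ℕ} (f : (S.graph i).Edge) :
    S.intHgt (S.tgt f) = S.intHgt (S.src f) + 1 := by
  refine S.intHgt_eq ?_
  rw [S.hgt_tgt, S.hgt_src_eq]; push_cast; ring

theorem hgt_tgt_eq {i : ℕ} (f : (S.graph i).Edge) :
    S.hgt i (S.tgt f) = S.intHgt (S.tgt f) * mesh m i := by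
  rw [S.hgt_tgt, S.hgt_src_eq, S.intHgt_tgt]; push_cast; ring

theorem mesh_eq_pow_mul {m : ℕ} {η Δ : ℝ} (S : AdmissibleSystem.{u} m η Δ) {i J : ℕ} (h : i ≤ J) :
    mesh m i = (m ^ (J - i) : ℕ) * mesh m J := by
  have : (m : ℝ) ≠ 0 := by exact_mod_cast S.m_pos.ne'
  obtain ⟨k, rfl⟩ := Nat.exists_eq_add_of_le h
  rw [mesh, mesh, pow_add, Nat.add_sub_cancel_left]
  push_cast
  field_simp

theorem coord_mem_of_thread {F : ∀ i, (S.graph i).Edge} (hF : ∀ i, S.up (F (i + 1)) = F i)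
    {v : S.Limit} {i J : ℕ} (h : i ≤ J) (hv : v.coord J ∈ (S.graph J).edgeSet (F J)) :
    v.coord i ∈ (S.graph i).edgeSet (F i) := by
  induction J, h using Nat.le_induction with
  | base => exact hv
  | succ J _ ih =>
    refine ih ?_
    rw [← v.proj_coord, ← hF]
    exact S.proj_mem hv

section Walk

variable {J : ℕ} {w : ℕ → S.Space J} {e : ℕ → (S.graph J).Edge}

theorem runs_mem (h : EdgePath.Runs S.src S.tgt w e) (r : ℕ) :
    w r ∈ (S.graph J).edgeSet (e r) ∧ w (r + 1) ∈ (S.graph J).edgeSet (e r) := by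
  rcases h r with ⟨h1, h2⟩ | ⟨h1, h2⟩ <;> rw [h1, h2]
  · exact ⟨S.src_mem _, S.tgt_mem _⟩
  · exact ⟨S.tgt_mem _, S.src_mem _⟩

theorem hgt_runs (h : EdgePath.Runs S.src S.tgt w e) (r : ℕ) :
    S.hgt J (w r) = S.intHgt (w r) * mesh m J := by
  rcases h r with ⟨h1, -⟩ | ⟨h1, -⟩ <;> rw [h1]
  · exact S.hgt_src_eq _
  · exact S.hgt_tgt_eq _

/-- The limit points above the points of a walk. -/
noncomputable def walkPoint (w : ℕ → S.Space J) (r : ℕ) : S.Limit :=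
  (S.exists_limit_coord_eq J (w r)).choose

theorem walkPoint_coord (w : ℕ → S.Space J) (r : ℕ) : (S.walkPoint w r).coord J = w r :=
  (S.exists_limit_coord_eq J (w r)).choose_spec

/-- The edges below the edges of a walk. -/
noncomputable def walkEdge (e : ℕ → (S.graph J).Edge) (r : ℕ) : ∀ i, (S.graph i).Edge :=
  (S.exists_edge_thread J (e r)).choose

theorem walkEdge_self (e : ℕ → (S.graph J).Edge) (r : ℕ) : S.walkEdge e r J = e r :=
  (S.exists_edge_thread J (e r)).choose_spec.1

theorem up_walkEdge (e : ℕ → (S.graph J).Edge) (r i : ℕ) :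
    S.up (S.walkEdge e r (i + 1)) = S.walkEdge e r i :=
  (S.exists_edge_thread J (e r)).choose_spec.2 i

theorem walkPoint_mem (h : EdgePath.Runs S.src S.tgt w e) (r : ℕ) {i : ℕ} (hi : i ≤ J) :
    (S.walkPoint w r).coord i ∈ (S.graph i).edgeSet (S.walkEdge e r i) ∧
      (S.walkPoint w (r + 1)).coord i ∈ (S.graph i).edgeSet (S.walkEdge e r i) := by
  constructor <;> refine S.coord_mem_of_thread (S.up_walkEdge e r) hi ?_ <;>
    rw [S.walkPoint_coord, S.walkEdge_self]
  · exact (S.runs_mem h r).1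
  · exact (S.runs_mem h r).2

theorem hgt_walkPoint (h : EdgePath.Runs S.src S.tgt w e) (r i : ℕ) :
    S.hgt i ((S.walkPoint w r).coord i) = S.intHgt (w r) * mesh m J := by
  rw [S.hgt_coord, ← S.hgt_coord _ J, S.walkPoint_coord, S.hgt_runs h]

theorem eq_src_of_intHgt {i : ℕ} {f : (S.graph i).Edge} {x : S.Space i} (hi : i ≤ J)
    (hx : x ∈ (S.graph i).edgeSet f) {k : ℤ} (hk : S.hgt i x = k * mesh m J)
    (h : k = (m ^ (J - i) : ℕ) * S.intHgt (S.src f)) : x = S.src f := by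
  refine S.eq_of_hgt_eq hx (S.src_mem f) ?_
  rw [hk, h, S.hgt_src_eq, S.mesh_eq_pow_mul hi]; push_cast; ring

theorem eq_tgt_of_intHgt {i : ℕ} {f : (S.graph i).Edge} {x : S.Space i} (hi : i ≤ J)
    (hx : x ∈ (S.graph i).edgeSet f) {k : ℤ} (hk : S.hgt i x = k * mesh m J)
    (h : k = (m ^ (J - i) : ℕ) * (S.intHgt (S.src f) + 1)) : x = S.tgt f := by
  refine S.eq_of_hgt_eq hx (S.tgt_mem f) ?_
  rw [hk, h, S.hgt_tgt, S.hgt_src_eq, S.mesh_eq_pow_mul hi]; push_cast; ring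

/-- A walk in one of the graphs, with its projections to the preceding graphs. -/
noncomputable def towerWalk (len : ℕ) (h : EdgePath.Runs S.src S.tgt w e) : TowerWalk.{u} m J where
  Pt := S.Space
  Ed i := (S.graph i).Edge
  src := S.src
  tgt := S.tgt
  ht := S.intHgt
  pr {i} := S.proj i
  up := S.up
  len := len
  pos r i := (S.walkPoint w r).coord i
  edge := S.walkEdge e
  height r := S.intHgt (w r)
  abs_height r := by
    rcases h r with ⟨h1, h2⟩ | ⟨h1, h2⟩ <;> rw [h1, h2, S.intHgt_tgt]
    · simp
    · rw [sub_add_cancel_left]; simp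
  ht_tgt := S.intHgt_tgt
  pr_pos r i := (S.walkPoint w r).proj_coord i
  up_edge r i := S.up_walkEdge e r i
  ht_src_edge r i hi := by
    have hq : 0 < m ^ (J - i) := pow_pos S.m_pos _
    have h0 := S.mesh_pos J
    have h1 := S.hgt_mem_of_mem (S.walkPoint_mem h r hi).1
    have h2 := S.hgt_mem_of_mem (S.walkPoint_mem h r hi).2
    rw [S.hgt_walkPoint h, S.hgt_src_eq, S.mesh_eq_pow_mul hi] at h1 h2
    have h3 : |S.intHgt (w (r + 1)) - S.intHgt (w r)| = 1 := by
      rcases h r with ⟨h1, h2⟩ | ⟨h1, h2⟩ <;> rw [h1, h2, S.intHgt_tgt]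
      · simp
      · rw [sub_add_cancel_left]; simp
    set k := S.intHgt (S.src (S.walkEdge e r i))
    have key : ∀ n : ℤ, (k : ℝ) * ((m ^ (J - i) : ℕ) * mesh m J) ≤ n * mesh m J ∧
        n * mesh m J ≤ k * ((m ^ (J - i) : ℕ) * mesh m J) + (m ^ (J - i) : ℕ) * mesh m J →
        k * (m ^ (J - i) : ℕ) ≤ n ∧ n ≤ k * (m ^ (J - i) : ℕ) + (m ^ (J - i) : ℕ) := by
      rintro n ⟨h4, h5⟩
      rw [← mul_assoc] at h4 h5
      rw [← add_mul] at h5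
      exact ⟨by exact_mod_cast le_of_mul_le_mul_right h4 h0,
        by exact_mod_cast le_of_mul_le_mul_right h5 h0⟩
    have h4 := key _ h1
    have h5 := key _ h2
    symm
    rw [Int.ediv_eq_iff_of_pos (by exact_mod_cast hq)]
    rw [abs_eq one_pos.le] at h3
    constructor
    · rw [mul_comm]; exact le_min (by linarith) (by linarith)
    · rcases h3 with h3 | h3
      · rw [min_eq_left (by omega)]; nlinarith
      · rw [min_eq_right (by omega)]; nlinarith
  pos_eq_src r i hi hh :=
    S.eq_src_of_intHgt hi (S.walkPoint_mem h r hi).1 (S.hgt_walkPoint h r i) hh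
  pos_eq_tgt r i hi hh :=
    S.eq_tgt_of_intHgt hi (S.walkPoint_mem h r hi).1 (S.hgt_walkPoint h r i) hh
  pos_succ_eq_src r i hi hh :=
    S.eq_src_of_intHgt hi (S.walkPoint_mem h r hi).2 (S.hgt_walkPoint h (r + 1) i) hh
  pos_succ_eq_tgt r i hi hh :=
    S.eq_tgt_of_intHgt hi (S.walkPoint_mem h r hi).2 (S.hgt_walkPoint h (r + 1) i) hh
  -- The common point of the two steps has a height off the grid of level `i`, so it lies inside a
  -- single edge of that level.
  edge_succ r i hi hd := by
    refine S.eq_of_mem_of_not_int (S.walkPoint_mem h (r + 1) hi).1 (S.walkPoint_mem h r hi).2 ?_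
    intro n hn
    rw [S.hgt_walkPoint h, S.mesh_eq_pow_mul hi, ← mul_assoc] at hn
    have h1 := mul_right_cancel₀ (S.mesh_pos J).ne' hn
    refine hd ⟨n, ?_⟩
    rw [mul_comm]; exact_mod_cast h1
  up_eq_of_pr_eq {i} f g hfg hd := by
    refine S.eq_of_mem_of_not_int (S.proj_mem (S.src_mem f)) (hfg ▸ S.proj_mem (S.src_mem g)) ?_
    intro n hn
    change S.hgt (i + 1) (S.src f) = _ at hn
    rw [S.hgt_src_eq, S.mesh_succ i, ← mul_assoc] at hn
    have h1 := mul_right_cancel₀ (S.mesh_pos (i + 1)).ne' hn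
    refine hd ⟨n, ?_⟩
    rw [mul_comm]; exact_mod_cast h1

end Walk

theorem exists_upPath_below {i : ℕ} (n : ℕ) {x : S.Space i} {k : ℤ} (hk : n ≤ k)
    (hx : S.hgt i x = k * mesh m i) :
    ∃ l v, UpPath S.src S.tgt v l x ∧ l.length = n ∧ S.intHgt v = k - n := by
  have h0 := S.mesh_pos i
  induction n generalizing x k with
  | zero => exact ⟨[], x, rfl, rfl, by simpa using S.intHgt_eq hx⟩
  | succ n ih =>
    have hk0 : (0 : ℝ) < k := by exact_mod_cast (show (0 : ℤ) < k by omega)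
    obtain ⟨e, he, hlt⟩ := S.exists_edge_below (x := x) (by rw [hx]; positivity)
    have hxe := S.eq_tgt_of_int he ⟨k, hx⟩ hlt
    obtain ⟨l, v, hl, hlen, hv⟩ := ih (x := S.src e) (k := k - 1) (by omega) (by
      have := S.hgt_tgt e
      rw [← hxe] at this; push_cast; linarith)
    refine ⟨l ++ [e], v, hl.append ?_, by simp [hlen], by push_cast; omega⟩
    rw [hxe]; exact UpPath.singleton e

/-- A connected finite set `H` of edges of the `J`-th graph is covered by a walk with about
`2 * H.card` steps, starting at a vertex of the `i`-th graph. -/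
theorem exists_covering_walk (i : ℕ) {J : ℕ} {H : Finset (S.graph J).Edge}
    (hH : H.Nonempty)
    (hconn : ∀ A ⊂ H, A.Nonempty → ∃ a ∈ A, ∃ b ∈ H, b ∉ A ∧ ∃ w, (w = S.src a ∨ w = S.tgt a) ∧
      (w = S.src b ∨ w = S.tgt b)) :
    ∃ (N : ℕ) (w : ℕ → S.Space J) (e : ℕ → (S.graph J).Edge), EdgePath.Runs S.src S.tgt w e ∧
      N ≤ 2 * H.card + m ^ (J - i) ∧ ((m ^ (J - i) : ℕ) : ℤ) ∣ S.intHgt (w 0) ∧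
      ∀ f ∈ H, ∃ r < N, e r = f := by
  obtain ⟨e₀, he₀⟩ := hH
  obtain ⟨l, hl, hlen, hmem⟩ := EdgePath.exists_closed he₀ (Or.inl rfl) hconn
  have hq : 0 < m ^ (J - i) := pow_pos S.m_pos _
  obtain ⟨k, -, hk⟩ := S.exists_nat_hgt_src e₀
  -- A preliminary ascent of fewer than `m ^ (J - i)` steps moves the start down to the grid of
  -- level `i`.
  obtain ⟨l', v, hl', hlen', hv⟩ := S.exists_upPath_below (x := S.src e₀) (k := k)
    (k % m ^ (J - i)) (by exact_mod_cast Nat.mod_le _ _) (by exact_mod_cast hk)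
  obtain ⟨w, e, h1, h2, h3⟩ := (hl'.edgePath.append hl).exists_runs ⟨e₀, Or.inl rfl⟩
  refine ⟨(l' ++ l).length, w, e, h1, ?_, ?_, fun f hf => h3 f (by simp [hmem f hf])⟩
  · rw [List.length_append, hlen, hlen']
    have := Nat.mod_lt k hq
    omega
  · rw [h2, hv]
    refine ⟨(k / m ^ (J - i) : ℕ), ?_⟩
    have := Nat.div_add_mod k (m ^ (J - i))
    have h4 : (k : ℤ) = ((m ^ (J - i) * (k / m ^ (J - i)) + k % m ^ (J - i) : ℕ) : ℤ) := by
      rw [this]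
    rw [Nat.cast_add, Nat.cast_mul] at h4
    omega

end AdmissibleSystem

/-! ### The length of a continuum and the edges that it meets -/

/-- A finite family of sets with bounded overlap, each of measure at least `h`. -/
theorem card_mul_le_of_overlap {X ι : Type*} [MeasurableSpace X] (μ : Measure X) {F : Finset ι}
    {U : ι → Set X} (hU : ∀ e ∈ F, MeasurableSet (U e)) {h : ℝ≥0∞} (hh : ∀ e ∈ F, h ≤ μ (U e))
    {K : ℕ} (hK : ∀ x, {e | e ∈ F ∧ x ∈ U e}.ncard ≤ K) : F.card * h ≤ K * μ univ := by
  classical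
  calc F.card * h = ∑ e ∈ F, h := by simp
    _ ≤ ∑ e ∈ F, μ (U e) := Finset.sum_le_sum hh
    _ = ∑ e ∈ F, ∫⁻ x, (U e).indicator 1 x ∂μ :=
        Finset.sum_congr rfl fun e he => (lintegral_indicator_one (hU e he)).symm
    _ = ∫⁻ x, ∑ e ∈ F, (U e).indicator 1 x ∂μ :=
        (lintegral_finsetSum' F fun e he => (measurable_one.indicator (hU e he)).aemeasurable).symm
    _ ≤ ∫⁻ _, K ∂μ := by
        refine lintegral_mono fun x => ?_
        have h1 : ∑ e ∈ F, (U e).indicator (1 : X → ℝ≥0∞) x = (F.filter fun e => x ∈ U e).card := by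
          simp [Set.indicator_apply]
        rw [h1]
        have h2 := hK x
        rw [show {e | e ∈ F ∧ x ∈ U e} = ↑(F.filter fun e => x ∈ U e) by ext; simp,
          Set.ncard_coe_finset] at h2
        exact Nat.cast_le.2 h2
    _ = K * μ univ := by simp

/-- A connected set that contains a point of `{g = 0}` and a point of `{r ≤ g}`, where `g` is
`1`-Lipschitz, meets `{|g| < r}` in a set of length at least `r`. -/
theorem ofReal_le_hausdorffMeasure {X : Type*} [EMetricSpace X] [MeasurableSpace X] [BorelSpace X]
    {Γ : Set X} (hΓ : IsPreconnected Γ) {g : X → ℝ} (hg : LipschitzWith 1 g) {x z : X} (hx : x ∈ Γ)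
    (hz : z ∈ Γ) (hgx : g x = 0) {r : ℝ} (hgz : r ≤ g z) :
    ENNReal.ofReal r ≤ Measure.hausdorffMeasure 1 (g ⁻¹' Iio r ∩ Γ) := by
  have h1 : Ico 0 r ⊆ g '' (g ⁻¹' Iio r ∩ Γ) := by
    intro t ht
    have h2 := (hΓ.image g hg.continuous.continuousOn).ordConnected.out ⟨x, hx, hgx⟩ ⟨z, hz, rfl⟩
    obtain ⟨y, hy, rfl⟩ := h2 ⟨ht.1, ht.2.le.trans hgz⟩
    exact ⟨y, ⟨ht.2, hy⟩, rfl⟩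
  calc ENNReal.ofReal r = volume (Ico 0 r) := by simp
    _ ≤ volume (g '' (g ⁻¹' Iio r ∩ Γ)) := measure_mono h1
    _ = Measure.hausdorffMeasure 1 (g '' (g ⁻¹' Iio r ∩ Γ)) := by rw [hausdorffMeasure_real]
    _ ≤ _ := by
        simpa using (hg.lipschitzOnWith (s := g ⁻¹' Iio r ∩ Γ)).hausdorffMeasure_image_le
          (d := 1) zero_le_one

namespace GraphData.IsMetricGraph

theorem isClosed_edgeSet {X : Type u} [MetricSpace X] {G : GraphData X} (hG : G.IsMetricGraph)
    (e : G.Edge) : IsClosed (G.edgeSet e) := by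
  refine (isCompact_Icc.image_of_continuousOn ?_).isClosed
  refine LipschitzOnWith.continuousOn (K := 1) (LipschitzOnWith.of_dist_le_mul fun s hs t ht => ?_)
  rw [hG.dist_edge e s hs t ht, Real.dist_eq]
  simp

end GraphData.IsMetricGraph

namespace AdmissibleSystem

variable {m : ℕ} {η Δ : ℝ} (S : AdmissibleSystem.{u} m η Δ)

theorem lipschitzWith_coord (j : ℕ) : LipschitzWith 1 fun v : S.Limit => v.coord j := by
  intro v w
  rw [ENNReal.coe_one, one_mul]
  exact le_iSup (fun i => edist (v.coord i) (w.coord i)) j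

theorem lipschitzWith_dist_coord (j : ℕ) (x : S.Space j) :
    LipschitzWith 1 fun v : S.Limit => dist (v.coord j) x := by
  have := (LipschitzWith.dist_left x).comp (S.lipschitzWith_coord j)
  rwa [one_mul] at this

/-- The edges of the `j`-th graph that meet the projection of `Γ`. -/
def edgesMeeting (Γ : Set S.Limit) (j : ℕ) : Set (S.graph j).Edge :=
  {e | ∃ v ∈ Γ, v.coord j ∈ (S.graph j).edgeSet e}

variable {S}

/-- Otherwise any two points of `Γ` are less than `2 * mesh m j` apart in the `j`-th coordinate, and
passing to the limit adds at most `2 * η * mesh m j`. -/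
theorem exists_le_dist_coord (hm : 2 ≤ m) (hη : 0 ≤ η) {Γ : Set S.Limit} {j : ℕ}
    (hd : ENNReal.ofReal ((2 + 2 * η) * mesh m j) < Metric.ediam Γ) (x : S.Limit) :
    ∃ z ∈ Γ, mesh m j ≤ dist (z.coord j) (x.coord j) := by
  by_contra! h
  refine absurd hd (not_lt.2 (Metric.ediam_le fun v hv w hw => ?_))
  refine (S.edist_le_of_dist_coord hm hη v w j).trans (ENNReal.ofReal_le_ofReal ?_)
  have h1 := h v hv
  have h2 := h w hw
  have := dist_triangle_right (v.coord j) (w.coord j) (x.coord j)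
  linarith

theorem mesh_le_hausdorffMeasure (hm : 2 ≤ m) (hη : 0 ≤ η) {Γ : Set S.Limit}
    (hΓ : IsConnected Γ) {j : ℕ}
    (hd : ENNReal.ofReal ((2 + 2 * η) * mesh m j) < Metric.ediam Γ) {x : S.Limit} (hx : x ∈ Γ) :
    ENNReal.ofReal (mesh m j) ≤ Measure.hausdorffMeasure 1
      ((fun v : S.Limit => dist (v.coord j) (x.coord j)) ⁻¹' Iio (mesh m j) ∩ Γ) := by
  obtain ⟨z, hz, hzx⟩ := exists_le_dist_coord hm hη hd x
  exact ofReal_le_hausdorffMeasure hΓ.isPreconnected (S.lipschitzWith_dist_coord j _) hx hz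
    (dist_self _) hzx

/-- A bound for the number of edges of a graph of valence at most `Δ` within `R` edge lengths of a
given point. -/
noncomputable def edgeBound (Δ : ℝ) (R : ℕ) : ℕ :=
  (⌈Δ⌉₊ + 1) * (2 * (⌈Δ⌉₊ + 1) + 1) ^ (R + 2)

theorem ncard_edges_dist_le {i : ℕ} (x : S.Space i) (R : ℕ) :
    {e | ∃ z ∈ (S.graph i).edgeSet e, dist x z ≤ R * mesh m i}.Finite ∧
    {e | ∃ z ∈ (S.graph i).edgeSet e, dist x z ≤ R * mesh m i}.ncard ≤ edgeBound Δ R := by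
  have := (S.isMetricGraph i).ncard_edges_dist_le (S.valence_le i) x R
  rwa [S.edgeLength_eq_mesh] at this

/-- Around a point of `Γ` over each edge, the set of points within one edge length in the `j`-th
coordinate contains a piece of `Γ` of at least that length. Bounded valence bounds the overlap of
these sets. -/
theorem card_edgesMeeting_le (hm : 2 ≤ m) (hη : 0 ≤ η) {Γ : Set S.Limit}
    (hΓ : IsConnected Γ) {j : ℕ}
    (hd : ENNReal.ofReal ((2 + 2 * η) * mesh m j) < Metric.ediam Γ)
    {F : Finset (S.graph j).Edge} (hF : ∀ e ∈ F, e ∈ S.edgesMeeting Γ j) :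
    F.card * ENNReal.ofReal (mesh m j) ≤ edgeBound Δ 1 * Measure.hausdorffMeasure 1 Γ := by
  classical
  have hF' : ∀ e : (S.graph j).Edge, ∃ v : S.Limit,
      e ∈ F → v ∈ Γ ∧ v.coord j ∈ (S.graph j).edgeSet e := by
    intro e
    by_cases he : e ∈ F
    · obtain ⟨v, h⟩ := hF e he
      exact ⟨v, fun _ => h⟩
    · obtain ⟨v, -⟩ := hΓ.nonempty
      exact ⟨v, fun h => absurd h he⟩
  choose v hv using hF'
  set U : (S.graph j).Edge → Set S.Limit := fun e =>
    (fun w : S.Limit => dist (w.coord j) ((v e).coord j)) ⁻¹' Iio (mesh m j) with hU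
  have hUo : ∀ e, MeasurableSet (U e) := fun e =>
    (isOpen_Iio.preimage (S.lipschitzWith_dist_coord j _).continuous).measurableSet
  have := card_mul_le_of_overlap ((Measure.hausdorffMeasure 1).restrict Γ) (F := F) (U := U)
    (fun e _ => hUo e) (h := ENNReal.ofReal (mesh m j)) (fun e he => by
      rw [Measure.restrict_apply (hUo e)]
      exact mesh_le_hausdorffMeasure hm hη hΓ hd (hv e he).1) (K := edgeBound Δ 1) (fun x => by
      obtain ⟨h1, h2⟩ := ncard_edges_dist_le (x.coord j) 1
      refine (Set.ncard_le_ncard ?_ h1).trans h2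
      rintro e ⟨he, hxe⟩
      refine ⟨_, (hv e he).2, ?_⟩
      simpa using (show dist (x.coord j) ((v e).coord j) < mesh m j from hxe).le)
  simpa using this

theorem exists_finset_edgesMeeting (hm : 2 ≤ m) (hη : 0 ≤ η) {Γ : Set S.Limit}
    (hΓ : IsConnected Γ) (hfin : Measure.hausdorffMeasure 1 Γ ≠ ∞) {j : ℕ}
    (hd : ENNReal.ofReal ((2 + 2 * η) * mesh m j) < Metric.ediam Γ) :
    ∃ H : Finset (S.graph j).Edge, (∀ e, e ∈ H ↔ e ∈ S.edgesMeeting Γ j) ∧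
      H.card * ENNReal.ofReal (mesh m j) ≤ edgeBound Δ 1 * Measure.hausdorffMeasure 1 Γ := by
  have hf : (S.edgesMeeting Γ j).Finite := by
    by_contra hinf
    have h0 : ENNReal.ofReal (mesh m j) ≠ 0 := by simpa using S.mesh_pos j
    have hB : edgeBound Δ 1 * Measure.hausdorffMeasure 1 Γ ≠ ∞ :=
      ENNReal.mul_ne_top (by simp) hfin
    obtain ⟨n, hn⟩ := ENNReal.exists_nat_mul_gt h0 hB
    obtain ⟨F, hF, hFc⟩ := (show (S.edgesMeeting Γ j).Infinite from hinf).exists_subset_card_eq n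
    have := card_edgesMeeting_le hm hη hΓ hd (F := F) fun e he => hF he
    rw [hFc] at this
    exact absurd hn (not_lt.2 this)
  refine ⟨hf.toFinset, by simp, card_edgesMeeting_le hm hη hΓ hd (by simp)⟩

/-- The edges in `A` and those in its complement form two closed sets that cover the connected
projection of `Γ`, so they have a common point in it. A point common to two different edges is a
vertex. -/
theorem edgesMeeting_connected {Γ : Set S.Limit} (hΓ : IsConnected Γ) {j : ℕ}
    {H : Finset (S.graph j).Edge} (hH : ∀ e, e ∈ H ↔ e ∈ S.edgesMeeting Γ j)
    {A : Finset (S.graph j).Edge} (hA : A ⊂ H) (hne : A.Nonempty) :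
    ∃ a ∈ A, ∃ b ∈ H, b ∉ A ∧ ∃ w, (w = S.src a ∨ w = S.tgt a) ∧
      (w = S.src b ∨ w = S.tgt b) := by
  classical
  have hcl : ∀ F : Finset (S.graph j).Edge, IsClosed (⋃ e ∈ F, (S.graph j).edgeSet e) := fun F =>
    F.finite_toSet.isClosed_biUnion fun e _ => (S.isMetricGraph j).isClosed_edgeSet e
  have hc := hΓ.isPreconnected.image _ (S.lipschitzWith_coord j).continuous.continuousOn
  rw [isPreconnected_closed_iff] at hc
  obtain ⟨a₀, ha₀⟩ := hne
  obtain ⟨b₀, hb₀, hb₀A⟩ := Finset.exists_of_ssubset hA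
  obtain ⟨va, hva, hva'⟩ := (hH a₀).1 (hA.1 ha₀)
  obtain ⟨vb, hvb, hvb'⟩ := (hH b₀).1 hb₀
  obtain ⟨x, -, hx1, hx2⟩ := hc _ _ (hcl A) (hcl (H \ A)) (by
      rintro _ ⟨v, hv, rfl⟩
      obtain ⟨e, he⟩ := S.exists_edge (v.coord j)
      have heH := (hH e).2 ⟨v, hv, he⟩
      by_cases h : e ∈ A
      · exact Or.inl (mem_biUnion (x := e) h he)
      · exact Or.inr (mem_biUnion (x := e) (by simp [heH, h]) he))
    ⟨_, ⟨va, hva, rfl⟩, mem_biUnion (x := a₀) ha₀ hva'⟩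
    ⟨_, ⟨vb, hvb, rfl⟩, mem_biUnion (x := b₀) (by simp [hb₀, hb₀A]) hvb'⟩
  simp only [mem_iUnion, Finset.mem_sdiff, exists_prop] at hx1 hx2
  obtain ⟨a, ha, hxa⟩ := hx1
  obtain ⟨b, ⟨hb, hbA⟩, hxb⟩ := hx2
  have hv : x ∈ (S.graph j).vertices :=
    (S.isMetricGraph j).inter_subset a b (fun h => hbA (h ▸ ha)) ⟨hxa, hxb⟩
  exact ⟨a, ha, b, hb, hbA, x, (S.mem_vertices_iff hxa).1 hv, (S.mem_vertices_iff hxb).1 hv⟩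

end AdmissibleSystem

/-! ### Beta numbers of single balls -/

namespace AdmissibleSystem

variable {m : ℕ} {η Δ : ℝ} (S : AdmissibleSystem.{u} m η Δ)

theorem exists_mesh_lt (hm : 2 ≤ m) {ε : ℝ} (hε : 0 < ε) : ∃ j, mesh m j < ε := by
  have hm' : (2 : ℝ) ≤ m := by exact_mod_cast hm
  obtain ⟨j, hj⟩ := exists_pow_lt_of_lt_one hε (show ((m : ℝ)⁻¹) < 1 from
    inv_lt_one_of_one_lt₀ (by linarith))
  exact ⟨j, by rwa [mesh, ← inv_pow]⟩

theorem mesh_anti (hm : 2 ≤ m) : Antitone (mesh m) := by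
  have hm' : (1 : ℝ) ≤ m := by exact_mod_cast (by omega : 1 ≤ m)
  intro i j hij
  exact inv_anti₀ (by positivity) (pow_le_pow_right₀ hm' hij)

theorem mesh_add (m i j : ℕ) : mesh m (i + j) = mesh m i * mesh m j := by
  rw [mesh, mesh, mesh, pow_add, mul_inv]

theorem exists_monotoneGeodesic_coord_eq (v : S.Limit) (j : ℕ) :
    ∃ L, S.IsMonotoneGeodesic L ∧ ∃ w ∈ L, w.coord j = v.coord j := by
  obtain ⟨e, he⟩ := S.exists_edge (v.coord j)
  obtain ⟨L, hL, h⟩ := S.exists_monotoneGeodesic (UpPath.singleton (src := S.src) (tgt := S.tgt) e)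
  exact ⟨L, hL, h e (by simp) _ he⟩

theorem edist_le_of_coord_eq (hm : 2 ≤ m) (hη : 0 ≤ η) {v w : S.Limit} {j : ℕ}
    (h : w.coord j = v.coord j) : edist v w ≤ ENNReal.ofReal (2 * η * mesh m j) := by
  refine (S.edist_le_of_dist_coord hm hη v w j).trans_eq ?_
  rw [h, dist_self, zero_add]

theorem exists_hgt_eq {L : Set S.Limit} (hL : S.IsMonotoneGeodesic L) {t : ℝ}
    (ht : t ∈ Icc (0 : ℝ) 1) : ∃ w ∈ L, S.hgt 0 (w.coord 0) = t := by
  obtain ⟨w, hw, h⟩ := hL.2.symm ▸ mem_univ (S.isometric_unitInterval.some.symm ⟨t, ht⟩)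
  refine ⟨w, hw, ?_⟩
  rw [show w.coord 0 = _ from h]
  exact congrArg Subtype.val (S.isometric_unitInterval.some.apply_symm_apply ⟨t, ht⟩)

/-- Some monotone geodesic passes within a quarter of the mesh of the center. Its nearby point and
the point a quarter of the mesh higher or lower both belong to the ball. -/
theorem le_ediam_adicBall (hm : 2 ≤ m) (hη : 0 ≤ η) {A : ℕ} (hA : 0 < A) (i : ℕ) (p : S.Limit) :
    ENNReal.ofReal (mesh m i / 4) ≤ Metric.ediam (S.adicBall A i p) := by
  have h0 := S.mesh_pos i
  have h1 : mesh m i ≤ 1 := by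
    have := mesh_anti hm (Nat.zero_le i)
    simpa [mesh] using this
  obtain ⟨j, hj⟩ := exists_mesh_lt hm (show 0 < mesh m i / (8 * (η + 1)) by positivity)
  have hj' : 2 * η * mesh m j ≤ mesh m i / 4 := by
    rw [lt_div_iff₀ (by positivity)] at hj
    nlinarith [S.mesh_pos j]
  obtain ⟨L, hL, w, hw, hwj⟩ := S.exists_monotoneGeodesic_coord_eq p j
  have hpw := (S.edist_le_of_coord_eq hm hη hwj).trans (ENNReal.ofReal_le_ofReal hj')
  have ht := S.hgt_mem 0 (w.coord 0)
  obtain ⟨t, htI, htd⟩ : ∃ t ∈ Icc (0 : ℝ) 1, |S.hgt 0 (w.coord 0) - t| = mesh m i / 4 := by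
    rcases le_total (S.hgt 0 (w.coord 0)) (1 / 2) with h | h
    · refine ⟨S.hgt 0 (w.coord 0) + mesh m i / 4, ⟨by linarith [ht.1], by linarith⟩, ?_⟩
      rw [sub_add_cancel_left, abs_neg, abs_of_pos (by linarith)]
    · refine ⟨S.hgt 0 (w.coord 0) - mesh m i / 4, ⟨by linarith, by linarith [ht.2]⟩, ?_⟩
      rw [sub_sub_cancel, abs_of_pos (by linarith)]
  obtain ⟨w', hw', rfl⟩ := S.exists_hgt_eq hL htI
  have hww : edist w w' = ENNReal.ofReal (mesh m i / 4) := by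
    rw [← hL.1 w hw w' hw', edist_dist, ← S.abs_hgt_sub_zero, htd]
  have hlt : ENNReal.ofReal (mesh m i / 4 + mesh m i / 4) < ENNReal.ofReal (A * mesh m i) := by
    refine (ENNReal.ofReal_lt_ofReal_iff (by positivity)).2 ?_
    have : (1 : ℝ) ≤ A := by exact_mod_cast hA
    nlinarith
  rw [ENNReal.ofReal_add (by linarith) (by linarith)] at hlt
  rw [← hww]
  refine Metric.edist_le_ediam_of_mem ?_ ?_
  · rw [adicBall, Metric.mem_eball, edist_comm]
    exact (hpw.trans le_self_add).trans_lt hlt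
  · rw [adicBall, Metric.mem_eball, edist_comm]
    refine ((edist_triangle p w w').trans ?_).trans_lt hlt
    rw [hww]; exact add_le_add_left hpw _

theorem ediam_adicBall_le (A i : ℕ) (p : S.Limit) :
    Metric.ediam (S.adicBall A i p) ≤ ENNReal.ofReal (2 * A * mesh m i) := by
  refine Metric.ediam_eball_le.trans_eq ?_
  rw [mul_assoc, ENNReal.ofReal_mul two_pos.le]
  simp [mesh]

/-- The distance of `E ∩ B` to the best monotone geodesic. -/
noncomputable def deviation (E B : Set S.Limit) : ℝ≥0∞ :=
  ⨅ (L : Set S.Limit) (_ : S.IsMonotoneGeodesic L), ⨆ x ∈ E ∩ B, Metric.infEDist x L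

theorem deviation_le {E B L : Set S.Limit} (hL : S.IsMonotoneGeodesic L) {r : ℝ≥0∞}
    (h : ∀ x ∈ E ∩ B, Metric.infEDist x L ≤ r) : S.deviation E B ≤ r :=
  (iInf₂_le L hL).trans (iSup₂_le h)

theorem beta_le (hm : 2 ≤ m) (hη : 0 ≤ η) {A : ℕ} (hA : 0 < A) {i : ℕ} {p : S.Limit}
    {E : Set S.Limit} {a : ℝ}
    (h : S.deviation E (S.adicBall A i p) ≤ ENNReal.ofReal (a * mesh m i)) :
    S.beta E (S.adicBall A i p) ≤ ENNReal.ofReal (4 * a) := by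
  have h0 := S.mesh_pos i
  calc S.beta E (S.adicBall A i p)
      ≤ ENNReal.ofReal (a * mesh m i) / ENNReal.ofReal (mesh m i / 4) :=
        ENNReal.div_le_div h (S.le_ediam_adicBall hm hη hA i p)
    _ = ENNReal.ofReal (a * mesh m i / (mesh m i / 4)) :=
        (ENNReal.ofReal_div_of_pos (by positivity)).symm
    _ = ENNReal.ofReal (4 * a) := by congr 1; field_simp

/-- Monotone geodesics pass arbitrarily close to any given point; the error shrinks with `j`. -/
theorem deviation_le_of_edist_le (hm : 2 ≤ m) (hη : 0 ≤ η) {E B : Set S.Limit} (x₀ : S.Limit)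
    {r : ℝ≥0∞} (h : ∀ x ∈ E ∩ B, edist x x₀ ≤ r) (j : ℕ) :
    S.deviation E B ≤ r + ENNReal.ofReal (2 * η * mesh m j) := by
  obtain ⟨L, hL, w, hw, hwj⟩ := S.exists_monotoneGeodesic_coord_eq x₀ j
  refine S.deviation_le hL fun x hx => (Metric.infEDist_le_edist_of_mem hw).trans ?_
  exact (edist_triangle x x₀ w).trans (add_le_add (h x hx) (S.edist_le_of_coord_eq hm hη hwj))

section Walk

variable {S}
variable {J : ℕ} {w : ℕ → S.Space J} {e : ℕ → (S.graph J).Edge}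

theorem vert_mem_edgeSet_walkEdge (h : EdgePath.Runs S.src S.tgt w e) (len : ℕ) {j r : ℕ} (hj : j ≤ J)
    (h0 : ((m ^ (J - j) : ℕ) : ℤ) ∣ S.intHgt (w 0)) :
    ((S.towerWalk len h).vert j r : S.Space j) ∈ (S.graph j).edgeSet (S.walkEdge e r j) := by
  rcases (S.towerWalk len h).vert_cases S.m_pos hj h0 r with h1 | h1
  · rw [h1.2]; exact S.src_mem (S.walkEdge e r j)
  · rw [h1.2]; exact S.tgt_mem (S.walkEdge e r j)

theorem dist_le_mesh {i : ℕ} {f : (S.graph i).Edge} {x y : S.Space i}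
    (hx : x ∈ (S.graph i).edgeSet f) (hy : y ∈ (S.graph i).edgeSet f) : dist x y ≤ mesh m i := by
  rw [← S.abs_hgt_sub hx hy, abs_le]
  have h1 := S.hgt_mem_of_mem hx
  have h2 := S.hgt_mem_of_mem hy
  constructor <;> linarith

theorem exists_visited_near (h : EdgePath.Runs S.src S.tgt w e) (len : ℕ) {a : ℕ}
    (ha : a ≤ J) (h0 : ((m ^ (J - a) : ℕ) : ℤ) ∣ S.intHgt (w 0)) {x : S.Limit} {r : ℕ}
    (hr : r < len) (hx : x.coord J ∈ (S.graph J).edgeSet (e r)) :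
    ∃ v : S.Space a, v ∈ (S.towerWalk len h).visited a ∧ dist v (x.coord a) ≤ mesh m a := by
  refine ⟨_, (S.towerWalk len h).vert_mem_visited (i := a) hr.le,
    dist_le_mesh (vert_mem_edgeSet_walkEdge h len ha h0) ?_⟩
  exact S.coord_mem_of_thread (S.up_walkEdge e r) ha (by rwa [S.walkEdge_self])

/-- If there are no bad vertices near a set of points covered by the walk, then that set is close
to a monotone geodesic. -/
theorem exists_monotoneGeodesic_of_bad (hm : 2 ≤ m) (hη : 0 ≤ η)
    (h : EdgePath.Runs S.src S.tgt w e) (len : ℕ) {a j : ℕ} (haj : a ≤ j) (hj : j ≤ J)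
    (h0 : ((m ^ (J - a) : ℕ) : ℤ) ∣ S.intHgt (w 0)) {T : Set S.Limit} {p : S.Space a}
    (hcov : ∀ x ∈ T, ∃ r < len, x.coord J ∈ (S.graph J).edgeSet (e r))
    (hT : ∀ x ∈ T, dist (x.coord a) p < mesh m a)
    (hTT : ∀ x ∈ T, ∀ y ∈ T, dist (x.coord a) (y.coord a) + 2 * mesh m j < mesh m a)
    (hbad : ∀ v : S.Space a, v ∈ (S.towerWalk len h).bad a j → 3 * mesh m a < dist v p) :
    ∃ L, S.IsMonotoneGeodesic L ∧
      ∀ x ∈ T, Metric.infEDist x L ≤ ENNReal.ofReal ((1 + 2 * η) * mesh m j) := by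
  have ha := haj.trans hj
  have hm0 := S.m_pos
  have h0j : ((m ^ (J - j) : ℕ) : ℤ) ∣ S.intHgt (w 0) := TowerWalk.dvd_height_of_le haj h0
  set W := S.towerWalk len h with hW
  -- Every point of `T` is close to a crossed edge of level `j` over a crossed edge `f` of level
  -- `a`. It remains to show that all these edges of level `j` lie on one upward path.
  have key : ∀ x ∈ T, ∃ f : (S.graph a).Edge, f ∈ W.crossed a ∧ ∃ t ∈ W.crossings j,
      W.edge t a = f ∧ ∃ q : S.Limit, q.coord a ∈ (S.graph a).edgeSet f ∧
        q.coord j ∈ (S.graph j).edgeSet (S.walkEdge e t j) ∧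
          dist (q.coord j) (x.coord j) ≤ mesh m j := by
    intro x hx
    obtain ⟨r, hr, hxr⟩ := hcov x hx
    have hxe : ∀ i ≤ J, x.coord i ∈ (S.graph i).edgeSet (S.walkEdge e r i) := fun i hi =>
      S.coord_mem_of_thread (S.up_walkEdge e r) hi (by rwa [S.walkEdge_self])
    have hva := dist_le_mesh (vert_mem_edgeSet_walkEdge h len (r := r) ha h0) (hxe a ha)
    have hvj := dist_le_mesh (vert_mem_edgeSet_walkEdge h len (r := r) hj h0j) (hxe j hj)
    have hnb : W.vert a r ∉ W.bad a j := by
      intro hb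
      have h2 := (dist_triangle (α := S.Space a) (W.vert a r) (x.coord a) p).trans
        (add_le_add hva (hT x hx).le)
      exact absurd (hbad _ hb) (not_lt.2 (h2.trans (by linarith [S.mesh_pos a])))
    obtain ⟨f, hf, -, t, ht, htf, hv⟩ :=
      W.exists_crossing_of_notMem_bad hm0 haj hj h0 (show r ≤ W.len from hr.le) hnb
    have hmem : (W.vert j r : S.Space j) ∈ (S.graph j).edgeSet (S.walkEdge e t j) := by
      rcases hv with hv | hv
      · rw [hv]; exact S.src_mem (S.walkEdge e t j)
      · rw [hv]; exact S.tgt_mem (S.walkEdge e t j)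
    refine ⟨f, hf, t, ht, htf, S.walkPoint w (W.lastVisit j r), ?_, hmem, hvj⟩
    rw [← htf]
    exact S.coord_mem_of_thread (S.up_walkEdge e t) haj hmem
  have : Nonempty (S.graph a).Edge := ⟨(S.exists_edge p).choose⟩
  have : Nonempty S.Limit := ⟨(S.exists_limit_coord_eq a p).choose⟩
  choose! f hf t ht htf q hqa hqj hqd using key
  have hqa' : ∀ x ∈ T, dist ((q x).coord a) (x.coord a) ≤ mesh m j := fun x hx =>
    (S.dist_coord_mono _ _ haj).trans (hqd x hx)
  have hfin : ∀ {u v : S.Space j} {l : List (S.graph j).Edge}, UpPath S.src S.tgt u l v →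
      (∀ x ∈ T, S.walkEdge e (t x) j ∈ l) → ∃ L, S.IsMonotoneGeodesic L ∧
        ∀ x ∈ T, Metric.infEDist x L ≤ ENNReal.ofReal ((1 + 2 * η) * mesh m j) := by
    intro u v l hl hmem
    obtain ⟨L, hL, hLl⟩ := S.exists_monotoneGeodesic hl
    refine ⟨L, hL, fun x hx => ?_⟩
    obtain ⟨z, hz, hzq⟩ := hLl _ (hmem x hx) _ (hqj x hx)
    refine (Metric.infEDist_le_edist_of_mem hz).trans
      ((S.edist_le_of_dist_coord hm hη x z j).trans (ENNReal.ofReal_le_ofReal ?_))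
    rw [hzq, dist_comm]
    linarith [hqd x hx]
  rcases T.eq_empty_or_nonempty with rfl | ⟨x₀, hx₀⟩
  · obtain ⟨x⟩ := (S.isMetricGraph j).nonempty
    exact hfin (show UpPath S.src S.tgt x [] x from rfl) (by simp)
  have hmj : 2 * mesh m j < mesh m a := by simpa using hTT x₀ hx₀ x₀ hx₀
  have hend : ∀ x ∈ T, ∀ v : S.Space a, v ∈ (S.graph a).edgeSet (f x) → v ∉ W.bad a j := by
    intro x hx v hv hb
    have h1 := hbad v hb
    have h2 := dist_le_mesh hv (hqa x hx)
    have h3 := hqa' x hx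
    have h4 := hT x hx
    have h5 := dist_triangle4 v ((q x).coord a) (x.coord a) p
    linarith [S.mesh_pos a]
  have hsrc : ∀ x ∈ T, S.src (f x) ∉ W.bad a j := fun x hx => hend x hx _ (S.src_mem _)
  have htgt : ∀ x ∈ T, S.tgt (f x) ∉ W.bad a j := fun x hx => hend x hx _ (S.tgt_mem _)
  have hss : ∀ x ∈ T, ∀ y ∈ T, S.src (f x) = S.src (f y) → f x = f y := fun x hx y hy hxy =>
    W.edge_eq_of_src_eq hm0 ha h0 (hf x hx) (hf y hy) hxy (hsrc x hx)
  have htt : ∀ x ∈ T, ∀ y ∈ T, S.tgt (f x) = S.tgt (f y) → f x = f y := fun x hx y hy hxy =>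
    W.edge_eq_of_tgt_eq hm0 ha h0 (hf x hx) (hf y hy) hxy (htgt x hx)
  -- The edges of level `a` are less than one edge length apart, hence equal or adjacent. Sharing a
  -- lower end or an upper end would be a branching, so adjacent ones are consecutive.
  have hpair : ∀ x ∈ T, ∀ y ∈ T,
      f x = f y ∨ S.tgt (f x) = S.src (f y) ∨ S.tgt (f y) = S.src (f x) := by
    intro x hx y hy
    have hd : dist ((q x).coord a) ((q y).coord a) < (S.graph a).edgeLength := by
      rw [S.edgeLength_eq_mesh]
      have h1 := dist_triangle4 ((q x).coord a) (x.coord a) (y.coord a) ((q y).coord a)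
      have h2 := hqa' x hx
      have h3 := hqa' y hy
      rw [dist_comm] at h3
      linarith [hTT x hx y hy]
    by_cases hxy : f x = f y
    · exact Or.inl hxy
    obtain ⟨v, hv, hvx, hvy⟩ :=
      (S.isMetricGraph a).exists_mem_of_dist_lt (hqa x hx) (hqa y hy) hd
    rcases (S.mem_vertices_iff hvx).1 hv with h1 | h1 <;>
      rcases (S.mem_vertices_iff hvy).1 hv with h2 | h2
    · exact absurd (hss x hx y hy (h1.symm.trans h2)) hxy
    · exact Or.inr (Or.inr (h2.symm.trans h1))
    · exact Or.inr (Or.inl (h1.symm.trans h2))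
    · exact absurd (htt x hx y hy (h1.symm.trans h2)) hxy
  by_cases hall : ∀ x ∈ T, f x = f x₀
  · obtain ⟨u, l, v, hl, hmem⟩ := W.exists_upPath_over_edge hm0 haj hj h0 (hf x₀ hx₀)
      (hsrc x₀ hx₀) (htgt x₀ hx₀)
    exact hfin hl fun x hx => hmem _ (ht x hx) ((htf x hx).trans (hall x hx))
  push Not at hall
  obtain ⟨x₁, hx₁, hne⟩ := hall
  obtain ⟨y, hy, z, hz, hyz⟩ : ∃ y ∈ T, ∃ z ∈ T, S.tgt (f y) = S.src (f z) := by
    rcases hpair x₁ hx₁ x₀ hx₀ with h1 | h1 | h1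
    · exact absurd h1 hne
    · exact ⟨x₁, hx₁, x₀, hx₀, h1⟩
    · exact ⟨x₀, hx₀, x₁, hx₁, h1⟩
  obtain ⟨u, l, v, hl, hmem⟩ := W.exists_upPath_over_edges hm0 haj hj h0 (hf y hy) (hf z hz) hyz
    (hsrc y hy) (htgt y hy) (htgt z hz)
  refine hfin hl fun x hx => hmem _ (ht x hx) ?_
  rw [htf x hx]
  have hi : ∀ {g g' : (S.graph a).Edge}, S.tgt g = S.src g' →
      S.intHgt (S.src g') = S.intHgt (S.src g) + 1 := fun {g g'} hg => by
    rw [← hg, S.intHgt_tgt]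
  -- No third edge occurs: one below `f y` would be too low to meet `f z`, and one above `f y` has
  -- the same lower end as `f z`.
  rcases hpair x hx y hy with h1 | h1 | h1
  · exact Or.inl h1
  · rcases hpair x hx z hz with h2 | h2 | h2
    · exact Or.inr h2
    · have := hi h1; have := hi h2; have := hi hyz; omega
    · have := hi h1; have := hi h2; have := hi hyz; omega
  · exact Or.inr (hss x hx z hz (h1.symm.trans hyz))

end Walk

end AdmissibleSystem

/-! ### Powers of beta numbers in terms of nearby bad vertices -/

/-- The rate at which the `p`-th powers of the mesh sizes decrease. -/
noncomputable def rate (m : ℕ) (p : ℝ) : ℝ := (m : ℝ) ^ (-p)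

theorem rate_pos {m : ℕ} (hm : 2 ≤ m) (p : ℝ) : 0 < rate m p :=
  Real.rpow_pos_of_pos (by exact_mod_cast (by omega : 0 < m)) _

theorem mesh_rpow (m n : ℕ) (p : ℝ) : mesh m n ^ p = rate m p ^ n := by
  have h : (0 : ℝ) ≤ m := Nat.cast_nonneg m
  rw [mesh, rate, ← Real.rpow_natCast, ← Real.rpow_natCast, ← Real.rpow_neg h, ← Real.rpow_mul h,
    ← Real.rpow_mul h]
  ring_nf

theorem rpow_mul_rate {m : ℕ} (hm : 2 ≤ m) (p : ℝ) : (m : ℝ) ^ p * rate m p = 1 := by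
  have h : (0 : ℝ) < m := by exact_mod_cast (by omega : 0 < m)
  rw [rate, ← Real.rpow_add h, add_neg_cancel, Real.rpow_zero]

theorem mul_rate_lt_one {m : ℕ} (hm : 2 ≤ m) {p : ℝ} (hp : 1 < p) : m * rate m p < 1 := by
  have h : (0 : ℝ) < m := by exact_mod_cast (by omega : 0 < m)
  have h1 : (1 : ℝ) < m := by exact_mod_cast (by omega : 1 < m)
  rw [rate]
  nth_rewrite 1 [← Real.rpow_one (m : ℝ)]
  rw [← Real.rpow_add h]
  exact Real.rpow_lt_one_of_one_lt_of_neg h1 (by linarith)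

theorem Finset.card_filter_exists_le {α β : Type*} (F : Finset α) (V : Finset β)
    (R : β → α → Prop) {K : ℕ} (hK : ∀ v ∈ V, {e | R v e}.Finite ∧ {e | R v e}.ncard ≤ K) :
    {e | e ∈ F ∧ ∃ v ∈ V, R v e}.ncard ≤ K * V.card := by
  classical
  have h : {e | e ∈ F ∧ ∃ v ∈ V, R v e} = ↑(V.biUnion fun v => F.filter (R v)) := by
    ext e; simp only [Set.mem_ofPred_eq, Finset.coe_biUnion, Finset.mem_coe, mem_iUnion,
      Finset.coe_filter, exists_prop]; tauto
  rw [h, Set.ncard_coe_finset, mul_comm]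
  refine Finset.card_biUnion_le_card_mul _ _ _ fun v hv => ?_
  rw [← Set.ncard_coe_finset]
  exact (Set.ncard_le_ncard (fun e he => (Finset.mem_filter.1 he).2) (hK v hv).1).trans (hK v hv).2

theorem Finset.sum_ite_exists_le {α β : Type*} (F : Finset α) (V : Finset β)
    (R : β → α → Prop) {K : ℕ} (hK : ∀ v ∈ V, {e | R v e}.Finite ∧ {e | R v e}.ncard ≤ K)
    [∀ e, Decidable (∃ v ∈ V, R v e)] :
    ∑ e ∈ F, (if ∃ v ∈ V, R v e then (1 : ℝ) else 0) ≤ K * V.card := by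
  have h := Finset.card_filter_exists_le F V R hK
  rw [show {e | e ∈ F ∧ ∃ v ∈ V, R v e} = ↑(F.filter fun e => ∃ v ∈ V, R v e) by ext; simp,
    Set.ncard_coe_finset] at h
  rw [Finset.sum_ite]
  simp only [Finset.sum_const, nsmul_eq_mul, mul_one, mul_zero, add_zero]
  exact_mod_cast h

namespace AdmissibleSystem

variable {m : ℕ} {η Δ : ℝ} (S : AdmissibleSystem.{u} m η Δ)

theorem beta_eq_zero {E B : Set S.Limit} (h : E ∩ B = ∅) : S.beta E B = 0 := by
  obtain ⟨x⟩ := (S.isMetricGraph 0).nonempty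
  obtain ⟨v, -⟩ := S.exists_limit_coord_eq 0 x
  obtain ⟨L, hL, -⟩ := S.exists_monotoneGeodesic_coord_eq v 0
  have h1 : S.deviation E B ≤ 0 := S.deviation_le hL (by simp [h])
  change S.deviation E B / _ = 0
  rw [le_antisymm h1 bot_le, ENNReal.zero_div]

theorem dist_coord_lt_of_mem_adicBall {A i : ℕ} {v x : S.Limit} (hx : x ∈ S.adicBall A i v) (a : ℕ) :
    dist (x.coord a) (v.coord a) < A * mesh m i := by
  have h : edist x v < ENNReal.ofReal (A * mesh m i) := hx
  exact (ENNReal.ofReal_lt_ofReal_iff'.1 ((S.ofReal_dist_coord_le x v a).trans_lt h)).1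

theorem midpoint_mem (i : ℕ) (e : (S.graph i).Edge) :
    (S.graph i).midpoint e ∈ (S.graph i).edgeSet e := by
  have := (S.isMetricGraph i).edgeLength_pos
  exact ⟨_, ⟨by linarith, by linarith⟩, rfl⟩

section Walk

variable {S}
variable {J : ℕ} {w : ℕ → S.Space J} {e : ℕ → (S.graph J).Edge}

/-- Level `a = i - c` is coarse enough for the ball, of diameter at most `2 * A * mesh m i`, to be
smaller than an edge, so that absence of bad vertices applies. For `n ≤ c` the claim is the trivial
bound by the radius, because `m ^ c * mesh m n` is at least `1`. -/
theorem beta_adicBall_le (hm : 2 ≤ m) (hη : 0 ≤ η) {A c : ℕ} (hA : 0 < A)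
    (hc : 2 * A + 2 ≤ m ^ c) {Γ : Set S.Limit}
    (h : EdgePath.Runs S.src S.tgt w e) (len : ℕ)
    (hcov : ∀ x ∈ Γ, ∃ r < len, x.coord J ∈ (S.graph J).edgeSet (e r))
    {a i : ℕ} (hi : i = a + c) (h0 : ((m ^ (J - a) : ℕ) : ℤ) ∣ S.intHgt (w 0)) (v : S.Limit)
    {n : ℕ} (hn : n ≤ c ∨ (a + n ≤ J ∧
      ¬ ∃ u : S.Space a, u ∈ (S.towerWalk len h).bad a (a + n) ∧
        dist u (v.coord a) ≤ 3 * mesh m a)) :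
    S.beta Γ (S.adicBall A i v) ≤
      ENNReal.ofReal (4 * (A + 1 + 2 * η) * m ^ c * mesh m n) := by
  have hp := S.mesh_mul_pow c
  have hai : mesh m a = m ^ c * mesh m i := by rw [hi, mesh_add]; linear_combination -mesh m a * hp
  have h0i := S.mesh_pos i
  have h0n := S.mesh_pos n
  have hmc : (0 : ℝ) < (m : ℝ) ^ c := by exact_mod_cast pow_pos S.m_pos c
  have hA' : (1 : ℝ) ≤ A := by exact_mod_cast hA
  by_cases hnc : n ≤ c
  · have h1 : 1 ≤ (m : ℝ) ^ c * mesh m n := by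
      rw [← hp]; exact mul_le_mul_of_nonneg_left (mesh_anti hm hnc) hmc.le
    have h2 : S.deviation Γ (S.adicBall A i v) ≤ ENNReal.ofReal ((A + 2 * η) * mesh m i) := by
      refine (S.deviation_le_of_edist_le hm hη v (r := ENNReal.ofReal (A * mesh m i))
        (fun x hx => ?_) i).trans_eq ?_
      · exact (show edist x v < ENNReal.ofReal (A * mesh m i) from hx.2).le
      · rw [← ENNReal.ofReal_add (by positivity) (by positivity)]; ring_nf
    refine (S.beta_le hm hη hA h2).trans (ENNReal.ofReal_le_ofReal ?_)
    nlinarith [mul_nonneg (show (0 : ℝ) ≤ 4 * (A + 2 * η) by positivity) (sub_nonneg.2 h1),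
      mul_pos hmc h0n]
  · obtain ⟨hnJ, hn⟩ := hn.resolve_left hnc
    have hmj : mesh m (a + n) ≤ mesh m i := mesh_anti hm (by omega)
    have hcA : (2 * A + 2 : ℝ) ≤ m ^ c := by exact_mod_cast hc
    have hle := mul_le_mul_of_nonneg_right hcA h0i.le
    rw [← hai] at hle
    obtain ⟨L, hL, hLd⟩ := exists_monotoneGeodesic_of_bad hm hη h len (Nat.le_add_right a n) hnJ h0
      (T := Γ ∩ S.adicBall A i v) (p := v.coord a) (fun x hx => hcov x hx.1)
      (fun x hx => by
        have := S.dist_coord_lt_of_mem_adicBall hx.2 a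
        nlinarith)
      (fun x hx y hy => by
        have h1 := S.dist_coord_lt_of_mem_adicBall hx.2 a
        have h2 := S.dist_coord_lt_of_mem_adicBall hy.2 a
        have := dist_triangle_right (x.coord a) (y.coord a) (v.coord a)
        nlinarith)
      (fun u hu => not_le.1 fun hle => hn ⟨u, hu, hle⟩)
    have h2 : S.deviation Γ (S.adicBall A i v) ≤
        ENNReal.ofReal (((1 + 2 * η) * m ^ c * mesh m n) * mesh m i) := by
      refine (S.deviation_le hL hLd).trans_eq ?_
      rw [mesh_add, hai]; ring_nf
    refine (S.beta_le hm hη hA h2).trans (ENNReal.ofReal_le_ofReal ?_)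
    nlinarith [mul_pos hmc h0n]

-- The beta number is of order `mesh m n` as long as no bad vertex appears up to `n`. The first one
-- that appears is charged with the bound of the preceding step. If none does, the final bound is
-- charged to a visited vertex, which exists unless the ball misses `Γ`.
open scoped Classical in
theorem beta_rpow_le (hm : 2 ≤ m) (hη : 0 ≤ η) {p : ℝ} (hp' : 0 < p) {A c : ℕ} (hA : 0 < A)
    (hc : 2 * A + 2 ≤ m ^ c) {Γ : Set S.Limit}
    (h : EdgePath.Runs S.src S.tgt w e) (len : ℕ)
    (hcov : ∀ x ∈ Γ, ∃ r < len, x.coord J ∈ (S.graph J).edgeSet (e r))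
    {a i N : ℕ} (hi : i = a + c) (hN : a + N = J)
    (h0 : ((m ^ (J - a) : ℕ) : ℤ) ∣ S.intHgt (w 0)) (v : S.Limit) :
    S.beta Γ (S.adicBall A i v) ^ p ≤
      ENNReal.ofReal ((4 * (A + 1 + 2 * η) * m ^ c) ^ p * m ^ p *
        (rate m p ^ N * (if ∃ u : S.Space a, u ∈ (S.towerWalk len h).visited a ∧
            dist u (v.coord a) ≤ 3 * mesh m a then 1 else 0) +
          ∑ n ∈ Finset.range (N + 1), rate m p ^ n *
            (if ∃ u : S.Space a, u ∈ (S.towerWalk len h).bad a (a + n) ∧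
              dist u (v.coord a) ≤ 3 * mesh m a then 1 else 0))) := by
  have hp := hp'.le
  have h0i := S.mesh_pos i
  have hmR : (2 : ℝ) ≤ m := by exact_mod_cast hm
  have hθ := rate_pos hm p
  have hmp : 1 ≤ (m : ℝ) ^ p := Real.one_le_rpow (by linarith) hp
  set C : ℝ := 4 * (A + 1 + 2 * η) * m ^ c with hC
  have hC0 : 0 ≤ C := by positivity
  have hCp : 0 ≤ C ^ p := Real.rpow_nonneg hC0 p
  have hpow : ∀ n, S.beta Γ (S.adicBall A i v) ≤ ENNReal.ofReal (C * mesh m n) →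
      S.beta Γ (S.adicBall A i v) ^ p ≤ ENNReal.ofReal (C ^ p * rate m p ^ n) := by
    intro n hn
    refine (ENNReal.rpow_le_rpow hn hp).trans_eq ?_
    rw [ENNReal.ofReal_rpow_of_nonneg (mul_nonneg hC0 (S.mesh_pos n).le) hp,
      Real.mul_rpow hC0 (S.mesh_pos n).le, mesh_rpow]
  by_cases hempty : Γ ∩ S.adicBall A i v = ∅
  · rw [S.beta_eq_zero hempty, ENNReal.zero_rpow_of_pos hp']; exact bot_le
  have hvis : ∃ u : S.Space a, u ∈ (S.towerWalk len h).visited a ∧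
      dist u (v.coord a) ≤ 3 * mesh m a := by
    obtain ⟨x, hx⟩ := nonempty_iff_ne_empty.2 hempty
    obtain ⟨r, hr, hxr⟩ := hcov x hx.1
    obtain ⟨u, hu, hux⟩ := exists_visited_near h len (by omega : a ≤ J) h0 hr hxr
    refine ⟨u, hu, ?_⟩
    have h1 := S.dist_coord_lt_of_mem_adicBall hx.2 a
    have h2 := dist_triangle u (x.coord a) (v.coord a)
    have hai : mesh m a = m ^ c * mesh m i := by
      rw [hi, mesh_add]; linear_combination -mesh m a * S.mesh_mul_pow c
    have hcA : (2 * A + 2 : ℝ) ≤ m ^ c := by exact_mod_cast hc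
    have hle := mul_le_mul_of_nonneg_right hcA h0i.le
    rw [← hai] at hle
    nlinarith
  rw [if_pos hvis, mul_one]
  set σ : ℕ → ℝ := fun n => rate m p ^ n *
    (if ∃ u : S.Space a, u ∈ (S.towerWalk len h).bad a (a + n) ∧
      dist u (v.coord a) ≤ 3 * mesh m a then 1 else 0) with hσ
  have hσ0 : ∀ n, 0 ≤ σ n := fun n => mul_nonneg (by positivity) (by split_ifs <;> norm_num)
  have hsum0 : ∀ M, 0 ≤ ∑ n ∈ Finset.range M, σ n := fun M => Finset.sum_nonneg fun n _ => hσ0 n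
  have key : ∀ M ≤ N, S.beta Γ (S.adicBall A i v) ^ p ≤
      ENNReal.ofReal (C ^ p * m ^ p * ∑ n ∈ Finset.range (M + 1), σ n) ∨
      S.beta Γ (S.adicBall A i v) ≤ ENNReal.ofReal (C * mesh m M) := by
    intro M
    induction M with
    | zero =>
      intro _
      exact Or.inr (beta_adicBall_le hm hη hA hc h len hcov hi h0 v (Or.inl (Nat.zero_le _)))
    | succ M ih =>
      intro hM
      have hnn : 0 ≤ C ^ p * m ^ p := by positivity
      rcases ih (by omega) with h1 | h1
      · refine Or.inl (h1.trans (ENNReal.ofReal_le_ofReal (mul_le_mul_of_nonneg_left ?_ hnn)))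
        rw [Finset.sum_range_succ _ (M + 1)]
        linarith [hσ0 (M + 1)]
      · by_cases hb : ∃ u : S.Space a, u ∈ (S.towerWalk len h).bad a (a + (M + 1)) ∧
            dist u (v.coord a) ≤ 3 * mesh m a
        · refine Or.inl ((hpow M h1).trans (ENNReal.ofReal_le_ofReal ?_))
          have h2 : σ (M + 1) = rate m p ^ (M + 1) := by rw [hσ]; simp only; rw [if_pos hb, mul_one]
          -- The shift from `M` to `M + 1` costs the factor `m ^ p` in the constant.
          have h3 : C ^ p * rate m p ^ M = C ^ p * m ^ p * σ (M + 1) := by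
            rw [h2, pow_succ]; linear_combination -(C ^ p * rate m p ^ M) * rpow_mul_rate hm p
          rw [h3, Finset.sum_range_succ]
          exact mul_le_mul_of_nonneg_left (by linarith [hsum0 (M + 1)]) hnn
        · exact Or.inr (beta_adicBall_le hm hη hA hc h len hcov hi h0 v
            (Or.inr ⟨by omega, hb⟩))
  have hnn : 0 ≤ C ^ p * m ^ p := by positivity
  have hθN : 0 ≤ rate m p ^ N := by positivity
  rcases key N le_rfl with h1 | h1
  · exact h1.trans (ENNReal.ofReal_le_ofReal (mul_le_mul_of_nonneg_left (by linarith) hnn))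
  · refine (hpow N h1).trans (ENNReal.ofReal_le_ofReal ?_)
    rw [mul_assoc]
    refine mul_le_mul_of_nonneg_left ?_ hCp
    nlinarith [hsum0 (N + 1)]

end Walk

end AdmissibleSystem

/-! ### Summation over the small scales -/

namespace AdmissibleSystem

variable {m : ℕ} {η Δ : ℝ} {S : AdmissibleSystem.{u} m η Δ}

theorem ncard_centers_le {ctr : ∀ n, (S.graph n).Edge → S.Limit} (hctr : S.IsCenterChoice ctr)
    {i R : ℕ} (P : (S.graph i).Edge → Prop) (x : S.Limit)
    (hP : ∀ e, P e → dist (x.coord i) ((ctr i e).coord i) ≤ R * mesh m i) :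
    {e | P e}.Finite ∧ {e | P e}.ncard ≤ edgeBound Δ R := by
  obtain ⟨h1, h2⟩ := ncard_edges_dist_le (x.coord i) R
  have hsub : {e | P e} ⊆
      {e | ∃ z ∈ (S.graph i).edgeSet e, dist (x.coord i) z ≤ R * mesh m i} := fun e he =>
    ⟨_, S.midpoint_mem i e, by rw [← hctr i e]; exact hP e he⟩
  exact ⟨h1.subset hsub, (Set.ncard_le_ncard hsub h1).trans h2⟩

theorem ncard_near_le (hm : 2 ≤ m) (hη : 0 ≤ η) {ctr : ∀ n, (S.graph n).Edge → S.Limit}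
    (hctr : S.IsCenterChoice ctr) {a c i : ℕ} (hi : i = a + c) (u : S.Space a) :
    {e | dist u ((ctr i e).coord a) ≤ 3 * mesh m a}.Finite ∧
    {e | dist u ((ctr i e).coord a) ≤ 3 * mesh m a}.ncard ≤
      edgeBound Δ ⌈(3 + 2 * η) * m ^ c⌉₊ := by
  obtain ⟨x, rfl⟩ := S.exists_limit_coord_eq a u
  refine ncard_centers_le hctr _ x fun e he => ?_
  have hai : mesh m a = m ^ c * mesh m i := by
    rw [hi, mesh_add]; linear_combination -mesh m a * S.mesh_mul_pow c
  calc dist (x.coord i) ((ctr i e).coord i) ≤ (3 + 2 * η) * mesh m a := by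
        linarith [S.dist_coord_le hm hη x (ctr i e) i a]
    _ = ((3 + 2 * η) * m ^ c) * mesh m i := by rw [hai]; ring
    _ ≤ _ := mul_le_mul_of_nonneg_right (Nat.le_ceil _) (S.mesh_pos i).le

variable (S) in
/-- The sum over all balls of a given scale. -/
noncomputable def scaleSum (p : ℝ) (A : ℕ) (ctr : ∀ n, (S.graph n).Edge → S.Limit)
    (Γ : Set S.Limit) (i : ℕ) : ℝ≥0∞ :=
  ∑' f, S.beta Γ (S.adicBall A i (ctr i f)) ^ p * Metric.ediam (S.adicBall A i (ctr i f))

section Walk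

variable {J : ℕ} {w : ℕ → S.Space J} {e : ℕ → (S.graph J).Edge}

/-- The balls of a given small scale. -/
theorem scaleSum_le (hm : 2 ≤ m) (hη : 0 ≤ η) {p : ℝ} (hp : 0 < p) {A c : ℕ} (hA : 0 < A)
    (hc : 2 * A + 2 ≤ m ^ c) {ctr : ∀ n, (S.graph n).Edge → S.Limit}
    (hctr : S.IsCenterChoice ctr) {Γ : Set S.Limit}
    (h : EdgePath.Runs S.src S.tgt w e) (len : ℕ)
    (hcov : ∀ x ∈ Γ, ∃ r < len, x.coord J ∈ (S.graph J).edgeSet (e r))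
    {a i N : ℕ} (hi : i = a + c) (hN : a + N = J)
    (h0 : ((m ^ (J - a) : ℕ) : ℤ) ∣ S.intHgt (w 0)) :
    S.scaleSum p A ctr Γ i ≤
      ENNReal.ofReal ((4 * (A + 1 + 2 * η) * m ^ c) ^ p * m ^ p * (2 * A) *
        edgeBound Δ ⌈(3 + 2 * η) * m ^ c⌉₊ *
        (mesh m a * rate m p ^ N * ((S.towerWalk len h).visited a).card +
          ∑ n ∈ Finset.range (N + 1), mesh m a * rate m p ^ n *
            ((S.towerWalk len h).bad a (a + n)).card)) := by
  classical
  have hθ := rate_pos hm p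
  have h0a := S.mesh_pos a
  have hmi : mesh m i ≤ mesh m a := mesh_anti hm (by omega)
  have hmp : 0 ≤ (m : ℝ) ^ p := Real.rpow_nonneg (Nat.cast_nonneg m) p
  set C : ℝ := (4 * (A + 1 + 2 * η) * m ^ c) ^ p * m ^ p with hC
  have hC0 : 0 ≤ C := mul_nonneg (Real.rpow_nonneg (by positivity) p) hmp
  set K := edgeBound Δ ⌈(3 + 2 * η) * m ^ c⌉₊ with hK
  set V : Finset (S.Space a) := (S.towerWalk len h).visited a with hV
  set B : ℕ → Finset (S.Space a) := fun n => (S.towerWalk len h).bad a (a + n) with hB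
  set τ : Finset (S.Space a) → (S.graph i).Edge → ℝ := fun T f =>
    @ite ℝ (∃ u ∈ T, dist u ((ctr i f).coord a) ≤ 3 * mesh m a) (Classical.propDecidable _) 1 0 with hτ
  have hτ0 : ∀ T f, 0 ≤ τ T f := fun T f => by simp only [hτ]; split_ifs <;> norm_num
  -- Each vertex is near at most `K` centers, so summing over balls the indicator of a nearby vertex
  -- of `T` gives at most `K * T.card`.
  have hτs : ∀ (F : Finset (S.graph i).Edge) T, ∑ f ∈ F, τ T f ≤ K * T.card := fun F T =>
    @Finset.sum_ite_exists_le _ _ F T (fun u f => dist u ((ctr i f).coord a) ≤ 3 * mesh m a) K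
      (fun u _ => ncard_near_le hm hη hctr hi u) fun _ => Classical.propDecidable _
  rw [scaleSum, ENNReal.tsum_eq_iSup_sum]
  refine iSup_le fun F => ?_
  have h1 : ∀ f ∈ F, S.beta Γ (S.adicBall A i (ctr i f)) ^ p *
      Metric.ediam (S.adicBall A i (ctr i f)) ≤
      ENNReal.ofReal (C * (2 * A) * (mesh m a * rate m p ^ N * τ V f +
        ∑ n ∈ Finset.range (N + 1), mesh m a * rate m p ^ n * τ (B n) f)) := by
    intro f _
    have h2 : S.beta Γ (S.adicBall A i (ctr i f)) ^ p ≤ ENNReal.ofReal (C * (rate m p ^ N * τ V f +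
        ∑ n ∈ Finset.range (N + 1), rate m p ^ n * τ (B n) f)) :=
      beta_rpow_le hm hη hp hA hc h len hcov hi hN h0 (ctr i f)
    refine (mul_le_mul' h2 (S.ediam_adicBall_le A i (ctr i f))).trans ?_
    have hnn : 0 ≤ rate m p ^ N * τ V f + ∑ n ∈ Finset.range (N + 1), rate m p ^ n * τ (B n) f :=
      add_nonneg (mul_nonneg (by positivity) (hτ0 _ _))
        (Finset.sum_nonneg fun n _ => mul_nonneg (by positivity) (hτ0 _ _))
    rw [← ENNReal.ofReal_mul' (by have := S.mesh_pos i; positivity)]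
    refine ENNReal.ofReal_le_ofReal ?_
    calc C * (rate m p ^ N * τ V f + ∑ n ∈ Finset.range (N + 1), rate m p ^ n * τ (B n) f) *
          (2 * A * mesh m i) ≤
        C * (rate m p ^ N * τ V f + ∑ n ∈ Finset.range (N + 1), rate m p ^ n * τ (B n) f) *
          (2 * A * mesh m a) := by
          refine mul_le_mul_of_nonneg_left ?_ (mul_nonneg hC0 hnn)
          exact mul_le_mul_of_nonneg_left hmi (by positivity)
      _ = _ := by
          have h3 : ∑ n ∈ Finset.range (N + 1), mesh m a * rate m p ^ n * τ (B n) f =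
              mesh m a * ∑ n ∈ Finset.range (N + 1), rate m p ^ n * τ (B n) f := by
            rw [Finset.mul_sum]; exact Finset.sum_congr rfl fun n _ => mul_assoc _ _ _
          rw [h3]; ring
  refine (Finset.sum_le_sum h1).trans ?_
  rw [← ENNReal.ofReal_sum_of_nonneg fun f _ => mul_nonneg (by positivity) (add_nonneg
    (mul_nonneg (by positivity) (hτ0 _ _))
    (Finset.sum_nonneg fun n _ => mul_nonneg (by positivity) (hτ0 _ _)))]
  refine ENNReal.ofReal_le_ofReal ?_
  rw [← Finset.mul_sum, Finset.sum_add_distrib, Finset.sum_comm, mul_assoc (C * _)]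
  refine mul_le_mul_of_nonneg_left ?_ (by positivity)
  rw [mul_add, Finset.mul_sum (a := (K : ℝ)), ← Finset.mul_sum]
  refine add_le_add ?_ (Finset.sum_le_sum fun n _ => ?_)
  · calc _ ≤ mesh m a * rate m p ^ N * (K * V.card) :=
          mul_le_mul_of_nonneg_left (hτs F V) (by positivity)
      _ = _ := mul_left_comm _ _ _
  · rw [← Finset.mul_sum]
    calc _ ≤ mesh m a * rate m p ^ n * (K * (B n).card) :=
          mul_le_mul_of_nonneg_left (hτs F (B n)) (by positivity)
      _ = _ := mul_left_comm _ _ _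

/-- The sum over the balls of finitely many small scales. -/
theorem sum_scaleSum_le (hm : 2 ≤ m) (hη : 0 ≤ η) {p : ℝ} (hp : 1 < p) {A c : ℕ} (hA : 0 < A)
    (hc : 2 * A + 2 ≤ m ^ c) {ctr : ∀ n, (S.graph n).Edge → S.Limit}
    (hctr : S.IsCenterChoice ctr) {Γ : Set S.Limit}
    (h : EdgePath.Runs S.src S.tgt w e) (len : ℕ)
    (hcov : ∀ x ∈ Γ, ∃ r < len, x.coord J ∈ (S.graph J).edgeSet (e r))
    {i₀ L : ℕ} (hJ : i₀ + L = J) (h0 : ((m ^ (J - i₀) : ℕ) : ℤ) ∣ S.intHgt (w 0)) :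
    ∑ k ∈ Finset.range (L + 1), S.scaleSum p A ctr Γ (k + (i₀ + c)) ≤
      ENNReal.ofReal ((4 * (A + 1 + 2 * η) * m ^ c) ^ p * m ^ p * (2 * A) *
        edgeBound Δ ⌈(3 + 2 * η) * m ^ c⌉₊ *
        ((1 / (1 - m * rate m p) + 42 / (1 - m * rate m p) ^ 2) *
          (mesh m J * len + mesh m i₀))) := by
  have hθ := rate_pos hm p
  have hmp : 0 ≤ (m : ℝ) ^ p := Real.rpow_nonneg (Nat.cast_nonneg m) p
  have hρ := mul_rate_lt_one hm hp
  set W := S.towerWalk len h with hW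
  set C : ℝ := (4 * (A + 1 + 2 * η) * m ^ c) ^ p * m ^ p * (2 * A) *
    edgeBound Δ ⌈(3 + 2 * η) * m ^ c⌉₊ with hC
  have hC0 : 0 ≤ C := by
    have := Real.rpow_nonneg (show (0 : ℝ) ≤ 4 * (A + 1 + 2 * η) * m ^ c by positivity) p
    positivity
  have hmesh : ∀ k, 0 < mesh m k := S.mesh_pos
  have hterm : ∀ k ∈ Finset.range (L + 1),
      S.scaleSum p A ctr Γ (k + (i₀ + c)) ≤
      ENNReal.ofReal (C * (mesh m (i₀ + k) * rate m p ^ (L - k) * (W.visited (i₀ + k)).card +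
          ∑ n ∈ Finset.range (L - k + 1), mesh m (i₀ + k) * rate m p ^ n *
            (W.bad (i₀ + k) (i₀ + k + n)).card)) := fun k hk =>
    scaleSum_le hm hη (by linarith) hA hc hctr h len hcov (by omega)
      (by have := Finset.mem_range.1 hk; omega)
      (TowerWalk.dvd_height_of_le (Nat.le_add_right _ _) h0)
  refine (Finset.sum_le_sum hterm).trans ?_
  rw [← ENNReal.ofReal_sum_of_nonneg fun k _ => mul_nonneg hC0 (add_nonneg
    (by have := hmesh (i₀ + k); positivity)
    (Finset.sum_nonneg fun n _ => by have := hmesh (i₀ + k); positivity))]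
  refine ENNReal.ofReal_le_ofReal ?_
  rw [← Finset.mul_sum]
  refine mul_le_mul_of_nonneg_left ?_ hC0
  rw [Finset.sum_add_distrib, add_mul]
  have hlen : (W.crossings J).card ≤ len := by
    refine (Finset.card_le_card (fun s hs => ?_)).trans_eq (Finset.card_range len)
    exact Finset.mem_range.2 (W.mem_crossings.1 hs).1
  have hbound : ((m : ℝ) ^ J)⁻¹ * (W.crossings J).card + ((m : ℝ) ^ i₀)⁻¹ ≤
      mesh m J * len + mesh m i₀ := by
    have : ((W.crossings J).card : ℝ) ≤ len := by exact_mod_cast hlen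
    exact add_le_add (mul_le_mul_of_nonneg_left this (hmesh J).le) le_rfl
  have h1ρ : 0 < 1 - m * rate m p := by linarith
  refine add_le_add ((W.sum_card_visited_le hm hθ hρ hJ h0).trans
    (mul_le_mul_of_nonneg_left hbound (by positivity))) ?_
  refine le_trans (le_of_eq ?_) ((W.sum_card_bad_le hm hθ hρ hJ h0).trans
    (mul_le_mul_of_nonneg_left hbound (by positivity)))
  have hinner : ∀ k ∈ Finset.range (L + 1), ∑ n ∈ Finset.range (L - k + 1),
      mesh m (i₀ + k) * rate m p ^ n * ((W.bad (i₀ + k) (i₀ + k + n)).card : ℝ) =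
      ∑ n ∈ Finset.Ico k (L + 1), ((m : ℝ) ^ (i₀ + k))⁻¹ * rate m p ^ (n - k) *
        ((W.bad (i₀ + k) (i₀ + n)).card : ℝ) := by
    intro k hk
    have hk' := Finset.mem_range.1 hk
    rw [Finset.sum_Ico_eq_sum_range, show L + 1 - k = L - k + 1 by omega]
    refine Finset.sum_congr rfl fun n _ => ?_
    rw [Nat.add_sub_cancel_left, add_assoc, mesh]
  rw [Finset.sum_congr rfl hinner]
  -- The sum over coarse levels and depths becomes a sum over the fine level first, as in
  -- `sum_card_bad_le`.
  refine Finset.sum_comm' fun k n => ?_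
  simp only [Finset.mem_range, Finset.mem_Ico]
  omega

end Walk

end AdmissibleSystem

/-! ### The initial scale and the large scales -/

namespace AdmissibleSystem

variable {m : ℕ} {η Δ : ℝ} {S : AdmissibleSystem.{u} m η Δ}

theorem ediam_le (hm : 2 ≤ m) (hη : 0 ≤ η) (Γ : Set S.Limit) :
    Metric.ediam Γ ≤ ENNReal.ofReal (1 + 2 * η) := by
  refine Metric.ediam_le fun v _ w _ => (S.edist_le_of_dist_coord hm hη v w 0).trans
    (ENNReal.ofReal_le_ofReal ?_)
  rw [← S.abs_hgt_sub_zero]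
  have h1 := S.hgt_mem 0 (v.coord 0)
  have h2 := S.hgt_mem 0 (w.coord 0)
  have h3 : |S.hgt 0 (v.coord 0) - S.hgt 0 (w.coord 0)| ≤ 1 := by
    rw [abs_le]; constructor <;> linarith [h1.1, h1.2, h2.1, h2.2]
  have h4 : mesh m 0 = 1 := by simp [mesh]
  rw [h4]; linarith

/-- The scale at which a set that is not a single point starts to be seen. -/
theorem exists_initial_scale (hm : 2 ≤ m) (hη : 0 ≤ η) {Γ : Set S.Limit}
    (h : 0 < Metric.ediam Γ) : ∃ i, ENNReal.ofReal ((3 + 2 * η) * mesh m i) ≤ Metric.ediam Γ ∧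
      Metric.ediam Γ ≤ ENNReal.ofReal ((3 + 2 * η) * m * mesh m i) := by
  classical
  have hex : ∃ i, ENNReal.ofReal ((3 + 2 * η) * mesh m i) ≤ Metric.ediam Γ := by
    obtain ⟨r, hr0, hr⟩ := ENNReal.lt_iff_exists_nnreal_btwn.1 h
    have hr0' : (0 : ℝ) < r := by exact_mod_cast hr0
    obtain ⟨i, hi⟩ := exists_mesh_lt hm (show 0 < r / (3 + 2 * η) by positivity)
    rw [lt_div_iff₀' (by positivity)] at hi
    refine ⟨i, (ENNReal.ofReal_le_ofReal hi.le).trans ?_⟩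
    rw [ENNReal.ofReal_coe_nnreal]; exact hr.le
  refine ⟨Nat.find hex, Nat.find_spec hex, ?_⟩
  rcases h0 : Nat.find hex with _ | i
  · refine (ediam_le hm hη Γ).trans (ENNReal.ofReal_le_ofReal ?_)
    have : (2 : ℝ) ≤ m := by exact_mod_cast hm
    simp only [mesh, pow_zero, inv_one, mul_one]
    nlinarith
  · have := Nat.find_min hex (m := i) (by omega)
    refine (not_le.1 this).le.trans_eq ?_
    rw [S.mesh_succ i, mul_assoc]

/-- A single point is approximated arbitrarily well by monotone geodesics, so all of its beta
numbers vanish. -/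
theorem scaleSum_eq_zero_of_ediam_eq_zero (hm : 2 ≤ m) (hη : 0 ≤ η) {p : ℝ} (hp : 0 < p)
    {A : ℕ} {ctr : ∀ n, (S.graph n).Edge → S.Limit} {Γ : Set S.Limit} (hΓ : Γ.Nonempty)
    (h : Metric.ediam Γ = 0) (i : ℕ) : S.scaleSum p A ctr Γ i = 0 := by
  obtain ⟨x, hx⟩ := hΓ
  refine ENNReal.tsum_eq_zero.2 fun f => ?_
  have h1 : S.deviation Γ (S.adicBall A i (ctr i f)) = 0 := by
    by_contra hne
    obtain ⟨r, hr0, hr⟩ := ENNReal.lt_iff_exists_nnreal_btwn.1 (pos_iff_ne_zero.2 hne)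
    have hr0' : (0 : ℝ) < r := by exact_mod_cast hr0
    obtain ⟨j, hj⟩ := exists_mesh_lt hm (show 0 < r / (2 * η + 1) by positivity)
    rw [lt_div_iff₀' (by positivity)] at hj
    have h2 := S.deviation_le_of_edist_le hm hη x (E := Γ) (B := S.adicBall A i (ctr i f)) (r := 0)
      (fun y hy => (Metric.edist_le_ediam_of_mem hy.1 hx).trans_eq h) j
    rw [zero_add] at h2
    refine absurd (hr.trans_le h2) (not_lt.2 ?_)
    rw [← ENNReal.ofReal_coe_nnreal]
    exact ENNReal.ofReal_le_ofReal (by nlinarith [S.mesh_pos j])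
  have h3 : S.beta Γ (S.adicBall A i (ctr i f)) = 0 := by
    change S.deviation Γ _ / _ = 0
    rw [h1, ENNReal.zero_div]
  rw [h3, ENNReal.zero_rpow_of_pos hp, zero_mul]

/-- The balls of a given large scale. -/
theorem scaleSum_le_of_ediam_le (hm : 2 ≤ m) (hη : 0 ≤ η) {p : ℝ} (hp : 0 < p) {A c : ℕ}
    (hA : 0 < A) {ctr : ∀ n, (S.graph n).Edge → S.Limit} (hctr : S.IsCenterChoice ctr)
    {Γ : Set S.Limit} (hΓ : Γ.Nonempty) {i₀ i s : ℕ} (hi : i + s + 1 = i₀ + c) {D : ℝ}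
    (hD : 0 ≤ D) (hdiam : Metric.ediam Γ ≤ ENNReal.ofReal (D * mesh m i₀)) :
    S.scaleSum p A ctr Γ i ≤ ENNReal.ofReal (edgeBound Δ ⌈D * m ^ c + A⌉₊ *
      ((4 * ((D + 2 * η) * m ^ c)) ^ p * (2 * A * m) * mesh m i₀) * (m * rate m p) ^ s) := by
  classical
  obtain ⟨x, hx⟩ := hΓ
  have hm0 : (0 : ℝ) < m := by exact_mod_cast S.m_pos
  have hθ := rate_pos hm p
  have h0 := S.mesh_pos i₀
  have hi0 := S.mesh_pos i
  have hs0 := S.mesh_pos s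
  have hone : ∀ k, mesh m k ≤ 1 := fun k => by
    simpa [mesh] using mesh_anti hm (Nat.zero_le k)
  have hmesh : mesh m i₀ = m ^ c * mesh m i * mesh m s * mesh m 1 := by
    have h1 : mesh m i * mesh m s * mesh m 1 = mesh m i₀ * mesh m c := by
      rw [← mesh_add, ← mesh_add, ← mesh_add, hi]
    linear_combination -(m : ℝ) ^ c * h1 - mesh m i₀ * S.mesh_mul_pow c
  have hle : mesh m i₀ ≤ m ^ c * mesh m s * mesh m i := by
    rw [hmesh]
    calc _ ≤ (m ^ c * mesh m i * mesh m s) * 1 :=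
          mul_le_mul_of_nonneg_left (hone 1) (by positivity)
      _ = _ := by ring
  have hle' : mesh m i₀ ≤ m ^ c * mesh m i := by
    refine hle.trans ?_
    calc _ = (m ^ c * mesh m i) * mesh m s := by ring
      _ ≤ (m ^ c * mesh m i) * 1 := mul_le_mul_of_nonneg_left (hone s) (by positivity)
      _ = _ := by ring
  have hge : mesh m i ≤ m * m ^ s * mesh m i₀ := by
    have h1 := S.mesh_mul_pow s
    have h2 := S.mesh_mul_pow 1
    have h3 : (1 : ℝ) ≤ m ^ c := one_le_pow₀ (by exact_mod_cast (by omega : 1 ≤ m))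
    have h4 : m * m ^ s * mesh m i₀ = m ^ c * mesh m i := by
      rw [pow_one] at h2
      rw [hmesh]
      linear_combination (m : ℝ) ^ c * mesh m i * (m * mesh m 1) * h1 + (m : ℝ) ^ c * mesh m i * h2
    rw [h4]; nlinarith
  set C : ℝ := 4 * ((D + 2 * η) * m ^ c) with hC
  have hC0 : 0 ≤ C := by positivity
  set t : ℝ := C ^ p * rate m p ^ s * (2 * A * mesh m i) with ht
  have hCp : 0 ≤ C ^ p := Real.rpow_nonneg hC0 p
  -- A geodesic near one point of `Γ` is within a multiple of `mesh m i₀` of all of `Γ`. Relative to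
  -- the scale `i`, this gives a beta number of order `mesh m s`. With the diameter of order `m ^ s
  -- * mesh m i₀`, the ratio `m * rate m p` results.
  have hterm : ∀ f, S.beta Γ (S.adicBall A i (ctr i f)) ^ p *
      Metric.ediam (S.adicBall A i (ctr i f)) ≤ ENNReal.ofReal t := by
    intro f
    have h1 := S.deviation_le_of_edist_le hm hη x (E := Γ) (B := S.adicBall A i (ctr i f))
      (fun y hy => (Metric.edist_le_ediam_of_mem hy.1 hx).trans hdiam) i₀
    rw [← ENNReal.ofReal_add (by positivity) (by positivity), ← add_mul] at h1
    have h2 := S.beta_le hm hη hA (h1.trans (ENNReal.ofReal_le_ofReal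
      (show (D + 2 * η) * mesh m i₀ ≤ ((D + 2 * η) * m ^ c * mesh m s) * mesh m i by
        calc _ ≤ (D + 2 * η) * (m ^ c * mesh m s * mesh m i) :=
              mul_le_mul_of_nonneg_left hle (by positivity)
          _ = _ := by ring)))
    rw [← mul_assoc] at h2
    have h3 := ENNReal.rpow_le_rpow h2 hp.le
    rw [ENNReal.ofReal_rpow_of_nonneg (by positivity) hp.le, Real.mul_rpow hC0 hs0.le,
      mesh_rpow] at h3
    refine (mul_le_mul' h3 (S.ediam_adicBall_le A i (ctr i f))).trans_eq ?_
    rw [← ENNReal.ofReal_mul (by positivity)]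
  -- Only balls that meet `Γ` contribute, and their centers are within a bounded number of edge
  -- lengths of `x`.
  set P : (S.graph i).Edge → Prop := fun f => (Γ ∩ S.adicBall A i (ctr i f)).Nonempty with hP
  obtain ⟨hfin, hcard⟩ := ncard_centers_le hctr (i := i) (R := ⌈D * m ^ c + A⌉₊) P x (by
    rintro f ⟨y, hy, hyB⟩
    have h1 : dist (x.coord i) (y.coord i) ≤ D * mesh m i₀ :=
      (ENNReal.ofReal_le_ofReal_iff (by positivity)).1 ((S.ofReal_dist_coord_le x y i).trans
        ((Metric.edist_le_ediam_of_mem hx hy).trans hdiam))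
    have h2 := S.dist_coord_lt_of_mem_adicBall hyB i
    calc dist (x.coord i) ((ctr i f).coord i) ≤ D * mesh m i₀ + A * mesh m i :=
          (dist_triangle _ (y.coord i) _).trans (add_le_add h1 h2.le)
      _ ≤ D * (m ^ c * mesh m i) + A * mesh m i := by
          linarith [mul_le_mul_of_nonneg_left hle' hD]
      _ = (D * m ^ c + A) * mesh m i := by ring
      _ ≤ _ := mul_le_mul_of_nonneg_right (Nat.le_ceil _) hi0.le)
  rw [scaleSum, tsum_eq_sum (s := hfin.toFinset) (fun f hf => by
    have : Γ ∩ S.adicBall A i (ctr i f) = ∅ := by simpa [hP, not_nonempty_iff_eq_empty] using hf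
    rw [S.beta_eq_zero this, ENNReal.zero_rpow_of_pos hp, zero_mul])]
  refine (Finset.sum_le_card_nsmul _ _ _ fun f _ => hterm f).trans ?_
  rw [← Set.ncard_eq_toFinset_card _ hfin, nsmul_eq_mul, ← ENNReal.ofReal_natCast,
    ← ENNReal.ofReal_mul (Nat.cast_nonneg _)]
  refine ENNReal.ofReal_le_ofReal ?_
  rw [mul_assoc (edgeBound Δ _ : ℝ)]
  refine mul_le_mul (by exact_mod_cast hcard) ?_ (by positivity) (by positivity)
  calc t ≤ C ^ p * rate m p ^ s * (2 * A * (m * m ^ s * mesh m i₀)) := by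
        refine mul_le_mul_of_nonneg_left (mul_le_mul_of_nonneg_left hge ?_) ?_ <;> positivity
    _ = _ := by rw [mul_pow]; ring

/-- The sum over the balls of all large scales. -/
theorem sum_scaleSum_le_of_ediam_le (hm : 2 ≤ m) (hη : 0 ≤ η) {p : ℝ} (hp : 1 < p) {A c : ℕ}
    (hA : 0 < A) {ctr : ∀ n, (S.graph n).Edge → S.Limit} (hctr : S.IsCenterChoice ctr)
    {Γ : Set S.Limit} (hΓ : Γ.Nonempty) {i₀ : ℕ} {D : ℝ} (hD : 0 ≤ D)
    (hdiam : Metric.ediam Γ ≤ ENNReal.ofReal (D * mesh m i₀)) :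
    ∑ i ∈ Finset.range (i₀ + c), S.scaleSum p A ctr Γ i ≤
      ENNReal.ofReal (edgeBound Δ ⌈D * m ^ c + A⌉₊ *
        ((4 * ((D + 2 * η) * m ^ c)) ^ p * (2 * A * m)) * (1 - m * rate m p)⁻¹ * mesh m i₀) := by
  have hθ := rate_pos hm p
  have hρ := mul_rate_lt_one hm hp
  have h0 := S.mesh_pos i₀
  have hCp : 0 ≤ (4 * ((D + 2 * η) * (m : ℝ) ^ c)) ^ p := Real.rpow_nonneg (by positivity) p
  rw [← Finset.sum_range_reflect]
  refine (Finset.sum_le_sum fun s hs => scaleSum_le_of_ediam_le hm hη (by linarith) hA hctr hΓ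
    (show i₀ + c - 1 - s + s + 1 = i₀ + c by have := Finset.mem_range.1 hs; omega) hD hdiam).trans ?_
  rw [← ENNReal.ofReal_sum_of_nonneg fun s _ => by positivity, ← Finset.mul_sum]
  refine ENNReal.ofReal_le_ofReal ?_
  have h1 : ∑ s ∈ Finset.range (i₀ + c), (m * rate m p) ^ s ≤ (1 - m * rate m p)⁻¹ := by
    rw [← one_div]; exact geom_sum_le (by positivity) hρ _
  refine (mul_le_mul_of_nonneg_left h1 (by positivity)).trans_eq (by ring)

end AdmissibleSystem

/-! ### Conclusion -/

namespace AdmissibleSystem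

variable {m : ℕ} {η Δ : ℝ} {S : AdmissibleSystem.{u} m η Δ}

/-- The sum over the balls of all small scales. -/
theorem tsum_scaleSum_le (hm : 2 ≤ m) (hη : 0 ≤ η) {p : ℝ} (hp : 1 < p) {A c : ℕ} (hA : 0 < A)
    (hc : 2 * A + 2 ≤ m ^ c) {ctr : ∀ n, (S.graph n).Edge → S.Limit}
    (hctr : S.IsCenterChoice ctr) {Γ : Set S.Limit} (hΓ : IsConnected Γ) {ℓ : ℝ} (hℓ : 0 ≤ ℓ)
    (hH : Measure.hausdorffMeasure 1 Γ = ENNReal.ofReal ℓ) {i₀ : ℕ}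
    (hdiam : ENNReal.ofReal ((3 + 2 * η) * mesh m i₀) ≤ Metric.ediam Γ) (hi₀ : mesh m i₀ ≤ ℓ) :
    ∑' k, S.scaleSum p A ctr Γ (k + (i₀ + c)) ≤
      ENNReal.ofReal ((4 * (A + 1 + 2 * η) * m ^ c) ^ p * m ^ p * (2 * A) *
        edgeBound Δ ⌈(3 + 2 * η) * m ^ c⌉₊ *
        ((1 / (1 - m * rate m p) + 42 / (1 - m * rate m p) ^ 2) *
          ((2 * edgeBound Δ 1 + 2) * ℓ))) := by
  have hρ := mul_rate_lt_one hm hp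
  have h1ρ : 0 < 1 - m * rate m p := by linarith
  have hCp : 0 ≤ (4 * (A + 1 + 2 * η) * (m : ℝ) ^ c) ^ p := Real.rpow_nonneg (by positivity) p
  have hmp : 0 ≤ (m : ℝ) ^ p := Real.rpow_nonneg (Nat.cast_nonneg m) p
  -- A partial sum involves finitely many scales, for which a covering walk in the graph of level
  -- `i₀ + L` is used. The bound does not depend on `L`.
  refine ENNReal.tsum_le_of_sum_range_le fun L => ?_
  have hJ0 := S.mesh_pos (i₀ + L)
  obtain ⟨H, hHmem, hHcard⟩ := exists_finset_edgesMeeting hm hη hΓ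
    (by rw [hH]; exact ENNReal.ofReal_ne_top) (j := i₀ + L) (by
      -- The initial scale is chosen with `3 + 2 * η`, leaving room for the strict inequality with
      -- `2 + 2 * η`.
      refine lt_of_lt_of_le ?_ hdiam
      have := S.mesh_pos i₀
      refine (ENNReal.ofReal_lt_ofReal_iff (by positivity)).2 ?_
      have := mesh_anti hm (Nat.le_add_right i₀ L)
      nlinarith)
  have hHcard' : H.card * mesh m (i₀ + L) ≤ edgeBound Δ 1 * ℓ := by
    rw [hH, ← ENNReal.ofReal_natCast, ← ENNReal.ofReal_natCast,
      ← ENNReal.ofReal_mul (Nat.cast_nonneg _), ← ENNReal.ofReal_mul (Nat.cast_nonneg _)] at hHcard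
    exact (ENNReal.ofReal_le_ofReal_iff (by positivity)).1 hHcard
  have hHne : H.Nonempty := by
    obtain ⟨x, hx⟩ := hΓ.nonempty
    obtain ⟨f, hf⟩ := S.exists_edge (x.coord (i₀ + L))
    exact ⟨f, (hHmem f).2 ⟨x, hx, hf⟩⟩
  obtain ⟨N, w, e, hrun, hN, h0, hcov⟩ := S.exists_covering_walk i₀ hHne
    fun B hB hBne => edgesMeeting_connected hΓ hHmem hB hBne
  refine (Finset.sum_le_sum_of_subset (Finset.range_mono (Nat.le_succ L))).trans
    ((sum_scaleSum_le hm hη hp hA hc hctr hrun N (fun x hx => ?_) rfl h0).trans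
      (ENNReal.ofReal_le_ofReal ?_))
  · obtain ⟨f, hf⟩ := S.exists_edge (x.coord (i₀ + L))
    obtain ⟨r, hr, hrf⟩ := hcov f ((hHmem f).2 ⟨x, hx, hf⟩)
    exact ⟨r, hr, hrf ▸ hf⟩
  · refine mul_le_mul_of_nonneg_left (mul_le_mul_of_nonneg_left ?_ (by positivity))
      (by positivity)
    -- The walk has scaled length at most `2 * edgeBound Δ 1 * ℓ` plus `mesh m i₀` for the
    -- preliminary ascent. Another `mesh m i₀` is in the bound for the sums, and each is at most
    -- `ℓ`.
    have h1 : (N : ℝ) ≤ 2 * H.card + (m ^ (i₀ + L - i₀) : ℕ) := by exact_mod_cast hN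
    have h2 := S.mesh_eq_pow_mul (Nat.le_add_right i₀ L)
    nlinarith [mul_le_mul_of_nonneg_left h1 hJ0.le]

end AdmissibleSystem

theorem theorem1p5 (m : ℕ) (hm : 2 ≤ m) (η Δ : ℝ) (hη : 0 < η) (hΔ : 0 < Δ)
    (A : ℕ) (hA : 0 < A) (p : ℝ) (hp : 1 < p) :
    ∃ C : ℝ, 0 < C ∧
      ∀ (S : AdmissibleSystem.{u} m η Δ)
        (c : ∀ n, (S.graph n).Edge → S.Limit), S.IsCenterChoice c →
        ∀ Γ : Set S.Limit, IsCompact Γ → IsConnected Γ →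
          ∑' b : (Σ n, (S.graph n).Edge),
              S.beta Γ (S.adicBall A b.1 (c b.1 b.2)) ^ p *
                Metric.ediam (S.adicBall A b.1 (c b.1 b.2)) ≤
            ENNReal.ofReal C * Measure.hausdorffMeasure 1 Γ := by
  obtain ⟨c, hc⟩ : ∃ c, 2 * A + 2 ≤ m ^ c :=
    ⟨2 * A + 2, (Nat.lt_pow_self (by omega : 1 < m)).le⟩
  have h1ρ : 0 < 1 - m * rate m p := by linarith [mul_rate_lt_one hm hp]
  have hmp : 0 ≤ (m : ℝ) ^ p := Real.rpow_nonneg (Nat.cast_nonneg m) p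
  have hCp : 0 ≤ (4 * (A + 1 + 2 * η) * (m : ℝ) ^ c) ^ p := Real.rpow_nonneg (by positivity) p
  have hCp' : 0 ≤ (4 * (((3 + 2 * η) * m + 2 * η) * (m : ℝ) ^ c)) ^ p :=
    Real.rpow_nonneg (by positivity) p
  set C₁ : ℝ := AdmissibleSystem.edgeBound Δ ⌈((3 + 2 * η) * m) * m ^ c + A⌉₊ *
    ((4 * (((3 + 2 * η) * m + 2 * η) * m ^ c)) ^ p * (2 * A * m)) * (1 - m * rate m p)⁻¹ with hC₁
  set C₂ : ℝ := (4 * (A + 1 + 2 * η) * m ^ c) ^ p * m ^ p * (2 * A) *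
    AdmissibleSystem.edgeBound Δ ⌈(3 + 2 * η) * m ^ c⌉₊ *
    ((1 / (1 - m * rate m p) + 42 / (1 - m * rate m p) ^ 2) *
      (2 * AdmissibleSystem.edgeBound Δ 1 + 2)) with hC₂
  have hC₁0 : 0 ≤ C₁ := by positivity
  have hC₂0 : 0 ≤ C₂ := by positivity
  -- The summand `1` makes the constant positive, which is also needed when the length is infinite.
  refine ⟨C₁ + C₂ + 1, by positivity, fun S ctr hctr Γ _ hΓ => ?_⟩
  have hη' := hη.le
  rw [ENNReal.tsum_sigma']
  change ∑' n, S.scaleSum p A ctr Γ n ≤ _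
  rcases eq_or_ne (Metric.ediam Γ) 0 with hd | hd
  · simp [AdmissibleSystem.scaleSum_eq_zero_of_ediam_eq_zero hm hη' (by linarith : 0 < p)
      hΓ.nonempty hd]
  rcases eq_or_ne (Measure.hausdorffMeasure 1 Γ) ∞ with htop | htop
  · rw [htop, ENNReal.mul_top (by simpa using by positivity)]
    exact le_top
  obtain ⟨i₀, hlow, hhigh⟩ :=
    AdmissibleSystem.exists_initial_scale hm hη' (pos_iff_ne_zero.2 hd)
  set ℓ : ℝ := (Measure.hausdorffMeasure 1 Γ).toReal with hℓ
  have hH : Measure.hausdorffMeasure 1 Γ = ENNReal.ofReal ℓ := (ENNReal.ofReal_toReal htop).symm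
  have hℓ0 : 0 ≤ ℓ := ENNReal.toReal_nonneg
  have h0 := S.mesh_pos i₀
  have hi₀ : mesh m i₀ ≤ ℓ := by
    obtain ⟨x, hx⟩ := hΓ.nonempty
    have h1 := AdmissibleSystem.mesh_le_hausdorffMeasure hm hη' hΓ (j := i₀)
      (((ENNReal.ofReal_lt_ofReal_iff (by positivity)).2 (by nlinarith)).trans_le hlow) hx
    exact (ENNReal.ofReal_le_ofReal_iff hℓ0).1 ((h1.trans (measure_mono inter_subset_right)).trans hH.le)
  have hlarge := AdmissibleSystem.sum_scaleSum_le_of_ediam_le (c := c) hm hη' hp hA hctr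
    hΓ.nonempty (by positivity) hhigh
  have hsmall := AdmissibleSystem.tsum_scaleSum_le hm hη' hp hA hc hctr hΓ hℓ0 hH hlow hi₀
  -- The scales are split at `i₀ + c`: a ball of scale `i₀ + c + k` is compared with vertices of
  -- level `i₀ + k`, and `i₀` is the first level at which `Γ` is longer than an edge by the required
  -- factor.
  rw [← ENNReal.summable.sum_add_tsum_nat_add' (k := i₀ + c), hH,
    ← ENNReal.ofReal_mul (by positivity)]
  refine (add_le_add hlarge hsmall).trans ?_
  rw [← ENNReal.ofReal_add (by positivity) (by positivity)]
  refine ENNReal.ofReal_le_ofReal ?_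
  have h2 : C₁ * mesh m i₀ ≤ C₁ * ℓ := mul_le_mul_of_nonneg_left hi₀ hC₁0
  have h3 : C₂ * ℓ = (4 * (A + 1 + 2 * η) * m ^ c) ^ p * m ^ p * (2 * A) *
      AdmissibleSystem.edgeBound Δ ⌈(3 + 2 * η) * m ^ c⌉₊ *
      ((1 / (1 - m * rate m p) + 42 / (1 - m * rate m p) ^ 2) *
        ((2 * AdmissibleSystem.edgeBound Δ 1 + 2) * ℓ)) := by rw [hC₂]; ring
  rw [← h3]
  linarith
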